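/- Let $m_{\rm b}>0$ and let $f\in C_c^\infty(\mathbb R^3)$ be a radial form factor with $\int f\,dx=1$ and $f(x)=0$ for $|x|\ge R_\rho$. For $e\in\mathbb R$ put $\rho=e f$. Consider the Abraham model with zero external potentials ($c=1$, $\gamma(v)=(1-|v|^2)^{-1/2}$): $$\partial_t B=-\nabla\times E,\quad \partial_t E=\nabla\times B-\rho(\cdot-q)\,v,\quad \nabla\cdot E=\rho(\cdot-q),\quad \nabla\cdot B=0,$$ $$\dot q=v,\qquad \frac{d}{dt}\big(m_{\rm b}\gamma(v)v\big)=\int \rho(x-q)\big[E(x,t)+v\times B(x,t)\big]dx .$$ The phase space $\mathcal M$ consists of the states $Y=(E,B,q,v)$ with $E,B\in L^2(\mathbb R^3,\mathbb R^3)$, $q,v\in\mathbb R^3$, $|v|<1$, satisfying the two divergence constraints in the sense of distributions. A solution is a continuous curve $Y:\mathbb R\to\mathcal M$ satisfying the time-integrated equations (the Maxwell equations in the sense of distributions). For $0<\sigma\le1$, $\mathcal M^\sigma$ is the set of $Y\in\mathcal M$ for which there are $R_0>0$ and $C$ such that for $|x|\ge R_0$ the fields are differentiable and $$|E(x)|+|B(x)|+|x|\,\big(|\nabla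 E(x)|+|\nabla B(x)|\big)\le C|x|^{-1-\sigma}.$$ The energy is $\mathcal E(Y)=m_{\rm b}\gamma(v)+\tfrac12\int(|E|^2+|B|^2)\,dx$. For $|v|<1$ the charge soliton fields are $$E_v=-\nabla\phi_v+v\,(v\cdot\nabla\phi_v),\quad B_v=-v\times\nabla\phi_v,\quad \phi_v(x)=\int\frac{\rho(y)\,dy}{4\pi\sqrt{(1-|v|^2)|x-y|^2+(v\cdot(x-y))^2}} .$$ The local energy norm is $\|(E,B)\|_R=\big(\tfrac12\int_{|x|\le R}(|E|^2+|B|^2)\,dx\big)^{1/2}$, and for a solution put $$Z(x,t)=\big(E(x,t)-E_{v(t)}(x-q(t)),\;B(x,t)-B_{v(t)}(x-q(t))\big).$$ **Proposition.** For every $\overline v\in[0,1)$ there is $\overline e>0$, depending only on $\overline v$, $m_{\rm b}$ and $f$, such that the following holds for all $e$ with $|e|\le\overline e$, all $\sigma\in(0,1]$, and every solution $Y$ with $Y(0)\in\mathcal M^\sigma$ and $\mathcal E(Y(0))\le m_{\rm b}(1-\overline v^2)^{-1/2}$: 1. for every $R>0$ there is a constant $C_R$ with $\|Z(\cdot+q(t),t)\|_R\le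 C_R(1+|t|)^{-1-\sigma}$ for all $t\in\mathbb R$; 2. $v$ is differentiable and there is a constant $C$ with $|\dot v(t)|\le C(1+|t|)^{-1-\sigma}$ for all $t\in\mathbb R$; 3. there is $v_\infty$ with $|v_\infty|<1$ and $\lim_{t\to\infty}v(t)=v_\infty$. -/

import Mathlib

open MeasureTheory Filter Topology
open scoped ContDiff RealInnerProductSpace ENNReal

noncomputable section

namespace AbrahamModel

/-- Euclidean three-space. -/
abbrev R3 : Type := EuclideanSpace ℝ (Fin 3)

/-- The real Hilbert space `L²(ℝ³, ℝ³)`. -/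
abbrev L2Field : Type := Lp R3 2 (volume : Measure R3)

/-- The vector product on `ℝ³`. -/
def cross (a b : R3) : R3 := WithLp.toLp 2 (crossProduct a.ofLp b.ofLp)

/-- The partial derivative `∂ᵢ Fⱼ` of a vector field at `x`. -/
def partialDeriv (F : R3 → R3) (i j : Fin 3) (x : R3) : ℝ :=
  fderiv ℝ F x (EuclideanSpace.single i 1) j

/-- The curl `∇ × F` of a (differentiable) vector field. -/
def curl (F : R3 → R3) (x : R3) : R3 :=
  !₂[partialDeriv F 1 2 x - partialDeriv F 2 1 x,
     partialDeriv F 2 0 x - partialDeriv F 0 2 x,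
     partialDeriv F 0 1 x - partialDeriv F 1 0 x]

/-- `γ = (1 - s²)^{-1/2}` as a function of the speed `s`, with the speed of light equal to one. -/
def lorentzFactor (s : ℝ) : ℝ := 1 / Real.sqrt (1 - s ^ 2)

/-- A form factor: smooth, radial, vanishing for `|x| ≥ Rρ`, with integral one. The charge
distribution of total charge `e` with this form factor is `ρ = e f`. -/
structure IsFormFactor (Rρ : ℝ) (f : R3 → ℝ) : Prop where
  smooth : ContDiff ℝ ∞ f
  radial : ∃ fr : ℝ → ℝ, ∀ x, f x = fr ‖x‖
  support : ∀ x, Rρ ≤ ‖x‖ → f x = 0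
  integral_eq_one : ∫ x, f x = 1

/-- The charge distribution `ρ = e f`. -/
def chargeDistribution (e : ℝ) (f : R3 → ℝ) (x : R3) : ℝ := e * f x

/-- A state `Y = (E, B, q, v)`, with square integrable fields. -/
structure State where
  E : L2Field
  B : L2Field
  q : R3
  v : R3

/-- `∇ · F = g` in the sense of distributions. -/
def HasWeakDivergence (F : R3 → R3) (g : R3 → ℝ) : Prop :=
  ∀ φ : R3 → ℝ, ContDiff ℝ ∞ φ → HasCompactSupport φ →
    ∫ x, ⟪F x, gradient φ x⟫ = - ∫ x, g x * φ x

/-- The phase space `𝓜`: finite field energy, `|v| < 1`, and the constraints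
`∇ · E = ρ(· - q)`, `∇ · B = 0`. -/
def phaseSpace (ρ : R3 → ℝ) : Set State :=
  {Y | ‖Y.v‖ < 1 ∧ HasWeakDivergence Y.E (fun x => ρ (x - Y.q)) ∧
    HasWeakDivergence Y.B (fun _ => 0)}

/-- The good subset `𝓜^σ` of the phase space: outside some ball the fields are (represented by)
differentiable functions with
`|E(x)| + |B(x)| + |x| (|∇E(x)| + |∇B(x)|) ≤ C |x|^{-1-σ}`. -/
def goodPhaseSpace (ρ : R3 → ℝ) (σ : ℝ) : Set State :=
  {Y | Y ∈ phaseSpace ρ ∧ ∃ E B : R3 → R3, Y.E =ᵐ[volume] E ∧ Y.B =ᵐ[volume] B ∧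
    ∃ R₀ C : ℝ, 0 < R₀ ∧ ∀ x : R3, R₀ ≤ ‖x‖ →
      DifferentiableAt ℝ E x ∧ DifferentiableAt ℝ B x ∧
      ‖E x‖ + ‖B x‖ + ‖x‖ * (‖fderiv ℝ E x‖ + ‖fderiv ℝ B x‖) ≤ C * ‖x‖ ^ (-1 - σ)}

/-- The energy `m_b γ(v) + ½ ∫ (E² + B²)` (without external potentials). -/
def energy (mb : ℝ) (Y : State) : ℝ :=
  mb * lorentzFactor ‖Y.v‖ + (1 / 2) * ∫ x, (‖Y.E x‖ ^ 2 + ‖Y.B x‖ ^ 2)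

/-- The Lorentz force `∫ ρ(x - q) (E(x) + v × B(x)) dx` exerted on the charge by the field. -/
def lorentzForce (ρ : R3 → ℝ) (Y : State) : R3 :=
  ∫ x, ρ (x - Y.q) • (Y.E x + cross Y.v (Y.B x))

/-- `t ↦ Y(t)`, `t ∈ ℝ`, is a finite energy solution of the Abraham model without external
potentials: a continuous curve in the phase space satisfying the time-integrated equations of
motion; the time-integrated Maxwell equations `∂ₜE = ∇ × B - ρ(· - q) v`, `∂ₜB = - ∇ × E` are
understood in the sense of distributions in `x`. -/
structure IsSolution (mb : ℝ) (ρ : R3 → ℝ) (Y : ℝ → State) : Prop where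
  mem_phaseSpace : ∀ t, Y t ∈ phaseSpace ρ
  continuous_E : Continuous fun t => (Y t).E
  continuous_B : Continuous fun t => (Y t).B
  continuous_q : Continuous fun t => (Y t).q
  continuous_v : Continuous fun t => (Y t).v
  maxwell_E : ∀ η : R3 → R3, ContDiff ℝ ∞ η → HasCompactSupport η → ∀ t : ℝ,
    ∫ x, ⟪(Y t).E x, η x⟫ = (∫ x, ⟪(Y 0).E x, η x⟫) +
      ∫ s in (0 : ℝ)..t, ((∫ x, ⟪(Y s).B x, curl η x⟫) -
        ∫ x, ρ (x - (Y s).q) * ⟪(Y s).v, η x⟫)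
  maxwell_B : ∀ η : R3 → R3, ContDiff ℝ ∞ η → HasCompactSupport η → ∀ t : ℝ,
    ∫ x, ⟪(Y t).B x, η x⟫ = (∫ x, ⟪(Y 0).B x, η x⟫) -
      ∫ s in (0 : ℝ)..t, ∫ x, ⟪(Y s).E x, curl η x⟫
  position : ∀ t : ℝ, (Y t).q = (Y 0).q + ∫ s in (0 : ℝ)..t, (Y s).v
  momentum : ∀ t : ℝ, (mb * lorentzFactor ‖(Y t).v‖) • (Y t).v =
    (mb * lorentzFactor ‖(Y 0).v‖) • (Y 0).v + ∫ s in (0 : ℝ)..t, lorentzForce ρ (Y s)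

/-- The scalar potential of the charge soliton with velocity `v`,
`φ_v(x) = ∫ (4π √(γ⁻² (x-y)² + (v·(x-y))²))⁻¹ ρ(y) dy`, where `γ⁻² = 1 - v²`. -/
def solitonPotential (ρ : R3 → ℝ) (v x : R3) : ℝ :=
  ∫ y, (4 * Real.pi *
    Real.sqrt ((1 - ‖v‖ ^ 2) * ‖x - y‖ ^ 2 + ⟪v, x - y⟫ ^ 2))⁻¹ * ρ y

/-- The electric soliton field `E_v = - ∇φ_v + v (v · ∇φ_v)`. -/
def solitonE (ρ : R3 → ℝ) (v x : R3) : R3 :=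
  - gradient (solitonPotential ρ v) x + ⟪v, gradient (solitonPotential ρ v) x⟫ • v

/-- The magnetic soliton field `B_v = - v × ∇φ_v`. -/
def solitonB (ρ : R3 → ℝ) (v x : R3) : R3 :=
  - cross v (gradient (solitonPotential ρ v) x)

/-- The local energy norm `‖(E, B)‖_R = (½ ∫_{|x| ≤ R} (E² + B²))^{1/2}`. -/
def localEnergyNorm (R : ℝ) (E B : R3 → R3) : ℝ≥0∞ :=
  ((1 / 2) * ∫⁻ x in Metric.closedBall (0 : R3) R, (‖E x‖ₑ ^ 2 + ‖B x‖ₑ ^ 2)) ^ (1 / 2 : ℝ)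

/-- First component of the deviation `Z(x) = (E(x) - E_v(x - q), B(x) - B_v(x - q))` of the
fields of a state from its comoving charge soliton. -/
def deviationE (ρ : R3 → ℝ) (Y : State) (x : R3) : R3 := Y.E x - solitonE ρ Y.v (x - Y.q)

/-- Second component of the deviation from the comoving charge soliton. -/
def deviationB (ρ : R3 → ℝ) (Y : State) (x : R3) : R3 := Y.B x - solitonB ρ Y.v (x - Y.q)

end AbrahamModel

end

/-!
Speeds stay below `vbar`. The solution is only weak, so the conservation of energy is replaced by
an inequality: for mollified fields the Poynting identity holds pointwise, and with a spatial
cut-off only the derivative of the cut-off contributes a flux (`integral_poynting`). Removing the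
mollification and the cut-off yields `m γ(v(t)) ≤ ℰ(Y(0))` (`IsSolution.kinetic_energy_le`), hence
`|v(t)| ≤ vbar < 1` for `t ≥ 0` (`IsSolution.norm_v_le`). The charge therefore leaves the backward
light cone of any ball that moves with it after a bounded time `T`
(`IsSolution.norm_le_of_wave_ne_zero`).

Retarded representation. For a test function `χ`, Kirchhoff's formula `u(τ, x) = τ M_τ χ(x)`, with
the spherical mean `M_τ`, solves the wave equation with data `u = 0`, `∂_τ u = χ`
(`wave_equation`). The fields `∂_τ u a` and `∇u × a` at `τ = t - s` form an adjoint solution of the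
Maxwell equations up to a gradient, which the divergence constraint turns into a source
(`hasDerivAt_pair_wave`). So `∫ E(t) · χ a` is the sum of a contribution of the data at time `0` and
an integral of the retarded sources against `u` (`IsSolution.hasDerivAt_retE`,
`IsSolution.hasDerivAt_retB`). Working with test functions throughout avoids all questions of
regularity of the fields.
* The data contribute `O((1 + t)^(-1-σ))`: `u(t, ·)` lives in a shell around the sphere of radius
  `t` about the charge, where `|x|` is comparable to `t`, and integration by parts moves the
  derivative of `u` to the data (`abs_pair_wave_le`, `IsSolution.exists_data_bound`).
* The soliton fields are the retarded fields of a charge in uniform motion: the map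
  `y ↦ y - |y| v` from retarded to present relative positions has Jacobian
  `1 - y · v / |y|`, and it turns the soliton kernel into `1 / (4π|y|)` (`integral_solKer`,
  `integral_mul_solitonPotential`).
* Over the time span `[t - T, t]` the sources differ from those of the uniform motion with
  velocity `v(t)` by the charge times the maximum of `|v̇|` on that span.

Together the fields near the charge deviate from the comoving soliton by at most
`D (1 + t)^(-1-σ)` plus a multiple of `sup |v̇|` over `[t - T, t]`
(`IsSolution.exists_deviation_bound`).

Decay. As `ρ` is even, the soliton exerts no force on its own charge
(`integral_soliton_mul_charge`), so Newton's law gives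
`|v̇(t)| ≤ D (1 + t)^(-1-σ) + θ sup_[t-T,t] |v̇|` with `θ = O(e²)`. When `θ (1 + T)² ≤ 1/2` this
forces `|v̇(t)| = O((1 + t)^(-1-σ))` (`exists_decay_of_retarded`,
`IsSolution.exists_acceleration_bound`). The smallness of `e` depends on `T`, hence only on `vbar`,
`m` and `f`. The deviation bound, read by duality between `L¹` and `L^∞`
(`ae_abs_le_of_integral_mul_le`), then bounds the local energy norm
(`IsSolution.exists_localEnergyNorm_bound`); here `T` depends on the radius `R`, but no further
smallness is needed. Since `1 + σ > 1` the acceleration is integrable and the velocity has a limit.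
Negative times follow by time reversal (`IsSolution.reverse`, `localEnergyNorm_reverse`).
-/

noncomputable section

namespace AbrahamModel

/-! ### Directional derivatives and test functions -/

section DirectionalDerivative

variable {E : Type*} [NormedAddCommGroup E] [NormedSpace ℝ E]

/-- The derivative of `g` in the direction `b`. -/
def dd (b : E) (g : E → ℝ) (x : E) : ℝ := fderiv ℝ g x b

lemma contDiff_dd {g : E → ℝ} (hg : ContDiff ℝ ∞ g) (b : E) : ContDiff ℝ ∞ (dd b g) :=
  (hg.fderiv_right (m := ∞) (by simp)).clm_apply contDiff_const

lemma dd_comm {g : E → ℝ} (hg : ContDiff ℝ ∞ g) (a b : E) : dd a (dd b g) = dd b (dd a g) := by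
  funext x
  have h2 : ∀ c d : E, dd c (dd d g) x = fderiv ℝ (fderiv ℝ g) x c d := by
    intro c d
    have : DifferentiableAt ℝ (fderiv ℝ g) x :=
      ((hg.fderiv_right (m := ∞) (by simp)).differentiable (by simp)) x
    have := (this.hasFDerivAt.clm_apply (hasFDerivAt_const d x)).fderiv
    unfold dd
    rw [this]
    simp
  rw [h2, h2]
  exact (hg.contDiffAt.isSymmSndFDerivAt
    (by simpa using WithTop.coe_le_coe.2 (le_top (a := (2 : ℕ∞))))).eq a b

lemma dd_eq_zero_of_notMem_tsupport {g : E → ℝ} {x : E} (hx : x ∉ tsupport g) (b : E) :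
    dd b g x = 0 := by
  unfold dd
  rw [fderiv_of_notMem_tsupport ℝ hx]; simp

lemma hasCompactSupport_dd {g : E → ℝ} (hg : HasCompactSupport g) (b : E) :
    HasCompactSupport (dd b g) := hg.fderiv_apply ℝ b

/-- Smooth functions with compact support. -/
structure IsTest (g : E → ℝ) : Prop where
  smooth : ContDiff ℝ ∞ g
  compact : HasCompactSupport g

lemma IsTest.dd {g : E → ℝ} (hg : IsTest g) (b : E) : IsTest (dd b g) :=
  ⟨contDiff_dd hg.smooth b, hasCompactSupport_dd hg.compact b⟩

lemma IsTest.continuous {g : E → ℝ} (hg : IsTest g) : Continuous g := hg.smooth.continuous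

lemma IsTest.differentiable {g : E → ℝ} (hg : IsTest g) : Differentiable ℝ g :=
  hg.smooth.differentiable (by simp)

lemma IsTest.add {g h : E → ℝ} (hg : IsTest g) (hh : IsTest h) : IsTest (fun x => g x + h x) :=
  ⟨hg.smooth.add hh.smooth, hg.compact.add hh.compact⟩

lemma IsTest.const_mul {g : E → ℝ} (hg : IsTest g) (c : ℝ) : IsTest (fun x => c * g x) :=
  ⟨contDiff_const.mul hg.smooth, hg.compact.mul_left⟩

lemma IsTest.comp_sub {g : E → ℝ} (hg : IsTest g) (q : E) : IsTest (fun x => g (x - q)) := by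
  refine ⟨hg.smooth.comp (contDiff_id.sub contDiff_const), ?_⟩
  have := hg.compact.comp_homeomorph (Homeomorph.addRight (-q))
  simpa [Function.comp_def, sub_eq_add_neg] using this

lemma IsTest.comp_const_sub {g : E → ℝ} (hg : IsTest g) (q : E) : IsTest (fun x => g (q - x)) := by
  refine ⟨hg.smooth.comp (contDiff_const.sub contDiff_id), ?_⟩
  have := hg.compact.comp_homeomorph ((Homeomorph.neg E).trans (Homeomorph.addLeft q))
  simpa [Function.comp_def, sub_eq_add_neg] using this

lemma dd_comp_sub {g : E → ℝ} (b q x : E) : dd b (fun y => g (y - q)) x = dd b g (x - q) := by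
  unfold dd; rw [fderiv_comp_sub]

lemma dd_comp_const_sub {g : E → ℝ} (hg : Differentiable ℝ g) (b q x : E) :
    dd b (fun y => g (q - y)) x = - dd b g (q - x) := by
  unfold dd
  have h : HasFDerivAt (fun y => q - y) (-(ContinuousLinearMap.id ℝ E)) x :=
    (hasFDerivAt_id x).const_sub q
  have := ((hg (q - x)).hasFDerivAt.comp x h).fderiv
  simp only [Function.comp_def] at this
  rw [this]; simp

lemma IsTest.exists_bound {g : E → ℝ} (hg : IsTest g) : ∃ C, 0 < C ∧ ∀ x, |g x| ≤ C := by
  obtain ⟨C, hC⟩ := hg.compact.exists_bound_of_continuous hg.continuous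
  exact ⟨max C 1, by positivity, fun x => (hC x).trans (le_max_left _ _)⟩

lemma IsTest.exists_radius {g : E → ℝ} (hg : IsTest g) : ∃ r, 0 < r ∧ ∀ x, g x ≠ 0 → ‖x‖ ≤ r := by
  obtain ⟨r, hr⟩ := hg.compact.isCompact.isBounded.exists_norm_le
  exact ⟨max r 1, by positivity, fun x hx => (hr x (subset_tsupport _ hx)).trans (le_max_left _ _)⟩

end DirectionalDerivative

/-! ### Integrals depending on a parameter -/

section Parametric

variable {α : Type*} [TopologicalSpace α]

/-- A jointly continuous family of functions that vanish off one compact set for all parameters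
near `s₀` is dominated near `s₀` by a multiple of the indicator of that set; this is the majorant
for continuity of, and differentiation under, the integral. -/
lemma exists_bound_near_of_compact_support {F : Type*} [NormedAddCommGroup F] {H : ℝ → α → F}
    (hH : Continuous (Function.uncurry H))
    {s₀ δ : ℝ} {K : Set α} (hK : IsCompact K)
    (hsupp : ∀ s, |s - s₀| < δ → ∀ x ∉ K, H s x = 0) :
    ∃ C, ∀ s, |s - s₀| < δ → ∀ x, ‖H s x‖ ≤ K.indicator (fun _ => C) x := by
  have hc : IsCompact (Metric.closedBall s₀ δ ×ˢ K) := (isCompact_closedBall _ _).prod hK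
  obtain ⟨C, hC⟩ := hc.exists_bound_of_continuousOn hH.continuousOn
  refine ⟨C, fun s hs x => ?_⟩
  by_cases hx : x ∈ K
  · rw [Set.indicator_of_mem hx]
    exact hC (s, x) ⟨by rw [Metric.mem_closedBall, Real.dist_eq]; exact hs.le, hx⟩
  · rw [Set.indicator_of_notMem hx, hsupp s hs x hx]; simp

variable [MeasurableSpace α] [BorelSpace α] [T2Space α] [SecondCountableTopologyEither α ℝ]

lemma continuousAt_integral_of_compact_support {μ : Measure α} [IsFiniteMeasureOnCompacts μ]
    {H : ℝ → α → ℝ} (hH : Continuous (Function.uncurry H)) {s₀ δ : ℝ} (hδ : 0 < δ) {K : Set α}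
    (hK : IsCompact K) (hsupp : ∀ s, |s - s₀| < δ → ∀ x ∉ K, H s x = 0) :
    ContinuousAt (fun s => ∫ x, H s x ∂μ) s₀ := by
  obtain ⟨C, hC⟩ := exists_bound_near_of_compact_support hH hK hsupp
  have hnear : ∀ᶠ s in 𝓝 s₀, |s - s₀| < δ := Metric.ball_mem_nhds s₀ hδ
  refine continuousAt_of_dominated (bound := K.indicator (fun _ => C)) ?_ ?_ ?_ ?_
  · exact Eventually.of_forall fun s => (hH.uncurry_left s).aestronglyMeasurable
  · filter_upwards [hnear] with s hs using Eventually.of_forall (hC s hs)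
  · exact (integrable_indicator_iff hK.measurableSet).2 (integrableOn_const hK.measure_lt_top.ne)
  · exact Eventually.of_forall fun x => (hH.uncurry_right x).continuousAt

lemma hasDerivAt_integral_of_compact_support {μ : Measure α} [IsFiniteMeasureOnCompacts μ]
    {H H' : ℝ → α → ℝ} (hH : Continuous (Function.uncurry H))
    (hH' : Continuous (Function.uncurry H'))
    (hd : ∀ s x, HasDerivAt (fun r => H r x) (H' s x) s) {s₀ δ : ℝ} (hδ : 0 < δ) {K : Set α}
    (hK : IsCompact K) (hsupp : ∀ s, |s - s₀| < δ → ∀ x ∉ K, H s x = 0) :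
    HasDerivAt (fun s => ∫ x, H s x ∂μ) (∫ x, H' s₀ x ∂μ) s₀ := by
  -- the derivative inherits the support, as `H` vanishes for an open set of parameters
  have hsupp' : ∀ s, |s - s₀| < δ → ∀ x ∉ K, H' s x = 0 := by
    intro s hs x hx
    have h0 : (fun r => H r x) =ᶠ[𝓝 s] fun _ => 0 := by
      have : ∀ᶠ r in 𝓝 s, |r - s₀| < δ := by
        have : Continuous fun r : ℝ => |r - s₀| := by fun_prop
        exact this.continuousAt.eventually_lt continuousAt_const hs
      filter_upwards [this] with r hr using hsupp r hr x hx
    exact (hd s x).unique ((hasDerivAt_const s (0 : ℝ)).congr_of_eventuallyEq h0)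
  obtain ⟨C, hC⟩ := exists_bound_near_of_compact_support hH hK hsupp
  obtain ⟨C', hC'⟩ := exists_bound_near_of_compact_support hH' hK hsupp'
  have hint : ∀ c : ℝ, Integrable (K.indicator (fun _ => c)) μ := fun c =>
    (integrable_indicator_iff hK.measurableSet).2 (integrableOn_const hK.measure_lt_top.ne)
  refine (hasDerivAt_integral_of_dominated_loc_of_deriv_le (bound := K.indicator (fun _ => C'))
    (Metric.ball_mem_nhds s₀ hδ) ?_ ?_ ?_ ?_ (hint _) ?_).2
  · exact Eventually.of_forall fun s => (hH.uncurry_left s).aestronglyMeasurable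
  · exact Integrable.mono' (hint C) (hH.uncurry_left s₀).aestronglyMeasurable
      (Eventually.of_forall (hC s₀ (by simpa using hδ)))
  · exact (hH'.uncurry_left s₀).aestronglyMeasurable
  · exact Eventually.of_forall fun x s hs => hC' s hs x
  · exact Eventually.of_forall fun x s _ => hd s x

end Parametric

/-! ### Vector algebra and the curl -/

/-- The standard basis of `ℝ³`. -/
abbrev ee (i : Fin 3) : R3 := EuclideanSpace.single i 1

lemma inner_ee (x : R3) (i : Fin 3) : ⟪x, ee i⟫ = x i := by
  simp [ee, EuclideanSpace.inner_single_right]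

lemma cross_apply (a b : R3) : cross a b =
    !₂[a 1 * b 2 - a 2 * b 1, a 2 * b 0 - a 0 * b 2, a 0 * b 1 - a 1 * b 0] := by
  unfold cross
  rw [_root_.cross_apply]

lemma norm_cross_le (a b : R3) : ‖cross a b‖ ≤ ‖a‖ * ‖b‖ := by
  refine le_of_sq_le_sq ?_ (by positivity)
  rw [mul_pow, EuclideanSpace.norm_sq_eq, EuclideanSpace.norm_sq_eq, EuclideanSpace.norm_sq_eq,
    cross_apply]
  simp only [Fin.sum_univ_three, Real.norm_eq_abs, sq_abs]
  simp
  nlinarith [sq_nonneg (a 0 * b 0 + a 1 * b 1 + a 2 * b 2)]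

lemma cross_neg_left (a b : R3) : cross (-a) b = - cross a b := by
  ext i; fin_cases i <;> simp [cross_apply] <;> ring

lemma cross_neg_right (a b : R3) : cross a (-b) = - cross a b := by
  ext i; fin_cases i <;> simp [cross_apply] <;> ring

lemma inner_cross_rotate (a b c : R3) : ⟪cross a b, c⟫ = ⟪b, cross c a⟫ := by
  simp [PiLp.inner_apply, Fin.sum_univ_three, cross_apply]; ring

lemma norm_ee (i : Fin 3) : ‖ee i‖ = 1 := by simp [ee]

/-- Expansion of a linear functional in the coordinates of its argument. -/
lemma fderiv_eq_sum (L : R3 →L[ℝ] ℝ) (b : R3) : L b = ∑ i, b i * L (ee i) := by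
  conv_lhs => rw [← (EuclideanSpace.basisFun (Fin 3) ℝ).sum_repr b]
  simp [map_sum, ee]

lemma dd_eq_sum (b : R3) (g : R3 → ℝ) (x : R3) : dd b g x = ∑ i, b i * dd (ee i) g x :=
  fderiv_eq_sum _ _

lemma gradient_apply (g : R3 → ℝ) (x : R3) (i : Fin 3) : gradient g x i = dd (ee i) g x := by
  rw [← inner_ee]
  unfold gradient dd
  rw [InnerProductSpace.toDual_symm_apply]

lemma inner_gradient (g : R3 → ℝ) (x a : R3) : ⟪gradient g x, a⟫ = dd a g x := by
  unfold gradient dd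
  rw [InnerProductSpace.toDual_symm_apply]

/-- The curl of `g a` is `∇g × a`, written as a sum over the standard basis. -/
lemma curl_smul_const {g : R3 → ℝ} (hg : Differentiable ℝ g) (a x : R3) :
    curl (fun y => g y • a) x = ∑ i, dd (ee i) g x • cross (ee i) a := by
  have h : ∀ i j, partialDeriv (fun y => g y • a) i j x = dd (ee i) g x * a j := by
    intro i j
    unfold partialDeriv dd
    rw [((hg x).hasFDerivAt.smul_const a).fderiv]
    simp
  ext k
  unfold curl
  simp only [h]
  fin_cases k <;> simp [Fin.sum_univ_three, cross_apply] <;> ring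

lemma cross_cross_ee (i j : Fin 3) (a : R3) :
    cross (ee j) (cross (ee i) a) = a j • ee i - (if i = j then (1 : ℝ) else 0) • a := by
  ext k
  fin_cases i <;> fin_cases j <;> fin_cases k <;> simp [cross_apply]

lemma vec_eq_sum (a : R3) : a = ∑ i, a i • ee i := by
  conv_lhs => rw [← (EuclideanSpace.basisFun (Fin 3) ℝ).sum_repr a]
  simp [ee]

/-! ### Pairing square integrable fields with test fields -/

/-- The pairing of the field `F` with the test field `g a`. -/
def pair (F : L2Field) (a : R3) (g : R3 → ℝ) : ℝ := ∫ x, ⟪F x, g x • a⟫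

lemma memLp_smul_const {g : R3 → ℝ} (hg : Continuous g) (hc : HasCompactSupport g) (a : R3) :
    MemLp (fun x => g x • a) 2 (volume : Measure R3) :=
  (hg.smul continuous_const).memLp_of_hasCompactSupport (hc.smul_right (f' := fun _ => a))

lemma pair_eq_inner {g : R3 → ℝ} (hg : Continuous g) (hc : HasCompactSupport g) (a : R3)
    (F : L2Field) : pair F a g = ⟪F, (memLp_smul_const hg hc a).toLp⟫ := by
  rw [L2.inner_def]
  refine integral_congr_ae ?_
  filter_upwards [(memLp_smul_const hg hc a).coeFn_toLp] with x hx
  rw [hx]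

lemma integrable_pair {g : R3 → ℝ} (hg : Continuous g) (hc : HasCompactSupport g) (a : R3)
    (F : L2Field) : Integrable (fun x => ⟪F x, g x • a⟫) := by
  refine (L2.integrable_inner (𝕜 := ℝ) F (memLp_smul_const hg hc a).toLp).congr ?_
  filter_upwards [(memLp_smul_const hg hc a).coeFn_toLp] with x hx
  rw [hx]

lemma pair_smul_right (F : L2Field) (c : ℝ) (a : R3) (g : R3 → ℝ) :
    pair F (c • a) g = c * pair F a g := by
  unfold pair
  rw [← integral_const_mul]
  congr 1; funext x
  rw [smul_comm, inner_smul_right]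

lemma pair_add_right {g : R3 → ℝ} (hg : Continuous g) (hc : HasCompactSupport g) (F : L2Field)
    (a b : R3) : pair F (a + b) g = pair F a g + pair F b g := by
  unfold pair
  rw [← integral_add (integrable_pair hg hc a F) (integrable_pair hg hc b F)]
  congr 1; funext x
  rw [smul_add, inner_add_right]

lemma pair_neg_right (F : L2Field) (a : R3) (g : R3 → ℝ) : pair F (-a) g = - pair F a g := by
  have := pair_smul_right F (-1) a g
  simpa using this

lemma pair_sum_right {ι : Type*} (s : Finset ι) {g : R3 → ℝ} (hg : Continuous g)
    (hc : HasCompactSupport g) (F : L2Field) (a : ι → R3) :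
    pair F (∑ i ∈ s, a i) g = ∑ i ∈ s, pair F (a i) g := by
  unfold pair
  rw [← integral_finsetSum _ (fun i _ => integrable_pair hg hc (a i) F)]
  simp [Finset.smul_sum, inner_sum]

lemma pair_mul (F : L2Field) (c : ℝ) (a : R3) (g : R3 → ℝ) :
    pair F a (fun x => c * g x) = c * pair F a g := by
  unfold pair
  rw [← integral_const_mul]
  congr 1; funext x
  rw [mul_smul, inner_smul_right]

lemma pair_add {g h : R3 → ℝ} (hg : Continuous g) (hc : HasCompactSupport g) (hh : Continuous h)
    (hc' : HasCompactSupport h) (F : L2Field) (a : R3) :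
    pair F a (fun x => g x + h x) = pair F a g + pair F a h := by
  unfold pair
  rw [← integral_add (integrable_pair hg hc a F) (integrable_pair hh hc' a F)]
  congr 1; funext x
  rw [add_smul, inner_add_right]

lemma pair_fun_sum {ι : Type*} (s : Finset ι) {g : ι → R3 → ℝ} (hg : ∀ i, Continuous (g i))
    (hc : ∀ i, HasCompactSupport (g i)) (F : L2Field) (a : R3) :
    pair F a (fun x => ∑ i ∈ s, g i x) = ∑ i ∈ s, pair F a (g i) := by
  unfold pair
  rw [← integral_finsetSum _ (fun i _ => integrable_pair (hg i) (hc i) a F)]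
  simp [Finset.sum_smul, inner_sum]

lemma pair_congr (F : L2Field) (a : R3) {g h : R3 → ℝ} (H : ∀ x, g x = h x) :
    pair F a g = pair F a h := by
  unfold pair; simp only [H]

/-- The square root of the volume of a ball: the norm of its indicator function in `L²`. -/
def ballRoot (r : ℝ) : ℝ := ((volume (Metric.closedBall (0 : R3) r)) ^ (1 / 2 : ℝ)).toReal

lemma ballRoot_nonneg (r : ℝ) : 0 ≤ ballRoot r := ENNReal.toReal_nonneg

/-- The Cauchy–Schwarz inequality against a bounded test function supported in a ball. -/
lemma abs_pair_le {g : R3 → ℝ} (hg : Continuous g) {r c : ℝ} (hc : 0 ≤ c)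
    (hsupp : ∀ x, g x ≠ 0 → ‖x‖ ≤ r) (hb : ∀ x, |g x| ≤ c) (F : L2Field) (a : R3) :
    |pair F a g| ≤ ‖F‖ * (c * ‖a‖ * ballRoot r) := by
  have hcs : HasCompactSupport g := by
    refine HasCompactSupport.intro (isCompact_closedBall (0 : R3) r) fun x hx => ?_
    by_contra h
    exact hx (by simpa using hsupp x h)
  rw [pair_eq_inner hg hcs]
  refine (abs_real_inner_le_norm _ _).trans ?_
  gcongr
  rw [Lp.norm_toLp]
  set η : R3 → R3 := fun x => g x • a
  have hs : Function.support η ⊆ Metric.closedBall 0 r := by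
    intro x hx
    have : g x ≠ 0 := by rintro h; simp [η, h] at hx
    simpa using hsupp x this
  rw [← eLpNorm_restrict_eq_of_support_subset hs]
  have h1 : eLpNorm η 2 (volume.restrict (Metric.closedBall 0 r)) ≤
      (volume.restrict (Metric.closedBall (0 : R3) r)) Set.univ ^ (ENNReal.toReal 2)⁻¹ *
        ENNReal.ofReal (c * ‖a‖) := by
    refine eLpNorm_le_of_ae_bound (Eventually.of_forall fun x => ?_)
    rw [norm_smul]
    gcongr
    exact hb x
  rw [Measure.restrict_apply_univ] at h1
  have hfin : volume (Metric.closedBall (0 : R3) r) ≠ ⊤ := measure_closedBall_lt_top.ne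
  have h2 := ENNReal.toReal_mono (ENNReal.mul_ne_top
    (ENNReal.rpow_ne_top_of_nonneg (by simp) hfin) ENNReal.ofReal_ne_top) h1
  rw [ENNReal.toReal_mul, ENNReal.toReal_ofReal (by positivity)] at h2
  unfold ballRoot
  rw [show (ENNReal.toReal 2)⁻¹ = (1 / 2 : ℝ) by simp] at h2
  linarith

lemma continuous_pair {X : Type*} [TopologicalSpace X] {F : X → L2Field} (hF : Continuous F)
    {g : R3 → ℝ} (hg : Continuous g) (hc : HasCompactSupport g) (a : R3) : Continuous fun s => pair (F s) a g := by
  simp only [pair_eq_inner hg hc]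
  fun_prop

/-! ### Curves of test functions -/

/-- A smooth function of time and space whose support in space is bounded locally uniformly
in time. -/
structure IsTestCurve (W : ℝ × R3 → ℝ) : Prop where
  smooth : ContDiff ℝ ∞ W
  supp : ∀ T : ℝ, ∃ r : ℝ, ∀ s x, |s| ≤ T → W (s, x) ≠ 0 → ‖x‖ ≤ r

lemma IsTestCurve.continuous {W : ℝ × R3 → ℝ} (hW : IsTestCurve W) : Continuous W :=
  hW.smooth.continuous

lemma IsTestCurve.dd {W : ℝ × R3 → ℝ} (hW : IsTestCurve W) (b : ℝ × R3) :
    IsTestCurve (dd b W) := by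
  refine ⟨contDiff_dd hW.smooth b, fun T => ?_⟩
  obtain ⟨r, hr⟩ := hW.supp (T + 1)
  refine ⟨r, fun s x hs h => ?_⟩
  by_contra hx
  push Not at hx
  refine h (dd_eq_zero_of_notMem_tsupport ?_ b)
  rw [notMem_tsupport_iff_eventuallyEq]
  have h1 : ∀ᶠ p : ℝ × R3 in 𝓝 (s, x), |p.1| < T + 1 ∧ r < ‖p.2‖ := by
    refine (ContinuousAt.eventually_lt (by fun_prop) continuousAt_const (by simp; linarith)).and
      (ContinuousAt.eventually_lt continuousAt_const (by fun_prop) hx)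
  filter_upwards [h1] with p hp
  by_contra h0
  exact absurd (hr p.1 p.2 hp.1.le h0) (not_le.2 hp.2)

lemma IsTestCurve.slice {W : ℝ × R3 → ℝ} (hW : IsTestCurve W) (s : ℝ) :
    IsTest fun x => W (s, x) := by
  refine ⟨hW.smooth.comp (contDiff_const.prodMk contDiff_id), ?_⟩
  obtain ⟨r, hr⟩ := hW.supp |s|
  refine HasCompactSupport.intro (isCompact_closedBall (0 : R3) r) fun x hx => ?_
  by_contra h
  exact hx (by simpa using hr s x le_rfl h)

lemma IsTestCurve.dd_slice {W : ℝ × R3 → ℝ} (hW : IsTestCurve W) (b : R3) (s : ℝ) (x : R3) :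
    AbrahamModel.dd b (fun y => W (s, y)) x = AbrahamModel.dd (0, b) W (s, x) := by
  unfold AbrahamModel.dd
  have h1 : HasFDerivAt (fun y : R3 => (s, y)) (ContinuousLinearMap.inr ℝ ℝ R3) x :=
    hasFDerivAt_prodMk_right s x
  have := ((hW.smooth.differentiable (by simp) (s, x)).hasFDerivAt.comp x h1).fderiv
  simp only [Function.comp_def] at this
  rw [this]; simp

lemma IsTestCurve.dd_slice_fun {W : ℝ × R3 → ℝ} (hW : IsTestCurve W) (b : R3) (s : ℝ) :
    AbrahamModel.dd b (fun y => W (s, y)) = fun x => AbrahamModel.dd (0, b) W (s, x) :=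
  funext fun x => hW.dd_slice b s x

lemma IsTestCurve.hasDerivAt_time {W : ℝ × R3 → ℝ} (hW : IsTestCurve W) (s : ℝ) (x : R3) :
    HasDerivAt (fun r => W (r, x)) (AbrahamModel.dd (1, 0) W (s, x)) s := by
  have h1 : HasDerivAt (fun r : ℝ => (r, x)) (1, 0) s :=
    (hasDerivAt_id s).prodMk (hasDerivAt_const s x)
  exact (hW.smooth.differentiable (by simp) (s, x)).hasFDerivAt.comp_hasDerivAt s h1

lemma IsTestCurve.reflect {W : ℝ × R3 → ℝ} (hW : IsTestCurve W) (t : ℝ) :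
    IsTestCurve fun p => W (t - p.1, p.2) := by
  refine ⟨hW.smooth.comp ((contDiff_const.sub contDiff_fst).prodMk contDiff_snd), fun T => ?_⟩
  obtain ⟨r, hr⟩ := hW.supp (|t| + T)
  exact ⟨r, fun s x hs h => hr _ x ((abs_sub _ _).trans (by gcongr)) h⟩

lemma IsTestCurve.dd_reflect {W : ℝ × R3 → ℝ} (hW : IsTestCurve W) (t s : ℝ) (x : R3) :
    AbrahamModel.dd (1, 0) (fun p : ℝ × R3 => W (t - p.1, p.2)) (s, x) =
      - AbrahamModel.dd (1, 0) W (t - s, x) := by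
  have h1 := (hW.reflect t).hasDerivAt_time s x
  have h2 : HasDerivAt (fun r => t - r) (-1) s := by
    simpa using (hasDerivAt_id s).const_sub t
  have h3 := (hW.hasDerivAt_time (t - s) x).comp s h2
  have := h1.unique h3
  simpa using this

/-- Uniform differentiability in time of a curve of test functions. -/
lemma IsTestCurve.uniform_remainder {W : ℝ × R3 → ℝ} (hW : IsTestCurve W) (s₀ : ℝ) {ε : ℝ}
    (hε : 0 < ε) : ∃ δ > 0, ∀ s, |s - s₀| < δ → ∀ x,
      |W (s, x) - W (s₀, x) - (s - s₀) * AbrahamModel.dd (1, 0) W (s₀, x)| ≤ ε * |s - s₀| := by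
  obtain ⟨r, hr⟩ := (hW.dd (1, 0)).supp (|s₀| + 1)
  have huc : UniformContinuousOn (AbrahamModel.dd (1, 0) W)
      (Metric.closedBall s₀ 1 ×ˢ Metric.closedBall (0 : R3) r) :=
    ((isCompact_closedBall _ _).prod (isCompact_closedBall _ _)).uniformContinuousOn_of_continuous
      (hW.dd (1, 0)).continuous.continuousOn
  obtain ⟨δ, hδ, hd⟩ := Metric.uniformContinuousOn_iff.1 huc ε hε
  have key : ∀ s, |s - s₀| < min δ 1 → ∀ x,
      |AbrahamModel.dd (1, 0) W (s, x) - AbrahamModel.dd (1, 0) W (s₀, x)| ≤ ε := by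
    intro s hs x
    have hs1 : |s - s₀| < 1 := hs.trans_le (min_le_right _ _)
    have hsabs : |s| ≤ |s₀| + 1 := by
      have := abs_add_le (s - s₀) s₀
      rw [sub_add_cancel] at this; linarith
    by_cases hx : ‖x‖ ≤ r
    · have := hd (s, x) ⟨by rw [Metric.mem_closedBall, Real.dist_eq]; exact hs1.le, by simpa using hx⟩
        (s₀, x) ⟨by simp, by simpa using hx⟩
        (by
          rw [Prod.dist_eq]; simp only [dist_self]
          rw [max_eq_left dist_nonneg, Real.dist_eq]
          exact hs.trans_le (min_le_left _ _))
      rw [Real.dist_eq] at this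
      exact this.le
    · have h1 : AbrahamModel.dd (1, 0) W (s, x) = 0 := by
        by_contra h; exact hx (hr s x hsabs h)
      have h2 : AbrahamModel.dd (1, 0) W (s₀, x) = 0 := by
        by_contra h; exact hx (hr s₀ x (by linarith) h)
      rw [h1, h2]; simpa using hε.le
  refine ⟨min δ 1, by positivity, fun s hs x => ?_⟩
  have hconv : Convex ℝ (Metric.ball s₀ (min δ 1)) := convex_ball _ _
  have := hconv.norm_image_sub_le_of_norm_hasDerivWithin_le
    (f := fun s => W (s, x) - s * AbrahamModel.dd (1, 0) W (s₀, x))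
    (f' := fun s => AbrahamModel.dd (1, 0) W (s, x) - 1 * AbrahamModel.dd (1, 0) W (s₀, x))
    (C := ε) (x := s₀) (y := s)
    (fun u _ => ((hW.hasDerivAt_time u x).sub ((hasDerivAt_id u).mul_const _)).hasDerivWithinAt)
    (fun u hu => by
      rw [one_mul]
      exact key u (by simpa [Real.dist_eq] using hu) x)
    (Metric.mem_ball_self (by positivity)) (by rw [Metric.mem_ball, Real.dist_eq]; exact hs)
  rw [Real.norm_eq_abs, Real.norm_eq_abs] at this
  convert this using 2
  ring

/-- Product rule for the pairing of a norm continuous, weakly differentiable curve of fields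
with a curve of test functions. -/
lemma hasDerivAt_pair {F : ℝ → L2Field} (hF : Continuous F) {W : ℝ × R3 → ℝ} (hW : IsTestCurve W)
    (a : R3) {s₀ d : ℝ} (hd : HasDerivAt (fun s => pair (F s) a fun x => W (s₀, x)) d s₀) :
    HasDerivAt (fun s => pair (F s) a fun x => W (s, x))
      (d + pair (F s₀) a fun x => dd (1, 0) W (s₀, x)) s₀ := by
  obtain ⟨r₁, hr₁⟩ := hW.supp (|s₀| + 1)
  obtain ⟨r₂, hr₂⟩ := (hW.dd (1, 0)).supp (|s₀| + 1)
  set r := max r₁ r₂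
  set D : R3 → ℝ := fun x => dd (1, 0) W (s₀, x)
  have hD : IsTest D := (hW.dd (1, 0)).slice s₀
  -- the remainder of the first order expansion of `W`, paired with `F s`
  have hrem : HasDerivAt (fun s => pair (F s) a
      (fun x => W (s, x) + (-1 * W (s₀, x) + -(s - s₀) * D x))) 0 s₀ := by
    rw [hasDerivAt_iff_isLittleO, Asymptotics.isLittleO_iff]
    intro c hc
    obtain ⟨M, hM⟩ : ∃ M, 0 ≤ M ∧ ∀ s ∈ Metric.closedBall s₀ 1, ‖F s‖ ≤ M := by
      obtain ⟨M, hM⟩ := (isCompact_closedBall s₀ 1).exists_bound_of_continuousOn hF.continuousOn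
      exact ⟨max M 0, le_max_right _ _, fun s hs => (hM s hs).trans (le_max_left _ _)⟩
    set N := M * (‖a‖ * ballRoot r) + 1
    have hN : 0 < N := by have := ballRoot_nonneg r; have := hM.1; positivity
    obtain ⟨δ, hδ, hb⟩ := hW.uniform_remainder s₀ (ε := c / N) (by positivity)
    have hnear : ∀ᶠ s in 𝓝 s₀, |s - s₀| < min δ 1 :=
      Metric.ball_mem_nhds s₀ (by positivity : 0 < min δ 1)
    filter_upwards [hnear] with s hs
    have hs1 : |s - s₀| < 1 := hs.trans_le (min_le_right _ _)
    have hsabs : |s| ≤ |s₀| + 1 := by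
      have := abs_add_le (s - s₀) s₀
      rw [sub_add_cancel] at this; linarith
    have hz : pair (F s₀) a (fun x => W (s₀, x) + (-1 * W (s₀, x) + -(s₀ - s₀) * D x)) = 0 := by
      unfold pair; simp
    rw [hz]
    have hest := abs_pair_le (g := fun x => W (s, x) + (-1 * W (s₀, x) + -(s - s₀) * D x))
      ((hW.slice s).add (((hW.slice s₀).const_mul (-1)).add (hD.const_mul _))).continuous
      (r := r) (c := c / N * |s - s₀|) (by positivity)
      (fun x hx => by
        by_contra h
        push Not at h
        have h1 : W (s, x) = 0 := by
          by_contra h'; exact absurd (hr₁ s x hsabs h') (not_le.2 ((le_max_left _ _).trans_lt h))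
        have h2 : W (s₀, x) = 0 := by
          by_contra h'
          exact absurd (hr₁ s₀ x (by linarith) h') (not_le.2 ((le_max_left _ _).trans_lt h))
        have h3 : D x = 0 := by
          by_contra h'
          exact absurd (hr₂ s₀ x (by linarith) h') (not_le.2 ((le_max_right _ _).trans_lt h))
        exact hx (by simp [h1, h2, h3]))
      (fun x => by
        have := hb s (hs.trans_le (min_le_left _ _)) x
        convert this using 2
        ring)
      (F s) a
    simp only [smul_zero, sub_zero, Real.norm_eq_abs]
    refine hest.trans ?_
    have hFs : ‖F s‖ ≤ M := hM.2 s (by rw [Metric.mem_closedBall, Real.dist_eq]; exact hs1.le)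
    have hb0 := ballRoot_nonneg r
    calc ‖F s‖ * (c / N * |s - s₀| * ‖a‖ * ballRoot r)
        ≤ M * (c / N * |s - s₀| * ‖a‖ * ballRoot r) := by gcongr
      _ = c / N * (M * (‖a‖ * ballRoot r)) * |s - s₀| := by ring
      _ ≤ c / N * N * |s - s₀| := by gcongr; simp [N]
      _ = c * |s - s₀| := by field_simp
  -- the linear term only needs continuity of `F`, as its coefficient vanishes at `s₀`
  have hlin : HasDerivAt (fun s => (s - s₀) * pair (F s) a D) (pair (F s₀) a D) s₀ := by
    have hcont : Continuous fun s => pair (F s) a D := continuous_pair hF hD.continuous hD.compact a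
    rw [hasDerivAt_iff_tendsto_slope]
    refine (hcont.continuousAt.tendsto.mono_left nhdsWithin_le_nhds).congr' ?_
    filter_upwards [self_mem_nhdsWithin] with s hs
    have : s - s₀ ≠ 0 := sub_ne_zero.2 hs
    simp [slope_def_field]; field_simp
  have := (hrem.add hd).add hlin
  refine (this.congr_deriv (by ring)).congr_of_eventuallyEq (Eventually.of_forall fun s => ?_)
  have h1 := hW.slice s
  have h2 := (hW.slice s₀).const_mul (-1)
  have h3 := hD.const_mul (-(s - s₀))
  have h4 := h2.add h3
  simp only [Pi.add_apply]
  rw [pair_add h1.continuous h1.compact h4.continuous h4.compact,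
    pair_add h2.continuous h2.compact h3.continuous h3.compact, pair_mul, pair_mul]
  ring

/-! ### Polar coordinates and spherical means -/

/-- The unit sphere of `ℝ³`. -/
abbrev S2 : Type := Metric.sphere (0 : R3) 1

/-- The surface measure of the unit sphere. -/
abbrev sph : Measure S2 := (volume : Measure R3).toSphere

lemma norm_S2 (w : S2) : ‖(w : R3)‖ = 1 := by simp

lemma sph_real_univ : sph.real Set.univ = 4 * Real.pi := by
  rw [Measure.toSphere_real_apply_univ]
  simp only [Measure.real, EuclideanSpace.volume_ball_fin_three]
  simp
  rw [ENNReal.toReal_ofReal (by positivity)]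
  ring

lemma integrable_polar {h : R3 → ℝ} (hi : Integrable h) :
    Integrable (fun p : S2 × Set.Ioi (0 : ℝ) => h ((p.2 : ℝ) • (p.1 : R3)))
      (sph.prod (Measure.volumeIoiPow 2)) := by
  have mp := (volume : Measure R3).measurePreserving_homeomorphUnitSphereProd
  have hfr : Module.finrank ℝ R3 - 1 = 2 := by simp
  rw [hfr] at mp
  rw [← mp.integrable_comp_emb (Homeomorph.measurableEmbedding _)]
  have : (fun p : S2 × Set.Ioi (0 : ℝ) => h ((p.2 : ℝ) • (p.1 : R3))) ∘
      (homeomorphUnitSphereProd R3) = h ∘ (Subtype.val : ({0}ᶜ : Set R3) → R3) := by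
    funext z
    have hz : ‖(z : R3)‖ ≠ 0 := norm_ne_zero_iff.2 z.2
    simp [smul_smul, hz]
  rw [this, ← integrableOn_iff_comap_subtypeVal (measurableSet_singleton _).compl]
  exact hi.integrableOn

/-- Integration in polar coordinates. -/
lemma integral_polar {h : R3 → ℝ} (hi : Integrable h) :
    ∫ z, h z = ∫ r in Set.Ioi (0 : ℝ), r ^ 2 * ∫ w : S2, h (r • (w : R3)) ∂sph := by
  have mp := (volume : Measure R3).measurePreserving_homeomorphUnitSphereProd
  have hfr : Module.finrank ℝ R3 - 1 = 2 := by simp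
  rw [hfr] at mp
  calc ∫ z, h z = ∫ z : ({(0)}ᶜ : Set R3), h z ∂(volume.comap Subtype.val) := by
        rw [integral_subtype_comap (measurableSet_singleton _).compl h, restrict_compl_singleton]
    _ = ∫ p : S2 × Set.Ioi (0 : ℝ), h ((p.2 : ℝ) • (p.1 : R3))
          ∂(sph.prod (Measure.volumeIoiPow 2)) := by
        rw [← mp.integral_comp (Homeomorph.measurableEmbedding _)]
        congr 1; funext z
        have hz : ‖(z : R3)‖ ≠ 0 := norm_ne_zero_iff.2 z.2
        simp [smul_smul, hz]
    _ = ∫ r : Set.Ioi (0 : ℝ), ∫ w : S2, h ((r : ℝ) • (w : R3)) ∂sph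
          ∂(Measure.volumeIoiPow 2) := integral_prod_symm _ (integrable_polar hi)
    _ = _ := by
      simp only [Measure.volumeIoiPow, ENNReal.ofReal]
      rw [integral_withDensity_eq_integral_smul,
        integral_subtype_comap measurableSet_Ioi fun a : ℝ =>
          Real.toNNReal (a ^ 2) • ∫ w : S2, h (a • (w : R3)) ∂sph]
      · refine setIntegral_congr_fun measurableSet_Ioi fun r hr => ?_
        simp only [NNReal.smul_def, smul_eq_mul]
        rw [Real.coe_toNNReal _ (by positivity)]
      · exact (measurable_subtype_coe.pow_const _).real_toNNReal

/-- The mean of `χ` over the sphere with centre `x` and radius `τ`, as a function of `(τ, x)`. -/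
def sphMean (χ : R3 → ℝ) (p : ℝ × R3) : ℝ :=
  (4 * Real.pi)⁻¹ * ∫ w : S2, χ (p.2 + p.1 • (w : R3)) ∂sph

/-- Spherical means are smooth: the integral over the sphere is a convolution at the origin,
with the surface measure as underlying measure and a cut-off that equals one on the sphere. -/
lemma contDiff_sphMean {χ : R3 → ℝ} (hχ : ContDiff ℝ ∞ χ) : ContDiff ℝ ∞ (sphMean χ) := by
  set b : ContDiffBump (0 : R3) := ⟨2, 3, by norm_num, by norm_num⟩
  set μ : Measure R3 := sph.map (fun w : S2 => (w : R3))
  have : IsFiniteMeasure μ := by unfold μ; infer_instance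
  have hconv := contDiffOn_convolution_right_with_param_comp (μ := μ) (n := (⊤ : ℕ∞))
    (ContinuousLinearMap.mul ℝ ℝ) (s := (Set.univ : Set (ℝ × R3))) (v := fun _ => (0 : R3))
    contDiffOn_const (f := fun _ => (1 : ℝ))
    (g := fun (p : ℝ × R3) (z : R3) => χ (p.2 - p.1 • z) * b z) (k := Metric.closedBall 0 3)
    isOpen_univ (isCompact_closedBall _ _)
    (fun p z _ hz => by
      have : b z = 0 := b.zero_of_le_dist (by
        have : ¬ dist z 0 ≤ 3 := by simpa using hz
        exact (not_le.1 this).le)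
      simp [this])
    (locallyIntegrable_const _)
    (by
      apply ContDiff.contDiffOn
      refine ContDiff.mul (hχ.comp ?_) (b.contDiff.comp contDiff_snd)
      fun_prop)
  rw [contDiffOn_univ] at hconv
  have hmul := (contDiff_const (c := (4 * Real.pi)⁻¹)).mul hconv
  refine cast (congrArg (ContDiff ℝ ∞) (funext fun p => ?_)) hmul
  symm
  unfold sphMean
  congr 1
  simp only [convolution_def, ContinuousLinearMap.mul_apply', one_mul, zero_sub, smul_neg,
    sub_neg_eq_add]
  rw [integral_map (by fun_prop) (by
    refine Continuous.aestronglyMeasurable ?_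
    have := b.continuous
    have := hχ.continuous
    fun_prop)]
  refine integral_congr_ae (Eventually.of_forall fun w => ?_)
  have : b (-(w : R3)) = 1 := b.one_of_mem_closedBall (by simp [b])
  simp [this]

lemma dd_sphMean {χ : R3 → ℝ} (hχ : ContDiff ℝ ∞ χ) (b : R3) (p : ℝ × R3) :
    dd (0, b) (sphMean χ) p = sphMean (dd b χ) p := by
  have h1 : HasDerivAt (fun h : ℝ => sphMean χ (p + h • ((0 : ℝ), b)))
      (dd (0, b) (sphMean χ) p) 0 := by
    have := ((contDiff_sphMean hχ).differentiable (by simp) p).hasFDerivAt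
    exact this.hasLineDerivAt _
  have h2 : HasDerivAt (fun h : ℝ => sphMean χ (p + h • ((0 : ℝ), b)))
      (sphMean (dd b χ) p) 0 := by
    have hk := hasDerivAt_integral_of_compact_support (μ := sph)
      (H := fun h w => χ (p.2 + h • b + p.1 • (w : R3)))
      (H' := fun h w => dd b χ (p.2 + h • b + p.1 • (w : R3)))
      (by have := hχ.continuous; fun_prop)
      (by have := (contDiff_dd hχ b).continuous; fun_prop)
      (fun s w => by
        have hl : HasDerivAt (fun h : ℝ => p.2 + h • b + p.1 • (w : R3)) b s := by
          simpa using (((hasDerivAt_id s).smul_const b).const_add p.2).add_const (p.1 • (w : R3))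
        exact (hχ.differentiable (by simp) _).hasFDerivAt.comp_hasDerivAt s hl)
      (s₀ := 0) one_pos isCompact_univ (fun _ _ x hx => absurd (Set.mem_univ x) hx)
    have := hk.const_mul (4 * Real.pi)⁻¹
    simpa [sphMean] using this
  exact h1.unique h2

/-- The radial derivative of a spherical mean is the mean of the outward normal derivative. -/
lemma dd_time_sphMean {χ : R3 → ℝ} (hχ : ContDiff ℝ ∞ χ) (p : ℝ × R3) :
    dd (1, 0) (sphMean χ) p =
      (4 * Real.pi)⁻¹ * ∫ w : S2, dd (w : R3) χ (p.2 + p.1 • (w : R3)) ∂sph := by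
  obtain ⟨τ, x⟩ := p
  have h1 : HasDerivAt (fun r : ℝ => sphMean χ (r, x)) (dd (1, 0) (sphMean χ) (τ, x)) τ := by
    have hl : HasDerivAt (fun r : ℝ => (r, x)) (1, 0) τ :=
      (hasDerivAt_id τ).prodMk (hasDerivAt_const τ x)
    exact ((contDiff_sphMean hχ).differentiable (by simp) (τ, x)).hasFDerivAt.comp_hasDerivAt τ hl
  have hk := hasDerivAt_integral_of_compact_support (μ := sph)
    (H := fun r w => χ (x + r • (w : R3)))
    (H' := fun r w => dd (w : R3) χ (x + r • (w : R3)))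
    (by have := hχ.continuous; fun_prop)
    (by
      unfold dd
      have : Continuous (fderiv ℝ χ) := hχ.continuous_fderiv (by simp)
      refine Continuous.clm_apply (this.comp ?_) ?_ <;> fun_prop)
    (fun s w => by
      have hl : HasDerivAt (fun h : ℝ => x + h • (w : R3)) (w : R3) s := by
        simpa using ((hasDerivAt_id s).smul_const (w : R3)).const_add x
      exact (hχ.differentiable (by simp) _).hasFDerivAt.comp_hasDerivAt s hl)
    (s₀ := τ) one_pos isCompact_univ (fun _ _ x hx => absurd (Set.mem_univ x) hx)
  exact h1.unique (hk.const_mul (4 * Real.pi)⁻¹)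

lemma sphMean_ne_zero {χ : R3 → ℝ} {p : ℝ × R3} (h : sphMean χ p ≠ 0) :
    ∃ w : S2, χ (p.2 + p.1 • (w : R3)) ≠ 0 := by
  by_contra hc
  push Not at hc
  exact h (by simp [sphMean, hc])

lemma sphMean_zero (χ : R3 → ℝ) (x : R3) : sphMean χ (0, x) = χ x := by
  simp only [sphMean, zero_smul, add_zero, integral_const, sph_real_univ, smul_eq_mul]
  field_simp

lemma isTestCurve_sphMean {χ : R3 → ℝ} (hχ : IsTest χ) : IsTestCurve (sphMean χ) := by
  refine ⟨contDiff_sphMean hχ.smooth, fun T => ?_⟩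
  obtain ⟨r, _, hr⟩ := hχ.exists_radius
  refine ⟨r + T, fun s x hs h => ?_⟩
  obtain ⟨w, hw⟩ := sphMean_ne_zero h
  have h1 := hr _ hw
  have h2 : ‖s • (w : R3)‖ = |s| := by rw [norm_smul, norm_S2]; simp
  have h3 := norm_sub_le (x + s • (w : R3)) (s • (w : R3))
  rw [add_sub_cancel_right] at h3
  simp only at h1
  linarith

/-- The Laplace operator. -/
def lap (χ : R3 → ℝ) (x : R3) : ℝ := ∑ i, dd (ee i) (dd (ee i) χ) x

lemma contDiff_lap {χ : R3 → ℝ} (hχ : ContDiff ℝ ∞ χ) : ContDiff ℝ ∞ (lap χ) :=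
  ContDiff.sum fun _ _ => contDiff_dd (contDiff_dd hχ _) _

lemma contDiff_comp_norm {θ : ℝ → ℝ} (hθ : ContDiff ℝ ∞ θ) (hs : tsupport θ ⊆ Set.Ioi 0) :
    ContDiff ℝ ∞ fun z : R3 => θ ‖z‖ := by
  rw [contDiff_iff_contDiffAt]
  intro z
  by_cases hz : z = 0
  · have h0 : (0 : ℝ) ∉ tsupport θ := fun h => lt_irrefl (0 : ℝ) (hs h)
    have h1 := notMem_tsupport_iff_eventuallyEq.1 h0
    have h2 : (fun z : R3 => θ ‖z‖) =ᶠ[𝓝 z] fun _ => 0 := by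
      have : Tendsto (fun z : R3 => ‖z‖) (𝓝 z) (𝓝 0) := by
        subst hz; simpa using (continuous_norm (E := R3)).tendsto 0
      exact this.eventually h1
    exact contDiffAt_const.congr_of_eventuallyEq h2
  · exact hθ.contDiffAt.comp z (contDiffAt_norm ℝ hz)

/-- Weak form of the Darboux equation: Green's identity for `χ (x + ·)` and a radial cut-off. -/
lemma darboux_weak {χ : R3 → ℝ} (hχ : ContDiff ℝ ∞ χ) (x : R3) {θ : ℝ → ℝ}
    (hθ : ContDiff ℝ ∞ θ) (hc : HasCompactSupport θ) (hs : tsupport θ ⊆ Set.Ioi 0) :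
    ∫ r in Set.Ioi (0 : ℝ), r ^ 2 * (θ r * sphMean (lap χ) (r, x)) =
      - ∫ r in Set.Ioi (0 : ℝ), r ^ 2 * (deriv θ r * dd (1, 0) (sphMean χ) (r, x)) := by
  set Θ : R3 → ℝ := fun z => θ ‖z‖ with hΘdef
  have hΘ : ContDiff ℝ ∞ Θ := contDiff_comp_norm hθ hs
  have hΘc : HasCompactSupport Θ := by
    obtain ⟨r, hr⟩ := hc.isCompact.isBounded.exists_norm_le
    refine HasCompactSupport.intro (isCompact_closedBall (0 : R3) r) fun z hz => ?_
    by_contra h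
    exact hz (by simpa using hr ‖z‖ (subset_tsupport _ h))
  have hdΘ : ∀ (b z : R3), z ≠ 0 → dd b Θ z = deriv θ ‖z‖ * (‖z‖⁻¹ * ⟪z, b⟫) := by
    intro b z hz
    have h1 : HasFDerivAt (fun z : R3 => ‖z‖) (‖z‖⁻¹ • innerSL ℝ z) z := by
      have := ((hasStrictFDerivAt_norm_sq z).hasFDerivAt.sqrt (by simpa using hz))
      simp only [Real.sqrt_sq (norm_nonneg _)] at this
      refine this.congr_fderiv ?_
      ext w; simp; field_simp
    have h2 := ((hθ.differentiable (by simp) ‖z‖).hasDerivAt.comp_hasFDerivAt z h1).fderiv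
    simp only [Function.comp_def] at h2
    unfold dd
    rw [hΘdef, h2]; simp
  set G : Fin 3 → R3 → ℝ := fun i z => dd (ee i) χ (x + z)
  have hG : ∀ i, ContDiff ℝ ∞ (G i) := fun i =>
    (contDiff_dd hχ (ee i)).comp (contDiff_const.add contDiff_id)
  have hddG : ∀ i z, fderiv ℝ (G i) z (ee i) = dd (ee i) (dd (ee i) χ) (x + z) := by
    intro i z
    simp only [G]
    rw [fderiv_comp_add_left]; rfl
  have hcG : ∀ i, Continuous fun z => fderiv ℝ (G i) z (ee i) := fun i =>
    ((hG i).continuous_fderiv (by simp)).clm_apply continuous_const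
  have hcΘ : ∀ i, Continuous (dd (ee i) Θ) := fun i => (contDiff_dd hΘ _).continuous
  have hint1 : ∀ i, Integrable fun z => Θ z * fderiv ℝ (G i) z (ee i) := fun i =>
    (hΘ.continuous.mul (hcG i)).integrable_of_hasCompactSupport hΘc.mul_right
  have hint2 : ∀ i, Integrable fun z => dd (ee i) Θ z * G i z := fun i =>
    ((hcΘ i).mul (hG i).continuous).integrable_of_hasCompactSupport
      (hasCompactSupport_dd hΘc _).mul_right
  have hparts : ∀ i, ∫ z, Θ z * fderiv ℝ (G i) z (ee i) = - ∫ z, dd (ee i) Θ z * G i z := fun i =>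
    integral_mul_fderiv_eq_neg_fderiv_mul_of_integrable (hint2 i) (hint1 i)
      ((hΘ.continuous.mul (hG i).continuous).integrable_of_hasCompactSupport hΘc.mul_right)
      (fun z _ => hΘ.differentiable (by simp) z) (fun z _ => (hG i).differentiable (by simp) z)
  have hsum : ∫ z, Θ z * lap χ (x + z) = - ∫ z, ∑ i, dd (ee i) Θ z * G i z := by
    have e1 : ∀ z, Θ z * lap χ (x + z) = ∑ i, Θ z * fderiv ℝ (G i) z (ee i) := fun z => by
      simp only [lap, hddG, Finset.mul_sum]
    simp only [e1]
    rw [integral_finsetSum _ fun i _ => hint1 i, integral_finsetSum _ fun i _ => hint2 i,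
      ← Finset.sum_neg_distrib]
    exact Finset.sum_congr rfl fun i _ => hparts i
  rw [integral_polar, integral_polar] at hsum
  · -- in polar coordinates, where `∇Θ = θ'(|z|) z / |z|`, both sides become spherical means
    have l1 : ∀ r ∈ Set.Ioi (0 : ℝ),
        r ^ 2 * ∫ w : S2, Θ (r • (w : R3)) * lap χ (x + r • (w : R3)) ∂sph
        = (4 * Real.pi) * (r ^ 2 * (θ r * sphMean (lap χ) (r, x))) := by
      intro r hr
      have hr' : 0 < r := hr
      simp only [hΘdef, norm_smul, norm_S2, Real.norm_eq_abs, abs_of_pos hr', mul_one, sphMean]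
      rw [integral_const_mul]
      field_simp
    have l2 : ∀ r ∈ Set.Ioi (0 : ℝ), r ^ 2 * ∫ w : S2, ∑ i, dd (ee i) Θ (r • (w : R3)) *
          G i (r • (w : R3)) ∂sph
        = (4 * Real.pi) * (r ^ 2 * (deriv θ r * dd (1, 0) (sphMean χ) (r, x))) := by
      intro r hr
      have hr' : 0 < r := hr
      rw [dd_time_sphMean hχ]
      have e2 : ∀ w : S2, ∑ i, dd (ee i) Θ (r • (w : R3)) * G i (r • (w : R3)) =
          deriv θ r * dd (w : R3) χ (x + r • (w : R3)) := by
        intro w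
        have hne : r • (w : R3) ≠ 0 := by
          rw [← norm_pos_iff, norm_smul, norm_S2]; simpa using hr'.ne'
        rw [dd_eq_sum (w : R3), Finset.mul_sum]
        refine Finset.sum_congr rfl fun i _ => ?_
        rw [hdΘ _ _ hne, norm_smul, norm_S2, Real.norm_eq_abs, abs_of_pos hr', mul_one,
          inner_ee]
        simp [G]; field_simp
      simp only [e2]
      rw [integral_const_mul]
      field_simp
    rw [setIntegral_congr_fun measurableSet_Ioi l1, setIntegral_congr_fun measurableSet_Ioi l2,
      integral_const_mul, integral_const_mul] at hsum
    have h4 : (4 * Real.pi) ≠ 0 := by positivity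
    apply mul_left_cancel₀ h4
    linarith
  · exact integrable_finsetSum _ fun i _ => hint2 i
  · refine (hΘ.continuous.mul ?_).integrable_of_hasCompactSupport hΘc.mul_right
    have := (contDiff_lap hχ).continuous
    fun_prop

/-- The solution `u(τ, x) = τ M_τ χ(x)` of the wave equation with data `u = 0`, `∂_τ u = χ`. -/
def wave (χ : R3 → ℝ) (p : ℝ × R3) : ℝ := p.1 * sphMean χ p

lemma isTestCurve_wave {χ : R3 → ℝ} (hχ : IsTest χ) : IsTestCurve (wave χ) := by
  have h := isTestCurve_sphMean hχ
  refine ⟨contDiff_fst.mul h.smooth, fun T => ?_⟩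
  obtain ⟨r, hr⟩ := h.supp T
  exact ⟨r, fun s x hs hne => hr s x hs (right_ne_zero_of_mul hne)⟩

lemma dd_time_wave {χ : R3 → ℝ} (hχ : ContDiff ℝ ∞ χ) (p : ℝ × R3) :
    dd (1, 0) (wave χ) p = sphMean χ p + p.1 * dd (1, 0) (sphMean χ) p := by
  have h := ((contDiff_sphMean hχ).differentiable (by simp) p).hasFDerivAt
  have := ((hasFDerivAt_fst (𝕜 := ℝ) (p := p)).mul h).fderiv
  unfold dd
  have e : wave χ = Prod.fst * sphMean χ := rfl
  rw [e, this]; simp; ring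

lemma dd_space_wave {χ : R3 → ℝ} (hχ : ContDiff ℝ ∞ χ) (b : R3) (p : ℝ × R3) :
    dd (0, b) (wave χ) p = wave (dd b χ) p := by
  have h := ((contDiff_sphMean hχ).differentiable (by simp) p).hasFDerivAt
  have := ((hasFDerivAt_fst (𝕜 := ℝ) (p := p)).mul h).fderiv
  have e : wave χ = Prod.fst * sphMean χ := rfl
  rw [wave, ← dd_sphMean hχ]
  unfold dd
  rw [e, this]; simp

lemma wave_zero (χ : R3 → ℝ) (x : R3) : wave χ (0, x) = 0 := by simp [wave]

lemma dd_time_wave_zero {χ : R3 → ℝ} (hχ : ContDiff ℝ ∞ χ) (x : R3) :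
    dd (1, 0) (wave χ) (0, x) = χ x := by
  rw [dd_time_wave hχ]; simp [sphMean_zero]

/-- The Darboux equation `∂_r (r² ∂_r M) = r² M(Δχ)` for spherical means. -/
lemma darboux {χ : R3 → ℝ} (hχ : ContDiff ℝ ∞ χ) (x : R3) {r : ℝ} (hr : 0 < r) :
    2 * r * dd (1, 0) (sphMean χ) (r, x) + r ^ 2 * dd (1, 0) (dd (1, 0) (sphMean χ)) (r, x) =
      r ^ 2 * sphMean (lap χ) (r, x) := by
  have hm := contDiff_sphMean hχ
  have hN : ContDiff ℝ ∞ (dd (1, 0) (sphMean χ)) := contDiff_dd hm _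
  have hline : ∀ s : ℝ, HasDerivAt (fun r : ℝ => (r, x)) (1, 0) s := fun s =>
    (hasDerivAt_id s).prodMk (hasDerivAt_const s x)
  set ψ : ℝ → ℝ := fun r => 2 * r * dd (1, 0) (sphMean χ) (r, x) +
    r ^ 2 * dd (1, 0) (dd (1, 0) (sphMean χ)) (r, x) - r ^ 2 * sphMean (lap χ) (r, x) with hψ
  have hd : ∀ s, HasDerivAt (fun r : ℝ => r ^ 2 * dd (1, 0) (sphMean χ) (r, x))
      (2 * s * dd (1, 0) (sphMean χ) (s, x) +
        s ^ 2 * dd (1, 0) (dd (1, 0) (sphMean χ)) (s, x)) s := by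
    intro s
    have h1 := (hN.differentiable (by simp) (s, x)).hasFDerivAt.comp_hasDerivAt s (hline s)
    have h2 := (hasDerivAt_pow 2 s).mul h1
    refine h2.congr_deriv ?_
    simp [dd]
  have hNc : Continuous fun r : ℝ => dd (1, 0) (sphMean χ) (r, x) :=
    hN.continuous.comp (by fun_prop)
  have hN'c : Continuous fun r : ℝ => dd (1, 0) (dd (1, 0) (sphMean χ)) (r, x) :=
    (contDiff_dd hN _).continuous.comp (by fun_prop)
  have hLc : Continuous fun r : ℝ => sphMean (lap χ) (r, x) :=
    (contDiff_sphMean (contDiff_lap hχ)).continuous.comp (by fun_prop)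
  have hψc : Continuous ψ := by fun_prop
  have hae := isOpen_Ioi.ae_eq_zero_of_integral_contDiff_smul_eq_zero (U := Set.Ioi (0 : ℝ))
    (μ := volume) (f := ψ) (hψc.locallyIntegrable.locallyIntegrableOn _) ?_
  · -- the two sides agree almost everywhere, hence everywhere by continuity
    have hdense : ψ r = 0 := by
      have h1 : ψ =ᵐ[volume.restrict (Set.Ioi 0)] fun _ => (0 : ℝ) := by
        rw [EventuallyEq, ae_restrict_iff' measurableSet_Ioi]
        exact hae
      have := Measure.eqOn_open_of_ae_eq h1 isOpen_Ioi hψc.continuousOn continuousOn_const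
      exact this hr
    simp only [hψ] at hdense
    linarith
  · intro θ hθ hc hs
    have hdw := darboux_weak hχ x hθ hc hs
    have hθ' : Continuous (deriv θ) := hθ.continuous_deriv (by simp)
    have hset : ∀ F : ℝ → ℝ, ∫ r, θ r • F r = ∫ r in Set.Ioi (0 : ℝ), θ r * F r := by
      intro F
      rw [setIntegral_eq_integral_of_forall_compl_eq_zero]
      · simp
      · intro s hs'
        have : θ s = 0 := by
          by_contra h
          exact hs' (hs (subset_tsupport _ h))
        simp [this]
    have hset' : ∀ F : ℝ → ℝ, ∫ r in Set.Ioi (0 : ℝ), deriv θ r * F r = ∫ r, deriv θ r * F r := by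
      intro F
      rw [setIntegral_eq_integral_of_forall_compl_eq_zero]
      intro s hs'
      have : deriv θ s = 0 := by
        by_contra h
        exact hs' (hs (support_deriv_subset (Function.mem_support.2 h)))
      simp [this]
    have hp := integral_mul_deriv_eq_deriv_mul_of_integrable (u := θ)
      (v := fun r : ℝ => r ^ 2 * dd (1, 0) (sphMean χ) (r, x)) (u' := deriv θ)
      (v' := fun s => 2 * s * dd (1, 0) (sphMean χ) (s, x) +
        s ^ 2 * dd (1, 0) (dd (1, 0) (sphMean χ)) (s, x))
      (fun s _ => (hθ.differentiable (by simp) s).hasDerivAt) (fun s _ => hd s)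
      ((Continuous.mul hθ.continuous (by fun_prop)).integrable_of_hasCompactSupport hc.mul_right)
      ((Continuous.mul hθ' (by fun_prop)).integrable_of_hasCompactSupport hc.deriv.mul_right)
      ((Continuous.mul hθ.continuous (by fun_prop)).integrable_of_hasCompactSupport hc.mul_right)
    have e1 : ∀ r, θ r • ψ r = θ r * (2 * r * dd (1, 0) (sphMean χ) (r, x) +
        r ^ 2 * dd (1, 0) (dd (1, 0) (sphMean χ)) (r, x)) -
        θ r * (r ^ 2 * sphMean (lap χ) (r, x)) := fun r => by simp only [hψ, smul_eq_mul]; ring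
    simp only [e1]
    rw [integral_sub, hp]
    · have hL := hset fun r => r ^ 2 * sphMean (lap χ) (r, x)
      simp only [smul_eq_mul] at hL
      rw [hL, ← hset' fun r => r ^ 2 * dd (1, 0) (sphMean χ) (r, x)]
      have c1 : ∀ r : ℝ, θ r * (r ^ 2 * sphMean (lap χ) (r, x)) =
        r ^ 2 * (θ r * sphMean (lap χ) (r, x)) := fun r => by ring
      have c2 : ∀ r : ℝ, deriv θ r * (r ^ 2 * dd (1, 0) (sphMean χ) (r, x)) =
        r ^ 2 * (deriv θ r * dd (1, 0) (sphMean χ) (r, x)) := fun r => by ring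
      simp only [c1, c2]
      linarith [hdw]
    · exact (Continuous.mul hθ.continuous (by fun_prop)).integrable_of_hasCompactSupport hc.mul_right
    · exact (Continuous.mul hθ.continuous (by fun_prop)).integrable_of_hasCompactSupport hc.mul_right

/-- Kirchhoff's formula: `wave χ` solves the wave equation. -/
lemma wave_equation {χ : R3 → ℝ} (hχ : ContDiff ℝ ∞ χ) {τ : ℝ} (hτ : 0 < τ) (x : R3) :
    dd (1, 0) (dd (1, 0) (wave χ)) (τ, x) = wave (lap χ) (τ, x) := by
  have hm := contDiff_sphMean hχ
  have hN : ContDiff ℝ ∞ (dd (1, 0) (sphMean χ)) := contDiff_dd hm _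
  have e : dd (1, 0) (wave χ) = fun p => sphMean χ p + p.1 * dd (1, 0) (sphMean χ) p :=
    funext fun p => dd_time_wave hχ p
  have h1 : dd (1, 0) (dd (1, 0) (wave χ)) (τ, x) =
      2 * dd (1, 0) (sphMean χ) (τ, x) + τ * dd (1, 0) (dd (1, 0) (sphMean χ)) (τ, x) := by
    have ha := (hm.differentiable (by simp) (τ, x)).hasFDerivAt
    have hb := (hN.differentiable (by simp) (τ, x)).hasFDerivAt
    have := (ha.add ((hasFDerivAt_fst (𝕜 := ℝ) (p := (τ, x))).mul hb)).fderiv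
    have e' : dd (1, 0) (wave χ) = sphMean χ + Prod.fst * dd (1, 0) (sphMean χ) := e
    rw [e']
    have e'' : ∀ g : ℝ × R3 → ℝ, dd (1, 0) g (τ, x) = fderiv ℝ g (τ, x) (1, 0) := fun _ => rfl
    rw [e'', this]; simp [dd]; ring
  rw [h1]
  have := darboux hχ x hτ
  unfold wave
  simp only
  apply mul_left_cancel₀ hτ.ne'
  linarith

lemma lap_slice_wave {χ : R3 → ℝ} (hχ : ContDiff ℝ ∞ χ) (p : ℝ × R3) :
    ∑ i, dd (0, ee i) (dd (0, ee i) (wave χ)) p = wave (lap χ) p := by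
  have h : ∀ i, dd (0, ee i) (dd (0, ee i) (wave χ)) p = wave (dd (ee i) (dd (ee i) χ)) p := by
    intro i
    rw [show dd (0, ee i) (wave χ) = wave (dd (ee i) χ) from funext (dd_space_wave hχ _),
      dd_space_wave (contDiff_dd hχ _)]
  simp only [h, wave, sphMean, lap]
  rw [← Finset.mul_sum, ← Finset.mul_sum, ← integral_finsetSum]
  intro i _
  have := (contDiff_dd (contDiff_dd hχ (ee i)) (ee i)).continuous
  exact Continuous.integrable_of_hasCompactSupport (by fun_prop)
    (HasCompactSupport.of_compactSpace _)

/-! ### Estimates for spherical waves -/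

lemma hasCompactSupport_of_bound {F : Type*} [Zero F] {g : R3 → F} {r : ℝ}
    (h : ∀ x, g x ≠ 0 → ‖x‖ ≤ r) : HasCompactSupport g :=
  HasCompactSupport.intro (isCompact_closedBall (0 : R3) r) fun x hx => by
    by_contra h'
    exact hx (by simpa using h x h')

lemma integrable_mul_of_locallyIntegrable {g h : R3 → ℝ} (hg : LocallyIntegrable g)
    (hh : Continuous h) (hc : HasCompactSupport h) : Integrable fun x => g x * h x := by
  have := hg.integrable_smul_left_of_hasCompactSupport hh hc
  simpa [mul_comm] using this

/-- Integrability for Fubini's theorem with a locally integrable function and an integral over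
the sphere. -/
lemma integrable_mul_sphere {g : R3 → ℝ} (hg : LocallyIntegrable g) {Φ : R3 → S2 → ℝ}
    (hΦ : Continuous (Function.uncurry Φ)) {r : ℝ} (hr : ∀ x w, Φ x w ≠ 0 → ‖x‖ ≤ r) :
    Integrable (fun p : R3 × S2 => g p.1 * Φ p.1 p.2) (volume.prod sph) := by
  set K := Metric.closedBall (0 : R3) r
  obtain ⟨C, hC⟩ := ((isCompact_closedBall (0 : R3) r).prod
    (isCompact_univ (X := S2))).exists_bound_of_continuousOn hΦ.continuousOn
  have hgK : Integrable (K.indicator g) :=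
    (integrable_indicator_iff measurableSet_closedBall).2
      (hg.integrableOn_isCompact (isCompact_closedBall _ _))
  have hb : Integrable (fun p : R3 × S2 => K.indicator g p.1 * C) (volume.prod sph) :=
    hgK.mul_prod (g := fun _ : S2 => C) (integrable_const C)
  refine hb.mono ?_ (Eventually.of_forall fun p => ?_)
  · exact (hg.aestronglyMeasurable.comp_fst).mul hΦ.aestronglyMeasurable
  · by_cases hp : p.1 ∈ K
    · rw [Set.indicator_of_mem hp, norm_mul, norm_mul]
      gcongr
      exact (hC p ⟨hp, Set.mem_univ _⟩).trans (le_abs_self C)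
    · have : Φ p.1 p.2 = 0 := by
        by_contra h
        exact hp (by simpa [K] using hr _ _ h)
      rw [this, norm_mul, norm_zero, mul_zero]; positivity

lemma integral_mul_sphere_comm {g : R3 → ℝ} (hg : LocallyIntegrable g) {Φ : R3 → S2 → ℝ}
    (hΦ : Continuous (Function.uncurry Φ)) {r : ℝ} (hr : ∀ x w, Φ x w ≠ 0 → ‖x‖ ≤ r) :
    ∫ x, g x * ∫ w, Φ x w ∂sph = ∫ w, (∫ x, g x * Φ x w) ∂sph := by
  rw [← integral_integral_swap (f := fun x w => g x * Φ x w) (integrable_mul_sphere hg hΦ hr)]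
  simp only [integral_const_mul]

lemma norm_le_of_shift {x : R3} {τ r : ℝ} {w : S2} (h : ‖x + τ • (w : R3)‖ ≤ r) :
    ‖x‖ ≤ r + |τ| := by
  have h2 : ‖τ • (w : R3)‖ = |τ| := by rw [norm_smul, norm_S2]; simp
  have h3 := norm_sub_le (x + τ • (w : R3)) (τ • (w : R3))
  rw [add_sub_cancel_right] at h3
  linarith

/-- Spherical means act on a locally integrable function as averages of translations. -/
lemma integral_mul_sphMean {g : R3 → ℝ} (hg : LocallyIntegrable g) {χ : R3 → ℝ}
    (hχ : Continuous χ) (hc : HasCompactSupport χ) (τ : ℝ) :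
    ∫ x, g x * sphMean χ (τ, x) =
      (4 * Real.pi)⁻¹ * ∫ w : S2, (∫ x, g x * χ (x + τ • (w : R3))) ∂sph := by
  obtain ⟨r, hr⟩ := hc.isCompact.isBounded.exists_norm_le
  rw [← integral_mul_sphere_comm hg (Φ := fun x w => χ (x + τ • (w : R3))) (by fun_prop)
    (r := r + |τ|) (fun x w h => norm_le_of_shift (hr _ (subset_tsupport _ h))),
    ← integral_const_mul]
  congr 1; funext x
  simp only [sphMean]; ring

lemma integral_sphere_const (c : ℝ) : (4 * Real.pi)⁻¹ * ∫ _w : S2, c ∂sph = c := by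
  rw [integral_const, sph_real_univ, smul_eq_mul]
  field_simp

lemma continuous_sphMean {χ : R3 → ℝ} (hχ : Continuous χ) : Continuous (sphMean χ) := by
  unfold sphMean
  refine continuous_const.mul ?_
  have := continuous_parametric_integral_of_continuous (μ := sph)
    (f := fun (p : ℝ × R3) (w : S2) => χ (p.2 + p.1 • (w : R3))) (by fun_prop) isCompact_univ
  simpa using this

/-- Spherical means contract the `L¹` norm. -/
lemma integral_abs_sphMean_le {χ : R3 → ℝ} (hχ : Continuous χ) (hc : HasCompactSupport χ) (τ : ℝ) :
    Integrable (fun x => |sphMean χ (τ, x)|) ∧ ∫ x, |sphMean χ (τ, x)| ≤ ∫ x, |χ x| := by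
  have hc' : HasCompactSupport fun x => |χ x| := hc.comp_left (g := fun y : ℝ => |y|) abs_zero
  have key := integral_mul_sphMean (g := fun _ => 1) (locallyIntegrable_const _) hχ.abs hc' τ
  have hcs : ∀ ψ : R3 → ℝ, HasCompactSupport ψ →
      HasCompactSupport fun x => sphMean ψ (τ, x) := by
    intro ψ hψ
    obtain ⟨r, hr⟩ := hψ.isCompact.isBounded.exists_norm_le
    refine hasCompactSupport_of_bound (r := r + |τ|) fun x hx => ?_
    obtain ⟨w, hw⟩ := sphMean_ne_zero hx
    exact norm_le_of_shift (hr _ (subset_tsupport _ hw))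
  have hi : ∀ ψ : R3 → ℝ, Continuous ψ → HasCompactSupport ψ →
      Integrable fun x => sphMean ψ (τ, x) := fun ψ h1 h2 =>
    ((continuous_sphMean h1).comp (by fun_prop)).integrable_of_hasCompactSupport (hcs ψ h2)
  refine ⟨(hi χ hχ hc).abs, ?_⟩
  calc ∫ x, |sphMean χ (τ, x)| ≤ ∫ x, sphMean (fun y => |χ y|) (τ, x) := by
        refine integral_mono (hi χ hχ hc).abs (hi _ hχ.abs hc') fun x => ?_
        simp only [sphMean]
        rw [abs_mul, abs_of_pos (by positivity : 0 < (4 * Real.pi)⁻¹)]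
        gcongr
        exact norm_integral_le_integral_norm (μ := sph) (fun w : S2 => χ (x + τ • (w : R3)))
    _ = ∫ x, |χ x| := by
        simp only [one_mul] at key
        rw [key]
        have : ∀ w : S2, ∫ x, |χ (x + τ • (w : R3))| = ∫ x, |χ x| := fun w =>
          integral_add_right_eq_self (μ := volume) (fun x => |χ x|) (τ • (w : R3))
        simp only [this, integral_sphere_const]

/-- A spherical wave is supported in a shell around the support of its initial datum. -/
lemma shell_of_sphMean_ne_zero {χ : R3 → ℝ} {p : R3} {R : ℝ} (hs : ∀ x, χ x ≠ 0 → ‖x - p‖ ≤ R)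
    {τ : ℝ} (hτ : 0 ≤ τ) {x : R3} (h : sphMean χ (τ, x) ≠ 0) : |‖x - p‖ - τ| ≤ R := by
  obtain ⟨w, hw⟩ := sphMean_ne_zero h
  have h1 := hs _ hw
  have h2 : ‖τ • (w : R3)‖ = τ := by
    rw [norm_smul, norm_S2, Real.norm_eq_abs, abs_of_nonneg hτ, mul_one]
  have h3 : |‖x - p‖ - ‖-(τ • (w : R3))‖| ≤ ‖x - p - -(τ • (w : R3))‖ := abs_norm_sub_norm_le _ _
  rw [norm_neg, h2] at h3
  refine h3.trans (le_trans (le_of_eq ?_) h1)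
  congr 1
  simp only; abel

lemma abs_integral_mul_le {g h : R3 → ℝ} {A : ℝ} (hi : Integrable fun x => |h x|)
    (hb : ∀ x, h x ≠ 0 → |g x| ≤ A) : |∫ x, g x * h x| ≤ A * ∫ x, |h x| := by
  rw [← integral_const_mul, ← Real.norm_eq_abs]
  refine norm_integral_le_of_norm_le (hi.const_mul A) (Eventually.of_forall fun x => ?_)
  by_cases hx : h x = 0
  · simp [hx]
  · rw [norm_mul, Real.norm_eq_abs, Real.norm_eq_abs]
    exact mul_le_mul_of_nonneg_right (hb x hx) (abs_nonneg _)

lemma abs_integral_mul_wave_le {g χ : R3 → ℝ} (hχ : Continuous χ) (hc : HasCompactSupport χ)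
    {τ A : ℝ} (hτ : 0 ≤ τ) (hA : 0 ≤ A) (hb : ∀ x, wave χ (τ, x) ≠ 0 → |g x| ≤ A) :
    |∫ x, g x * wave χ (τ, x)| ≤ A * (τ * ∫ x, |χ x|) := by
  have h := integral_abs_sphMean_le hχ hc τ
  have e : ∀ x, |wave χ (τ, x)| = τ * |sphMean χ (τ, x)| := fun x => by
    simp [wave, abs_mul, abs_of_nonneg hτ]
  refine (abs_integral_mul_le (by simp only [e]; exact h.1.const_mul _) hb).trans ?_
  simp only [e]
  rw [integral_const_mul]
  exact mul_le_mul_of_nonneg_left (mul_le_mul_of_nonneg_left h.2 hτ) (by positivity)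

/-- Integration by parts against a function that is differentiable on the support of the test
function only. -/
lemma abs_integral_mul_dd_le {g h : R3 → ℝ} (hg : LocallyIntegrable g) (hh : IsTest h) {A' : ℝ}
    (b : R3) (hd : ∀ x ∈ tsupport h, DifferentiableAt ℝ g x)
    (hb : ∀ x ∈ tsupport h, ‖fderiv ℝ g x‖ ≤ A') :
    |∫ x, g x * dd b h x| ≤ A' * ‖b‖ * ∫ x, |h x| := by
  have hm : Measurable fun x => fderiv ℝ g x b := measurable_fderiv_apply_const ℝ g b
  have hih : Integrable h := hh.continuous.integrable_of_hasCompactSupport hh.compact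
  have hbd : ∀ x, h x ≠ 0 → |fderiv ℝ g x b| ≤ A' * ‖b‖ := fun x hx =>
    (ContinuousLinearMap.le_opNorm _ _).trans
      (mul_le_mul_of_nonneg_right (hb x (subset_tsupport _ hx)) (norm_nonneg _))
  have hi : Integrable fun x => fderiv ℝ g x b * h x := by
    refine (hih.norm.const_mul (A' * ‖b‖)).mono' (hm.aestronglyMeasurable.mul
      hh.continuous.aestronglyMeasurable) (Eventually.of_forall fun x => ?_)
    by_cases hx : h x = 0
    · simp [hx]
    · rw [norm_mul]
      exact mul_le_mul_of_nonneg_right (hbd x hx) (norm_nonneg _)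
  have := integral_mul_fderiv_eq_neg_fderiv_mul_of_integrable (f := g) (g := h) (v := b) hi
    (integrable_mul_of_locallyIntegrable hg (hh.dd b).continuous (hh.dd b).compact)
    (integrable_mul_of_locallyIntegrable hg hh.continuous hh.compact) hd
    (fun x _ => hh.differentiable x)
  unfold dd
  rw [this, abs_neg]
  exact abs_integral_mul_le hih.abs hbd

lemma IsTest.shift {χ : R3 → ℝ} (hχ : IsTest χ) (c : R3) : IsTest fun x => χ (x + c) := by
  simpa using hχ.comp_sub (-c)

/-- The free field generated by differentiable data decays like the data on the light cone:
the part of Kirchhoff's formula without time derivative on the potential. -/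
lemma abs_integral_mul_dd_space_wave_le {g χ : R3 → ℝ} (hg : LocallyIntegrable g) (hχ : IsTest χ)
    {p : R3} {R τ A' : ℝ} (hs : ∀ x, χ x ≠ 0 → ‖x - p‖ ≤ R) (hτ : 0 ≤ τ) (hA' : 0 ≤ A') (b : R3)
    (hd : ∀ x, |‖x - p‖ - τ| ≤ R → DifferentiableAt ℝ g x ∧ ‖fderiv ℝ g x‖ ≤ A') :
    |∫ x, g x * dd (0, b) (wave χ) (τ, x)| ≤ A' * ‖b‖ * (τ * ∫ x, |χ x|) := by
  have hW := isTestCurve_wave hχ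
  have hts : ∀ x ∈ tsupport (fun x => wave χ (τ, x)), |‖x - p‖ - τ| ≤ R := by
    have hcl : IsClosed {x : R3 | |‖x - p‖ - τ| ≤ R} :=
      isClosed_le (by fun_prop) continuous_const
    refine closure_minimal (fun x hx => ?_) hcl
    exact shell_of_sphMean_ne_zero hs hτ (right_ne_zero_of_mul hx)
  have h1 := abs_integral_mul_dd_le hg (hW.slice τ) b (fun x hx => (hd x (hts x hx)).1)
    (fun x hx => (hd x (hts x hx)).2)
  simp only [hW.dd_slice] at h1
  refine h1.trans ?_
  have h := integral_abs_sphMean_le hχ.continuous hχ.compact τ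
  have e : ∀ x, |wave χ (τ, x)| = τ * |sphMean χ (τ, x)| := fun x => by
    simp [wave, abs_mul, abs_of_nonneg hτ]
  simp only [e]
  rw [integral_const_mul]
  exact mul_le_mul_of_nonneg_left (mul_le_mul_of_nonneg_left h.2 hτ) (by positivity)

/-- The part of Kirchhoff's formula with a time derivative on the potential. As
`∂_τ(τ M_τ χ) = M_τ χ + τ ∂_τ M_τ χ`, and the radial derivative can be moved to the data inside the
integral over the sphere, the amplitude and `τ` times the gradient of the data enter. -/
lemma abs_integral_mul_dd_time_wave_le {g χ : R3 → ℝ} (hg : LocallyIntegrable g) (hχ : IsTest χ)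
    {p : R3} {R τ A A' : ℝ} (hs : ∀ x, χ x ≠ 0 → ‖x - p‖ ≤ R) (hτ : 0 ≤ τ)
    (hd : ∀ x, |‖x - p‖ - τ| ≤ R → DifferentiableAt ℝ g x ∧ |g x| ≤ A ∧ ‖fderiv ℝ g x‖ ≤ A') :
    |∫ x, g x * dd (1, 0) (wave χ) (τ, x)| ≤ (A + τ * A') * ∫ x, |χ x| := by
  have hM := isTestCurve_sphMean hχ
  have hshift : ∀ w : S2, ∀ x ∈ tsupport (fun x => χ (x + τ • (w : R3))), |‖x - p‖ - τ| ≤ R := by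
    intro w
    have hcl : IsClosed {x : R3 | |‖x - p‖ - τ| ≤ R} :=
      isClosed_le (by fun_prop) continuous_const
    refine closure_minimal (fun x hx => ?_) hcl
    have h2 : ‖τ • (w : R3)‖ = τ := by
      rw [norm_smul, norm_S2, Real.norm_eq_abs, abs_of_nonneg hτ]; simp
    have h3 : |‖x - p‖ - ‖-(τ • (w : R3))‖| ≤ ‖x - p - -(τ • (w : R3))‖ := abs_norm_sub_norm_le _ _
    rw [norm_neg, h2] at h3
    refine h3.trans (le_trans (le_of_eq ?_) (hs _ hx))
    congr 1
    abel
  simp only [dd_time_wave hχ.smooth, mul_add]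
  rw [integral_add
    (integrable_mul_of_locallyIntegrable hg (hM.slice τ).continuous (hM.slice τ).compact)
    (integrable_mul_of_locallyIntegrable hg
      (h := fun x => τ * dd (1, 0) (sphMean χ) (τ, x))
      (((hM.dd (1, 0)).slice τ).const_mul τ).continuous
      (((hM.dd (1, 0)).slice τ).const_mul τ).compact)]
  refine (abs_add_le _ _).trans ?_
  rw [add_mul]
  gcongr
  · have h := integral_abs_sphMean_le hχ.continuous hχ.compact τ
    by_cases hA : 0 ≤ A
    · refine (abs_integral_mul_le h.1 fun x hx =>
        (hd x (shell_of_sphMean_ne_zero hs hτ hx)).2.1).trans ?_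
      exact mul_le_mul_of_nonneg_left h.2 hA
    · -- a negative bound forces the shell to be empty and the datum to vanish
      have h0 : ∀ x, |‖x - p‖ - τ| ≤ R → False := fun x hx =>
        hA ((abs_nonneg _).trans (hd x hx).2.1)
      have hχ0 : ∀ x, χ x = 0 := by
        intro x
        by_contra hne
        have w : S2 := ⟨ee 0, by simp⟩
        have : x - τ • (w : R3) ∈ tsupport (fun x => χ (x + τ • (w : R3))) :=
          subset_tsupport _ (by simpa using hne)
        exact h0 _ (hshift w _ this)
      simp [sphMean, hχ0]
  · obtain ⟨r, _, hr⟩ := hχ.exists_radius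
    have hr' : ∀ (x : R3) (w : S2), dd (w : R3) χ (x + τ • (w : R3)) ≠ 0 → ‖x‖ ≤ r + |τ| := by
      intro x w hne
      refine norm_le_of_shift (w := w) ?_
      by_contra hlt
      refine hne (dd_eq_zero_of_notMem_tsupport (fun hmem => hlt ?_) _)
      have hcl : IsClosed {x : R3 | ‖x‖ ≤ r} := isClosed_le continuous_norm continuous_const
      exact closure_minimal (fun x hx => hr x hx) hcl hmem
    have hcont : Continuous (Function.uncurry fun (x : R3) (w : S2) =>
        dd (w : R3) χ (x + τ • (w : R3))) := by
      unfold dd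
      have : Continuous (fderiv ℝ χ) := hχ.smooth.continuous_fderiv (by simp)
      refine Continuous.clm_apply (this.comp ?_) ?_ <;> fun_prop
    have e : ∀ x, g x * (τ * dd (1, 0) (sphMean χ) (τ, x)) = (4 * Real.pi)⁻¹ * τ *
        (g x * ∫ w : S2, dd (w : R3) χ (x + τ • (w : R3)) ∂sph) := fun x => by
      rw [dd_time_sphMean hχ.smooth]; ring
    simp only [e]
    rw [integral_const_mul, integral_mul_sphere_comm hg hcont hr', abs_mul,
      abs_of_nonneg (by positivity : 0 ≤ (4 * Real.pi)⁻¹ * τ)]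
    have hw : ∀ w : S2, ‖∫ x, g x * dd (w : R3) χ (x + τ • (w : R3))‖ ≤ A' * ∫ x, |χ x| := by
      intro w
      have h1 := abs_integral_mul_dd_le hg (hχ.shift (τ • (w : R3))) (w : R3)
        (fun x hx => (hd x (hshift w x hx)).1) (fun x hx => (hd x (hshift w x hx)).2.2)
      rw [norm_S2, mul_one, integral_add_right_eq_self (μ := volume) (fun x => |χ x|)] at h1
      have e2 : ∀ x, dd (w : R3) (fun x => χ (x + τ • (w : R3))) x =
          dd (w : R3) χ (x + τ • (w : R3)) := fun x => by
        unfold dd; rw [fderiv_comp_add_right]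
      simpa only [e2, Real.norm_eq_abs] using h1
    have h2 := norm_integral_le_of_norm_le_const (μ := sph) (Eventually.of_forall hw)
    rw [sph_real_univ, Real.norm_eq_abs] at h2
    calc (4 * Real.pi)⁻¹ * τ * |∫ w : S2, (∫ x, g x * dd (w : R3) χ (x + τ • (w : R3))) ∂sph|
        ≤ (4 * Real.pi)⁻¹ * τ * (A' * (∫ x, |χ x|) * (4 * Real.pi)) := by gcongr
      _ = τ * A' * ∫ x, |χ x| := by field_simp

lemma locallyIntegrable_of_L2 (F : L2Field) (a : R3) : LocallyIntegrable fun x => ⟪F x, a⟫ := by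
  have hF : LocallyIntegrable (F : R3 → R3) :=
    (Lp.memLp F).locallyIntegrable (by norm_num)
  intro x
  obtain ⟨s, hs, hi⟩ := hF x
  exact ⟨s, hs, hi.inner_const a⟩

lemma pair_eq_integral_mul {F : L2Field} {E : R3 → R3} (hFE : F =ᵐ[volume] E) (a : R3)
    (g : R3 → ℝ) : pair F a g = ∫ x, ⟪E x, a⟫ * g x := by
  refine integral_congr_ae ?_
  filter_upwards [hFE] with x hx
  rw [hx, inner_smul_right, mul_comm]

/-- The contribution of initial data that are regular on a shell: the potential `wave χ (τ, ·)` is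
of size `τ` in `L¹`, and one derivative falls on the data. -/
lemma abs_pair_wave_le {F : L2Field} {E : R3 → R3} (hFE : F =ᵐ[volume] E) {χ : R3 → ℝ}
    (hχ : IsTest χ) {p : R3} {R τ A A' : ℝ} (hs : ∀ x, χ x ≠ 0 → ‖x - p‖ ≤ R) (hτ : 0 ≤ τ)
    (hA' : 0 ≤ A')
    (hd : ∀ x, |‖x - p‖ - τ| ≤ R → DifferentiableAt ℝ E x ∧ ‖E x‖ ≤ A ∧ ‖fderiv ℝ E x‖ ≤ A')
    (a : R3) :
    |pair F a fun x => dd (1, 0) (wave χ) (τ, x)| ≤ ‖a‖ * (A + τ * A') * ∫ x, |χ x| ∧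
    ∀ b : R3, |pair F a fun x => dd (0, b) (wave χ) (τ, x)| ≤
      ‖a‖ * ‖b‖ * (τ * A') * ∫ x, |χ x| := by
  have hg : LocallyIntegrable fun x => ⟪E x, a⟫ :=
    (locallyIntegrable_of_L2 F a).congr (by filter_upwards [hFE] with x hx; rw [hx])
  have hd' : ∀ x, |‖x - p‖ - τ| ≤ R → DifferentiableAt ℝ (fun x => ⟪E x, a⟫) x ∧
      |⟪E x, a⟫| ≤ ‖a‖ * A ∧ ‖fderiv ℝ (fun x => ⟪E x, a⟫) x‖ ≤ ‖a‖ * A' := by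
    intro x hx
    obtain ⟨h1, h2, h3⟩ := hd x hx
    refine ⟨h1.inner ℝ (differentiableAt_const a), ?_, ?_⟩
    · refine (abs_real_inner_le_norm _ _).trans ?_
      rw [mul_comm]; gcongr
    · refine ContinuousLinearMap.opNorm_le_bound _ (by positivity) fun y => ?_
      rw [fderiv_inner_apply ℝ h1 (differentiableAt_const a)]
      simp only [fderiv_fun_const, Pi.zero_apply, _root_.zero_apply, inner_zero_right,
        zero_add]
      refine (norm_inner_le_norm _ _).trans ?_
      have := (fderiv ℝ E x).le_opNorm y
      calc ‖fderiv ℝ E x y‖ * ‖a‖ ≤ (A' * ‖y‖) * ‖a‖ := by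
            gcongr; exact this.trans (by gcongr)
        _ = ‖a‖ * A' * ‖y‖ := by ring
  rw [pair_eq_integral_mul hFE]
  refine ⟨(abs_integral_mul_dd_time_wave_le hg hχ hs hτ hd').trans (le_of_eq (by ring)),
    fun b => ?_⟩
  rw [pair_eq_integral_mul hFE]
  exact (abs_integral_mul_dd_space_wave_le hg hχ hs hτ (by positivity) b
    fun x hx => ⟨(hd' x hx).1, (hd' x hx).2.2⟩).trans (le_of_eq (by ring))

/-! ### Testing the Maxwell equations with spherical waves -/

/-- Duality between weak solutions of the Maxwell equations `∂ₜF = κ ∇ × G - J_F`,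
`∂ₜG = -κ ∇ × F - J_G`, `∇ · F = Q` (with `κ = ±1`) and the backward wave with final data
`u = 0`, `∂_τ u = χ`: the fields `∂_τ u a` and `κ ∇u × a` solve the adjoint equations up to the
gradient of `∂_a u`, which the divergence constraint turns into a source. -/
lemma hasDerivAt_pair_wave {F G : ℝ → L2Field} (hFc : Continuous F) (hGc : Continuous G) {κ : ℝ}
    (hκ : κ * κ = 1) {JF JG : ℝ → R3 → (R3 → ℝ) → ℝ} {Q : ℝ → (R3 → ℝ) → ℝ}
    (hF : ∀ g, IsTest g → ∀ a s, HasDerivAt (fun s => pair (F s) a g)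
      (κ * (∑ i, pair (G s) (cross (ee i) a) (dd (ee i) g)) - JF s a g) s)
    (hG : ∀ g, IsTest g → ∀ a s, HasDerivAt (fun s => pair (G s) a g)
      (-κ * (∑ i, pair (F s) (cross (ee i) a) (dd (ee i) g)) - JG s a g) s)
    (hdiv : ∀ g, IsTest g → ∀ s, ∑ i, pair (F s) (ee i) (dd (ee i) g) = - Q s g)
    {χ : R3 → ℝ} (hχ : IsTest χ) (a : R3) {t s : ℝ} (hst : s < t) :
    HasDerivAt (fun s => pair (F s) a (fun x => dd (1, 0) (wave χ) (t - s, x)) +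
        κ * ∑ i, pair (G s) (cross (ee i) a) fun x => dd (0, ee i) (wave χ) (t - s, x))
      (- JF s a (fun x => dd (1, 0) (wave χ) (t - s, x))
        + Q s (fun x => dd (0, a) (wave χ) (t - s, x))
        - κ * ∑ i, JG s (cross (ee i) a) fun x => dd (0, ee i) (wave χ) (t - s, x)) s := by
  have hU := isTestCurve_wave hχ
  set U := wave χ
  have hU0 := hU.dd (1, 0)
  have hUi : ∀ i, IsTestCurve (dd (0, ee i) U) := fun i => hU.dd _
  have hUii : ∀ i j, IsTest fun x => dd (0, ee j) (dd (0, ee i) U) (t - s, x) := fun i j =>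
    ((hUi i).dd _).slice _
  have d0 := hasDerivAt_pair hFc (hU0.reflect t) a (hF _ (hU0.slice (t - s)) a s)
  have di := fun i => hasDerivAt_pair hGc ((hUi i).reflect t) (cross (ee i) a)
    (hG _ ((hUi i).slice (t - s)) (cross (ee i) a) s)
  refine (d0.add ((HasDerivAt.fun_sum fun i _ => di i).const_mul κ)).congr_deriv ?_
  simp only [hU0.dd_reflect, (hUi _).dd_reflect, hU0.dd_slice_fun, (hUi _).dd_slice_fun]
  -- the second time derivative is the Laplacian
  have hw : pair (F s) a (fun x => -dd (1, 0) (dd (1, 0) U) (t - s, x)) =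
      - ∑ i, pair (F s) a fun x => dd (0, ee i) (dd (0, ee i) U) (t - s, x) := by
    rw [← pair_fun_sum _ (fun i => (hUii i i).continuous) (fun i => (hUii i i).compact)]
    have := pair_mul (F s) (-1) a fun x => ∑ i, dd (0, ee i) (dd (0, ee i) U) (t - s, x)
    rw [neg_one_mul] at this
    rw [← this]
    refine pair_congr _ _ fun x => ?_
    rw [neg_one_mul, wave_equation hχ.smooth (sub_pos.2 hst), lap_slice_wave hχ.smooth]
  have hmix : ∀ i, pair (G s) (cross (ee i) a)
      (fun x => -dd (1, 0) (dd (0, ee i) U) (t - s, x)) =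
      - pair (G s) (cross (ee i) a) fun x => dd (0, ee i) (dd (1, 0) U) (t - s, x) := by
    intro i
    have := pair_mul (G s) (-1) (cross (ee i) a) fun x => dd (0, ee i) (dd (1, 0) U) (t - s, x)
    rw [neg_one_mul] at this
    rw [← this]
    refine pair_congr _ _ fun x => ?_
    rw [neg_one_mul, dd_comm hU.smooth]
  have hcc : ∀ i j, pair (F s) (cross (ee j) (cross (ee i) a))
      (fun x => dd (0, ee j) (dd (0, ee i) U) (t - s, x)) =
      a j * pair (F s) (ee i) (fun x => dd (0, ee j) (dd (0, ee i) U) (t - s, x)) -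
      (if i = j then (1 : ℝ) else 0) *
        pair (F s) a (fun x => dd (0, ee j) (dd (0, ee i) U) (t - s, x)) := by
    intro i j
    rw [cross_cross_ee, sub_eq_add_neg, pair_add_right (hUii i j).continuous (hUii i j).compact,
      pair_neg_right, pair_smul_right, pair_smul_right]
    ring
  have hQ : ∑ i, ∑ j, a j * pair (F s) (ee i)
      (fun x => dd (0, ee j) (dd (0, ee i) U) (t - s, x)) =
      - Q s fun x => dd (0, a) U (t - s, x) := by
    rw [← hdiv _ ((hU.dd (0, a)).slice _) s]
    refine Finset.sum_congr rfl fun i _ => ?_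
    simp only [(hU.dd (0, a)).dd_slice_fun]
    have : ∀ x, dd (0, ee i) (dd (0, a) U) (t - s, x) =
        ∑ j, a j * dd (0, ee j) (dd (0, ee i) U) (t - s, x) := by
      intro x
      rw [dd_comm hU.smooth, ← (hUi i).dd_slice, dd_eq_sum]
      simp only [(hUi i).dd_slice]
    rw [pair_congr _ _ this, pair_fun_sum _ (fun j => ((hUii i j).const_mul (a j)).continuous)
      (fun j => ((hUii i j).const_mul (a j)).compact)]
    simp only [pair_mul]
  rw [hw]
  simp only [hmix, hcc, Finset.sum_sub_distrib, Finset.mul_sum, Finset.sum_add_distrib,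
    mul_sub, mul_add] at hQ ⊢
  simp only [ite_mul, one_mul, zero_mul, mul_ite, mul_zero, Finset.sum_ite_eq, Finset.mem_univ,
    if_true, Finset.sum_neg_distrib, mul_neg, neg_mul, ← mul_assoc, hκ]
  simp only [hQ]
  ring

/-! ### The soliton potential -/

/-- The integral kernel of the soliton potential. -/
def solKer (v z : R3) : ℝ :=
  (4 * Real.pi * Real.sqrt ((1 - ‖v‖ ^ 2) * ‖z‖ ^ 2 + ⟪v, z⟫ ^ 2))⁻¹

/-- The retarded position map: the field at the point `z` relative to the present position of a
uniformly moving charge is emitted at the point `y` relative to the retarded position, where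
`z = y - |y| v`. -/
def retard (v y : R3) : R3 := y - ‖y‖ • v

lemma retard_injective {v : R3} (hv : ‖v‖ < 1) : Function.Injective (retard v) := by
  intro y y' h
  have h1 : y - y' = (‖y‖ - ‖y'‖) • v := by
    unfold retard at h
    rw [sub_smul]
    rw [sub_eq_sub_iff_add_eq_add] at h
    rw [sub_eq_sub_iff_add_eq_add, h]; abel
  have h2 : ‖y - y'‖ ≤ ‖y - y'‖ * ‖v‖ := by
    conv_lhs => rw [h1, norm_smul]
    gcongr
    exact abs_norm_sub_norm_le y y'
  by_contra hne
  have : 0 < ‖y - y'‖ := norm_pos_iff.2 (sub_ne_zero.2 hne)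
  nlinarith

lemma retard_surjective {v : R3} (hv : ‖v‖ < 1) : Function.Surjective (retard v) := by
  intro z
  set w := 1 - ‖v‖ ^ 2 with hw
  have hwpos : 0 < w := by nlinarith [norm_nonneg v]
  set s := ⟪z, v⟫
  set D := Real.sqrt (s ^ 2 + w * ‖z‖ ^ 2)
  have hD : D ^ 2 = s ^ 2 + w * ‖z‖ ^ 2 := Real.sq_sqrt (by positivity)
  have hD0 : |s| ≤ D := Real.abs_le_sqrt (by have := sq_nonneg ‖z‖; nlinarith)
  -- the retarded distance is the positive root of a quadratic equation
  set r := (s + D) / w with hr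
  have hr0 : 0 ≤ r := div_nonneg (by linarith [neg_abs_le s]) hwpos.le
  have hrw : r * w = s + D := by rw [hr]; field_simp
  have hnorm : ‖z + r • v‖ = r := by
    refine (sq_eq_sq₀ (norm_nonneg _) hr0).1 ?_
    rw [norm_add_sq_real, inner_smul_right, norm_smul, Real.norm_eq_abs, mul_pow, sq_abs]
    have hv2 : ‖v‖ ^ 2 = 1 - w := by rw [hw]; ring
    have hs : ⟪z, v⟫ = s := rfl
    rw [hv2, hs]
    apply mul_left_cancel₀ hwpos.ne'
    linear_combination (2 * s - r * w - s - D) * hrw - hD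
  exact ⟨z + r • v, by unfold retard; rw [hnorm]; abel⟩

lemma retard_eq_zero {v : R3} (hv : ‖v‖ < 1) {y : R3} : retard v y = 0 ↔ y = 0 := by
  constructor
  · intro h
    exact retard_injective hv (h.trans (by simp [retard]))
  · rintro rfl; simp [retard]

/-- The derivative of the retarded position map. -/
def retardDeriv (v y : R3) : R3 →L[ℝ] R3 :=
  ContinuousLinearMap.id ℝ R3 - (‖y‖⁻¹ • innerSL ℝ y).smulRight v

lemma hasFDerivAt_retard (v : R3) {y : R3} (hy : y ≠ 0) :
    HasFDerivAt (retard v) (retardDeriv v y) y := by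
  have h1 : HasFDerivAt (fun z : R3 => ‖z‖) (‖y‖⁻¹ • innerSL ℝ y) y := by
    have := ((hasStrictFDerivAt_norm_sq y).hasFDerivAt.sqrt (by simpa using hy))
    simp only [Real.sqrt_sq (norm_nonneg _)] at this
    refine this.congr_fderiv ?_
    ext w; simp; field_simp
  exact (hasFDerivAt_id y).sub (h1.smul_const v)

/-- The derivative differs from the identity by a map of rank one. -/
lemma det_retardDeriv (v y : R3) : (retardDeriv v y).det = 1 - ‖y‖⁻¹ * ⟪y, v⟫ := by
  have h : ((retardDeriv v y : R3 →L[ℝ] R3) : R3 →ₗ[ℝ] R3) =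
      LinearMap.transvection ((-(‖y‖⁻¹ • innerSL ℝ y) : R3 →L[ℝ] ℝ) : R3 →ₗ[ℝ] ℝ) v := by
    ext1 z
    simp [retardDeriv, LinearMap.transvection, sub_eq_add_neg]
  rw [ContinuousLinearMap.det, h, LinearMap.transvection.det]
  simp [sub_eq_add_neg]

lemma inner_lt_norm {v y : R3} (hv : ‖v‖ < 1) (hy : y ≠ 0) : ⟪y, v⟫ < ‖y‖ := by
  have h1 := real_inner_le_norm y v
  have h2 : 0 < ‖y‖ := norm_pos_iff.2 hy
  nlinarith

lemma solKer_retard {v y : R3} (hv : ‖v‖ < 1) :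
    solKer v (retard v y) = (4 * Real.pi * (‖y‖ - ⟪y, v⟫))⁻¹ := by
  unfold solKer
  congr 2
  have h0 : 0 ≤ ‖y‖ - ⟪y, v⟫ := by
    by_cases hy : y = 0
    · simp [hy]
    · linarith [inner_lt_norm hv hy]
  rw [← Real.sqrt_sq h0]
  congr 1
  unfold retard
  rw [norm_sub_sq_real, inner_sub_right, inner_smul_right, inner_smul_right, norm_smul, norm_norm,
    real_inner_self_eq_norm_sq, real_inner_comm y v]
  ring

lemma image_retard {v : R3} (hv : ‖v‖ < 1) : retard v '' {0}ᶜ = {0}ᶜ := by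
  ext z
  constructor
  · rintro ⟨y, hy, rfl⟩
    exact fun h => hy ((retard_eq_zero hv).1 h)
  · intro hz
    obtain ⟨y, rfl⟩ := retard_surjective hv z
    exact ⟨y, fun h => hz ((retard_eq_zero hv).2 h), rfl⟩

/-- The Jacobian of the retarded position map cancels the Liénard–Wiechert denominator. -/
lemma abs_det_smul_eq {v : R3} (hv : ‖v‖ < 1) (g : R3 → ℝ) : ∀ y ∈ ({0}ᶜ : Set R3),
    |(retardDeriv v y).det| • (solKer v (retard v y) * g (retard v y)) =
      (4 * Real.pi * ‖y‖)⁻¹ * g (retard v y) := by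
  intro y hy
  have hy0 : 0 < ‖y‖ := norm_pos_iff.2 hy
  have hlt := inner_lt_norm hv hy
  have hd : 0 < 1 - ‖y‖⁻¹ * ⟪y, v⟫ := by
    rw [sub_pos, inv_mul_lt_iff₀ hy0]; simpa using hlt
  rw [det_retardDeriv, abs_of_pos hd, solKer_retard hv, smul_eq_mul]
  have : ‖y‖ - ⟪y, v⟫ ≠ 0 := by linarith
  field_simp

/-- The Liénard–Wiechert potential of a uniformly moving charge: change of variables from
retarded to present relative position. -/
lemma integral_solKer {v : R3} (hv : ‖v‖ < 1) (g : R3 → ℝ) :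
    ∫ z, solKer v z * g z = ∫ y, (4 * Real.pi * ‖y‖)⁻¹ * g (retard v y) := by
  have h := integral_image_eq_integral_abs_det_fderiv_smul (volume : Measure R3)
    (measurableSet_singleton (0 : R3)).compl
    (fun y hy => (hasFDerivAt_retard v hy).hasFDerivWithinAt) (retard_injective hv).injOn
    (fun z => solKer v z * g z)
  rw [image_retard hv, setIntegral_congr_fun (measurableSet_singleton (0 : R3)).compl
    (abs_det_smul_eq hv g)] at h
  simpa only [restrict_compl_singleton] using h

lemma integrable_solKer_iff {v : R3} (hv : ‖v‖ < 1) (g : R3 → ℝ) :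
    Integrable (fun z => solKer v z * g z) ↔
      Integrable fun y => (4 * Real.pi * ‖y‖)⁻¹ * g (retard v y) := by
  have h := integrableOn_image_iff_integrableOn_abs_det_fderiv_smul (volume : Measure R3)
    (measurableSet_singleton (0 : R3)).compl
    (fun y hy => (hasFDerivAt_retard v hy).hasFDerivWithinAt) (retard_injective hv).injOn
    (fun z => solKer v z * g z)
  rw [image_retard hv, integrableOn_congr_fun (abs_det_smul_eq hv g)
    (measurableSet_singleton (0 : R3)).compl] at h
  simpa only [IntegrableOn, restrict_compl_singleton] using h

lemma integrableOn_inv_norm (r : ℝ) :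
    IntegrableOn (fun z : R3 => ‖z‖⁻¹) (Metric.ball 0 r) := by
  rw [integrableOn_fun_norm_addHaar (volume : Measure R3) (f := fun s => s⁻¹)]
  have : IntegrableOn (fun y : ℝ => y) (Set.Ioo 0 r) :=
    (continuous_id.integrableOn_Icc (a := 0) (b := r)).mono_set Set.Ioo_subset_Icc_self
  refine this.congr_fun (fun y hy => ?_) measurableSet_Ioo
  have : y ≠ 0 := hy.1.ne'
  simp; field_simp

lemma locallyIntegrable_inv_norm : LocallyIntegrable fun z : R3 => ‖z‖⁻¹ := by
  intro x
  exact ⟨Metric.ball 0 (‖x‖ + 1), Metric.isOpen_ball.mem_nhds (by simp), integrableOn_inv_norm _⟩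

lemma measurable_solKer (v : R3) : Measurable (solKer v) := by
  unfold solKer; fun_prop

lemma solKer_nonneg (v z : R3) : 0 ≤ solKer v z := by unfold solKer; positivity

lemma solKer_le {v : R3} (hv : ‖v‖ < 1) (z : R3) :
    solKer v z ≤ (4 * Real.pi * Real.sqrt (1 - ‖v‖ ^ 2))⁻¹ * ‖z‖⁻¹ := by
  have h1 : 0 < 1 - ‖v‖ ^ 2 := by nlinarith [norm_nonneg v]
  by_cases hz : z = 0
  · simp [hz, solKer]
  have hz0 : 0 < ‖z‖ := norm_pos_iff.2 hz
  unfold solKer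
  rw [← mul_inv, mul_assoc (4 * Real.pi)]
  have h2 : Real.sqrt (1 - ‖v‖ ^ 2) * ‖z‖ ≤
      Real.sqrt ((1 - ‖v‖ ^ 2) * ‖z‖ ^ 2 + ⟪v, z⟫ ^ 2) := by
    rw [← Real.sqrt_sq hz0.le, ← Real.sqrt_mul h1.le, Real.sq_sqrt (sq_nonneg _)]
    exact Real.sqrt_le_sqrt (by nlinarith [sq_nonneg ⟪v, z⟫])
  have h3 : 0 < Real.sqrt (1 - ‖v‖ ^ 2) := Real.sqrt_pos.2 h1
  gcongr

lemma locallyIntegrable_solKer {v : R3} (hv : ‖v‖ < 1) : LocallyIntegrable (solKer v) := by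
  refine (locallyIntegrable_inv_norm.smul ((4 * Real.pi * Real.sqrt (1 - ‖v‖ ^ 2))⁻¹)).mono
    (measurable_solKer v).aestronglyMeasurable (Eventually.of_forall fun z => ?_)
  rw [Real.norm_eq_abs, abs_of_nonneg (solKer_nonneg v z), Pi.smul_apply, smul_eq_mul]
  exact (solKer_le hv z).trans (le_abs_self _)

lemma solitonPotential_eq (g : R3 → ℝ) (v x : R3) :
    solitonPotential g v x = ∫ z, solKer v z * g (x - z) := by
  have := integral_sub_left_eq_self (μ := volume) (fun z => solKer v z * g (x - z)) x
  simp only [sub_sub_cancel] at this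
  exact this

lemma solitonPotential_eq_convolution (g : R3 → ℝ) (v : R3) :
    solitonPotential g v = convolution (solKer v) g (ContinuousLinearMap.mul ℝ ℝ) volume := by
  funext x
  rw [solitonPotential_eq, convolution_def]
  rfl

lemma dd_convolution {h : R3 → ℝ} (hh : LocallyIntegrable h) {g : R3 → ℝ} (hg : IsTest g)
    (b x : R3) : dd b (convolution h g (ContinuousLinearMap.mul ℝ ℝ) volume) x =
      convolution h (dd b g) (ContinuousLinearMap.mul ℝ ℝ) volume x := by
  unfold dd
  rw [(hg.compact.hasFDerivAt_convolution_right (ContinuousLinearMap.mul ℝ ℝ)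
    hh (hg.smooth.of_le (by simp)) x).fderiv,
    convolution_precompR_apply _ hh (hg.compact.fderiv ℝ)
      (hg.smooth.continuous_fderiv (by simp))]

lemma dd_solitonPotential {g : R3 → ℝ} (hg : IsTest g) {v : R3} (hv : ‖v‖ < 1) (b x : R3) :
    dd b (solitonPotential g v) x = solitonPotential (dd b g) v x := by
  rw [solitonPotential_eq_convolution, solitonPotential_eq_convolution,
    dd_convolution (locallyIntegrable_solKer hv) hg]

lemma continuous_solitonPotential {g : R3 → ℝ} (hg : IsTest g) {v : R3} (hv : ‖v‖ < 1) :
    Continuous (solitonPotential g v) := by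
  rw [solitonPotential_eq_convolution]
  exact (hg.compact.contDiff_convolution_right (n := 0) _ (locallyIntegrable_solKer hv)
    (hg.smooth.of_le (by simp))).continuous

lemma inner_solitonE {ρ : R3 → ℝ} (hρ : IsTest ρ) {v : R3} (hv : ‖v‖ < 1) (a x : R3) :
    ⟪solitonE ρ v x, a⟫ =
      - solitonPotential (dd a ρ) v x + ⟪v, a⟫ * solitonPotential (dd v ρ) v x := by
  unfold solitonE
  rw [inner_add_left, inner_neg_left, inner_gradient, inner_smul_left, real_inner_comm,
    inner_gradient, dd_solitonPotential hρ hv, dd_solitonPotential hρ hv]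
  simp [mul_comm]

lemma inner_solitonB {ρ : R3 → ℝ} (hρ : IsTest ρ) {v : R3} (hv : ‖v‖ < 1) (a x : R3) :
    ⟪solitonB ρ v x, a⟫ = - solitonPotential (dd (cross a v) ρ) v x := by
  unfold solitonB
  rw [inner_neg_left, inner_cross_rotate, inner_gradient, dd_solitonPotential hρ hv]

/-- Uniform bound for soliton potentials with velocities bounded away from one. -/
lemma exists_solitonPotential_bound {vb : ℝ} (hvb : vb < 1) : ∃ C, 0 ≤ C ∧
    ∀ g : R3 → ℝ, Continuous g → HasCompactSupport g → ∀ M : ℝ, (∀ x, |g x| ≤ M) →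
      ∀ v x : R3, ‖v‖ ≤ vb → |solitonPotential g v x| ≤ C * (M + ∫ y, |g y|) := by
  -- near the singularity the kernel is integrable, away from it it is bounded
  set I := ∫ z in Metric.ball (0 : R3) 1, ‖z‖⁻¹
  have hI : 0 ≤ I := integral_nonneg fun z => by positivity
  set c := (4 * Real.pi * Real.sqrt (1 - vb ^ 2))⁻¹
  have hc : 0 ≤ c := by positivity
  refine ⟨c * (I + 1), by positivity, fun g hg hgc M hM v x hv => ?_⟩
  have hv1 : ‖v‖ < 1 := hv.trans_lt hvb
  have hM0 : 0 ≤ M := (abs_nonneg _).trans (hM 0)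
  have hgx : Continuous fun z => g (x - z) := by fun_prop
  have hgxc : HasCompactSupport fun z => g (x - z) := by
    have := hgc.comp_homeomorph ((Homeomorph.neg R3).trans (Homeomorph.addLeft x))
    simpa [Function.comp_def, sub_eq_add_neg] using this
  have hgi : Integrable fun z => |g (x - z)| :=
    (hgx.integrable_of_hasCompactSupport hgxc).abs
  have hbint : Integrable fun z => (Metric.ball (0 : R3) 1).indicator (fun z => ‖z‖⁻¹ * M) z +
      |g (x - z)| :=
    ((integrable_indicator_iff measurableSet_ball).2
      ((integrableOn_inv_norm 1).mul_const M)).add hgi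
  have hker : ∀ z, solKer v z ≤ c * ‖z‖⁻¹ := by
    intro z
    refine (solKer_le hv1 z).trans ?_
    have h1 : 0 < 1 - vb ^ 2 := by nlinarith [norm_nonneg v]
    have h2 : 0 < Real.sqrt (1 - vb ^ 2) := Real.sqrt_pos.2 h1
    refine mul_le_mul_of_nonneg_right (inv_anti₀ (by positivity) ?_) (by positivity)
    gcongr
  rw [solitonPotential_eq, ← Real.norm_eq_abs]
  refine (norm_integral_le_of_norm_le (hbint.const_mul c) (Eventually.of_forall fun z => ?_)).trans
    ?_
  · rw [norm_mul, Real.norm_eq_abs, Real.norm_eq_abs, abs_of_nonneg (solKer_nonneg v z)]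
    have h1 : solKer v z * |g (x - z)| ≤ c * (‖z‖⁻¹ * |g (x - z)|) := by
      rw [← mul_assoc]
      exact mul_le_mul_of_nonneg_right (hker z) (abs_nonneg _)
    refine h1.trans (mul_le_mul_of_nonneg_left ?_ hc)
    by_cases hz : z ∈ Metric.ball (0 : R3) 1
    · rw [Set.indicator_of_mem hz]
      have := mul_le_mul_of_nonneg_left (hM (x - z)) (by positivity : 0 ≤ ‖z‖⁻¹)
      linarith [abs_nonneg (g (x - z))]
    · rw [Set.indicator_of_notMem hz, zero_add]
      have : ‖z‖⁻¹ ≤ 1 := inv_le_one_of_one_le₀ (by simpa using hz)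
      exact mul_le_of_le_one_left (abs_nonneg _) this
  · rw [integral_const_mul, integral_add _ hgi, integral_indicator measurableSet_ball,
      integral_mul_const, integral_sub_left_eq_self (fun y => |g y|) volume x]
    · have hJ : 0 ≤ ∫ y, |g y| := integral_nonneg fun y => abs_nonneg _
      have : (I * M + ∫ y, |g y|) ≤ (I + 1) * (M + ∫ y, |g y|) := by
        nlinarith [mul_nonneg hI hJ]
      calc c * (I * M + ∫ y, |g y|) ≤ c * ((I + 1) * (M + ∫ y, |g y|)) := by gcongr
        _ = _ := by ring
    · exact (integrable_indicator_iff measurableSet_ball).2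
        ((integrableOn_inv_norm 1).mul_const M)

/-- A uniformly moving soliton potential is the superposition of the waves emitted in the past. -/
lemma integral_solKer_eq_wave {v : R3} (hv : ‖v‖ < 1) {g : R3 → ℝ} (hg : Continuous g)
    (hc : HasCompactSupport g) :
    ∫ z, solKer v z * g z = ∫ r in Set.Ioi (0 : ℝ), wave g (r, -(r • v)) := by
  have hi := (integrable_solKer_iff hv g).1
    (by simpa [mul_comm] using
      (locallyIntegrable_solKer hv).integrable_smul_left_of_hasCompactSupport hg hc)
  rw [integral_solKer hv, integral_polar hi]
  refine setIntegral_congr_fun measurableSet_Ioi fun r hr => ?_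
  have hr' : 0 < r := hr
  simp only [wave, sphMean, retard, norm_smul, norm_S2, Real.norm_eq_abs, abs_of_pos hr', mul_one]
  rw [integral_const_mul]
  have : ∀ w : S2, r • (w : R3) - r • v = -(r • v) + r • (w : R3) := fun w => by abel
  simp only [this]
  field_simp

lemma integral_intervalIntegral_swap_of_bound {F : R3 → ℝ → ℝ}
    (hF : Continuous (Function.uncurry F)) {r : ℝ} (hr : ∀ x τ, F x τ ≠ 0 → ‖x‖ ≤ r) {T : ℝ}
    (hT : 0 ≤ T) :
    ∫ x, (∫ τ in (0 : ℝ)..T, F x τ) = ∫ τ in (0 : ℝ)..T, ∫ x, F x τ := by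
  simp only [intervalIntegral.integral_of_le hT]
  refine integral_integral_swap ?_
  obtain ⟨C, hC⟩ := ((isCompact_closedBall (0 : R3) r).prod
    (isCompact_Icc (a := (0 : ℝ)) (b := T))).exists_bound_of_continuousOn hF.continuousOn
  have hK : Integrable ((Metric.closedBall (0 : R3) r).indicator fun _ => |C|) :=
    (integrable_indicator_iff measurableSet_closedBall).2
      (integrableOn_const measure_closedBall_lt_top.ne)
  have hb : Integrable (fun p : R3 × ℝ => (Metric.closedBall (0 : R3) r).indicator
      (fun _ => |C|) p.1 * 1) (volume.prod (volume.restrict (Set.Ioc 0 T))) :=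
    hK.mul_prod (g := fun _ : ℝ => (1 : ℝ)) (integrable_const 1)
  refine hb.mono' hF.aestronglyMeasurable ?_
  have hae : ∀ᵐ p : R3 × ℝ ∂(volume.prod (volume.restrict (Set.Ioc 0 T))), p.2 ∈ Set.Ioc 0 T :=
    Measure.quasiMeasurePreserving_snd.ae (ae_restrict_mem measurableSet_Ioc)
  filter_upwards [hae] with p hp
  rw [mul_one]
  by_cases hx : p.1 ∈ Metric.closedBall (0 : R3) r
  · rw [Set.indicator_of_mem hx]
    exact (hC p ⟨hx, Set.Ioc_subset_Icc_self hp⟩).trans (le_abs_self C)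
  · have : F p.1 p.2 = 0 := by
      by_contra h
      exact hx (by simpa using hr _ _ h)
    rw [Set.indicator_of_notMem hx, Function.uncurry_def]
    simp [this]

/-- Spherical means are symmetric with respect to the `L²` pairing. -/
lemma integral_mul_wave_comm {g χ : R3 → ℝ} (hg : Continuous g) {r : ℝ}
    (hgs : ∀ x, g x ≠ 0 → ‖x‖ ≤ r) (hχ : Continuous χ) (hχc : HasCompactSupport χ) (τ : ℝ) :
    ∫ x, g x * wave χ (τ, x) =
      ∫ x, χ x * (τ * ((4 * Real.pi)⁻¹ * ∫ w : S2, g (x - τ • (w : R3)) ∂sph)) := by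
  have h1 := integral_mul_sphMean hg.locallyIntegrable hχ hχc τ
  have h2 : ∀ w : S2, ∫ x, g x * χ (x + τ • (w : R3)) = ∫ x, χ x * g (x - τ • (w : R3)) := by
    intro w
    rw [← integral_add_right_eq_self (μ := volume)
      (fun x => χ x * g (x - τ • (w : R3))) (τ • (w : R3))]
    congr 1; funext x
    rw [add_sub_cancel_right, mul_comm]
  simp only [h2] at h1
  rw [← integral_mul_sphere_comm (g := χ) hχ.locallyIntegrable
    (Φ := fun x w => g (x - τ • (w : R3))) (by fun_prop) (r := r + |τ|)
    (fun x w hne => ?_)] at h1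
  · have e : ∀ x, g x * wave χ (τ, x) = τ * (g x * sphMean χ (τ, x)) := fun x => by
      simp only [wave]; ring
    simp only [e]
    rw [integral_const_mul, h1, ← integral_const_mul, ← integral_const_mul]
    congr 1; funext x
    ring
  · have h3 := hgs _ hne
    have h4 := norm_add_le (x - τ • (w : R3)) (τ • (w : R3))
    rw [sub_add_cancel, norm_smul, norm_S2, Real.norm_eq_abs, mul_one] at h4
    linarith

/-- The soliton potential, paired with a test function `χ`, as a retarded integral over a time
interval that covers the intersection of the backward light cone with the tube of the charge. -/
lemma integral_mul_solitonPotential {v : R3} (hv : ‖v‖ < 1) {g χ : R3 → ℝ} (hg : Continuous g)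
    (hχ : Continuous χ) (q : R3) {R Rg T : ℝ} (hχs : ∀ x, χ x ≠ 0 → ‖x - q‖ ≤ R)
    (hgs : ∀ x, g x ≠ 0 → ‖x‖ ≤ Rg) (hT0 : 0 ≤ T) (hT : R + Rg ≤ T * (1 - ‖v‖)) :
    ∫ x, solitonPotential g v (x - q) * χ x =
      ∫ τ in (0 : ℝ)..T, ∫ x, g (x - q + τ • v) * wave χ (τ, x) := by
  have hgc : HasCompactSupport g := hasCompactSupport_of_bound hgs
  have hχr : ∀ x, χ x ≠ 0 → ‖x‖ ≤ R + ‖q‖ := fun x hx => by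
    have h1 := hχs x hx
    have h2 := norm_add_le (x - q) q
    rw [sub_add_cancel] at h2
    linarith
  have hχc : HasCompactSupport χ := hasCompactSupport_of_bound hχr
  -- the integral over the sphere of radius `τ` around `x`
  set m : ℝ → R3 → ℝ := fun τ x => (4 * Real.pi)⁻¹ * ∫ w : S2, g (x - q + τ • v - τ • (w : R3)) ∂sph
    with hm
  have hmc : Continuous (Function.uncurry m) := by
    have := continuous_parametric_integral_of_continuous (μ := sph)
      (f := fun (p : ℝ × R3) (w : S2) => g (p.2 - q + p.1 • v - p.1 • (w : R3))) (by fun_prop)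
      isCompact_univ
    simp only [Measure.restrict_univ] at this
    exact continuous_const.mul this
  -- for `τ > T` the sphere has left the support of the charge
  have hvanish : ∀ τ x, T < τ → χ x ≠ 0 → m τ x = 0 := by
    intro τ x hτ hx
    have : ∀ w : S2, g (x - q + τ • v - τ • (w : R3)) = 0 := by
      intro w
      by_contra hne
      have h1 := hgs _ hne
      have h2 := hχs x hx
      have hτ0 : 0 < τ := hT0.trans_lt hτ
      have h3 : ‖τ • (w : R3)‖ = τ := by
        rw [norm_smul, norm_S2, Real.norm_eq_abs, abs_of_pos hτ0, mul_one]
      have h4 : ‖τ • v‖ = τ * ‖v‖ := by rw [norm_smul, Real.norm_eq_abs, abs_of_pos hτ0]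
      have h5 : τ • (w : R3) = (x - q) + τ • v - (x - q + τ • v - τ • (w : R3)) := by abel
      have h6 : τ ≤ R + τ * ‖v‖ + Rg := by
        rw [← h3]
        conv_lhs => rw [h5]
        refine (norm_sub_le _ _).trans (add_le_add ((norm_add_le _ _).trans ?_) h1)
        rw [h3, h4]
        gcongr
      nlinarith
    simp [hm, this]
  -- both sides are integrals of `τ m(τ, x) χ(x)`
  have hleft : ∀ x, solitonPotential g v (x - q) * χ x = ∫ τ in (0 : ℝ)..T, τ * m τ x * χ x := by
    intro x
    by_cases hx : χ x = 0
    · simp [hx]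
    rw [intervalIntegral.integral_mul_const]
    congr 1
    have hgx : Continuous fun z => g (x - q - z) := by fun_prop
    have hgxc : HasCompactSupport fun z => g (x - q - z) := by
      have := hgc.comp_homeomorph ((Homeomorph.neg R3).trans (Homeomorph.addLeft (x - q)))
      simpa [Function.comp_def, sub_eq_add_neg] using this
    rw [solitonPotential_eq, integral_solKer_eq_wave hv hgx hgxc]
    have e : ∀ τ, wave (fun z => g (x - q - z)) (τ, -(τ • v)) = τ * m τ x := by
      intro τ
      simp only [wave, sphMean, hm]
      have : ∀ w : S2, x - q - (-(τ • v) + τ • (w : R3)) = x - q + τ • v - τ • (w : R3) :=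
        fun w => by abel
      simp only [this]
    simp only [e]
    rw [intervalIntegral.integral_of_le hT0, ← Set.Ioc_union_Ioi_eq_Ioi hT0]
    refine setIntegral_eq_of_subset_of_forall_sdiff_eq_zero (by measurability)
      Set.subset_union_left (fun τ hτ => ?_)
    have : T < τ := by
      rcases hτ with ⟨h1 | h1, h2⟩
      · exact absurd h1 h2
      · exact h1
    rw [hvanish τ x this hx, mul_zero]
  have hright : ∀ τ, ∫ x, g (x - q + τ • v) * wave χ (τ, x) = ∫ x, τ * m τ x * χ x := by
    intro τ
    rw [integral_mul_wave_comm (g := fun x => g (x - q + τ • v)) (by fun_prop)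
      (r := Rg + ‖q - τ • v‖) (fun x hne => ?_) hχ hχc]
    · refine integral_congr_ae (Eventually.of_forall fun x => ?_)
      have e : ∀ w : S2, x - τ • (w : R3) - q + τ • v = x - q + τ • v - τ • (w : R3) :=
        fun w => by abel
      simp only [hm, e]; ring
    · have h4 : x = (x - q + τ • v) + (q - τ • v) := by abel
      rw [h4]
      exact (norm_add_le _ _).trans (add_le_add (hgs _ hne) le_rfl)
  simp only [hleft, hright]
  clear_value m
  refine integral_intervalIntegral_swap_of_bound (F := fun x τ => τ * m τ x * χ x) ?_
    (r := R + ‖q‖) (fun x τ h => hχr x (right_ne_zero_of_mul h)) hT0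
  have : Continuous fun p : R3 × ℝ => m p.2 p.1 :=
    hmc.comp (continuous_snd.prodMk continuous_fst)
  simp only [Function.uncurry_def]
  fun_prop

/-! ### The equations of motion -/

lemma continuous_integral_shift_mul {ρ : R3 → ℝ} (hρ : IsTest ρ) {g : R3 → ℝ} (hg : IsTest g)
    {q : ℝ → R3} (hq : Continuous q) : Continuous fun s => ∫ x, ρ (x - q s) * g x := by
  rw [continuous_iff_continuousAt]
  intro s
  have := hρ.continuous
  have := hg.continuous
  exact continuousAt_integral_of_compact_support (H := fun s x => ρ (x - q s) * g x)
    (by simp only [Function.uncurry_def]; fun_prop) one_pos hg.compact.isCompact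
    (fun r _ x hx => by rw [image_eq_zero_of_notMem_tsupport hx, mul_zero])

lemma exists_lipschitz_bound {ρ : R3 → ℝ} (hρ : IsTest ρ) :
    ∃ L, 0 ≤ L ∧ ∀ x y, |ρ x - ρ y| ≤ L * ‖x - y‖ := by
  obtain ⟨L, hL⟩ := ContDiff.lipschitzWith_of_hasCompactSupport hρ.compact hρ.smooth (by simp)
  exact ⟨L, L.2, fun x y => by simpa [Real.dist_eq, dist_eq_norm] using hL.dist_le_mul x y⟩

/-- Translations of a Lipschitz test function are continuous in the pairing, uniformly on bounded
sets of fields; so the force on a moving charge is continuous. -/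
lemma continuous_pair_shift {X : Type*} [TopologicalSpace X] {ρ : R3 → ℝ} (hρ : IsTest ρ)
    {F : X → L2Field} (hF : Continuous F) {q : X → R3} (hq : Continuous q) (a : R3) :
    Continuous fun s => pair (F s) a fun x => ρ (x - q s) := by
  obtain ⟨L, hL0, hL⟩ := exists_lipschitz_bound hρ
  obtain ⟨r, hr0, hr⟩ := hρ.exists_radius
  rw [continuous_iff_continuousAt]
  intro s₀
  have h0 := hρ.comp_sub (q s₀)
  have hsplit : ∀ s, pair (F s) a (fun x => ρ (x - q s)) =
      pair (F s) a (fun x => ρ (x - q s₀)) +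
        pair (F s) a (fun x => ρ (x - q s) + -1 * ρ (x - q s₀)) := by
    intro s
    have h1 := hρ.comp_sub (q s)
    have h2 := h0.const_mul (-1)
    rw [pair_add h1.continuous h1.compact h2.continuous h2.compact, pair_mul]
    ring
  set r' := r + ‖q s₀‖ + 1
  have hlim : Tendsto (fun s => pair (F s) a (fun x => ρ (x - q s) + -1 * ρ (x - q s₀)))
      (𝓝 s₀) (𝓝 0) := by
    have hbound : ∀ᶠ s in 𝓝 s₀, ‖pair (F s) a (fun x => ρ (x - q s) + -1 * ρ (x - q s₀))‖ ≤
        ‖F s‖ * (L * ‖q s - q s₀‖ * ‖a‖ * ballRoot r') := by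
      have hnear : ∀ᶠ s in 𝓝 s₀, ‖q s - q s₀‖ < 1 := by
        refine ContinuousAt.eventually_lt (by fun_prop) continuousAt_const (by simp)
      filter_upwards [hnear] with s hs
      refine abs_pair_le (((hρ.comp_sub (q s)).add (h0.const_mul (-1))).continuous)
        (by positivity) (fun x hx => ?_) (fun x => ?_) _ _
      · by_contra hlt
        push Not at hlt
        have hqs : ‖q s‖ ≤ ‖q s₀‖ + 1 := by
          have := norm_add_le (q s - q s₀) (q s₀)
          rw [sub_add_cancel] at this; linarith
        have e1 : ρ (x - q s) = 0 := by
          by_contra h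
          have := hr _ h
          have := norm_sub_norm_le x (q s)
          linarith
        have e2 : ρ (x - q s₀) = 0 := by
          by_contra h
          have := hr _ h
          have := norm_sub_norm_le x (q s₀)
          linarith
        exact hx (by simp [e1, e2])
      · have := hL (x - q s) (x - q s₀)
        rw [sub_sub_sub_cancel_left, ← norm_neg, neg_sub] at this
        convert this using 2
        ring
    refine squeeze_zero_norm' hbound ?_
    have : ContinuousAt (fun s => ‖F s‖ * (L * ‖q s - q s₀‖ * ‖a‖ * ballRoot r')) s₀ := by
      fun_prop
    simpa [ContinuousAt] using this
  have h1 : ContinuousAt (fun s => pair (F s) a fun x => ρ (x - q s₀)) s₀ :=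
    (continuous_pair hF h0.continuous h0.compact a).continuousAt
  have := h1.tendsto.add hlim
  rw [add_zero] at this
  exact this.congr fun s => (hsplit s).symm

lemma pair_eq_sum {g : R3 → ℝ} (hg : Continuous g) (hc : HasCompactSupport g) (F : L2Field)
    (a : R3) : pair F a g = ∑ i, a i * pair F (ee i) g := by
  conv_lhs => rw [vec_eq_sum a, pair_sum_right _ hg hc]
  simp only [pair_smul_right]

lemma integral_inner_curl {g : R3 → ℝ} (hg : IsTest g) (F : L2Field) (a : R3) :
    ∫ x, ⟪F x, curl (fun y => g y • a) x⟫ = ∑ i, pair F (cross (ee i) a) (dd (ee i) g) := by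
  unfold pair
  rw [← integral_finsetSum _ fun i _ =>
    integrable_pair (hg.dd (ee i)).continuous (hg.dd (ee i)).compact (cross (ee i) a) F]
  simp only [curl_smul_const hg.differentiable, inner_sum]

lemma gradient_eq_sum (g : R3 → ℝ) (x : R3) : gradient g x = ∑ i, dd (ee i) g x • ee i := by
  conv_lhs => rw [vec_eq_sum (gradient g x)]
  simp only [gradient_apply]

lemma HasWeakDivergence.sum_pair {F : L2Field} {d : R3 → ℝ} (h : HasWeakDivergence F d)
    {g : R3 → ℝ} (hg : IsTest g) :
    ∑ i, pair F (ee i) (dd (ee i) g) = - ∫ x, d x * g x := by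
  rw [← h g hg.smooth hg.compact]
  unfold pair
  rw [← integral_finsetSum _ fun i _ =>
    integrable_pair (hg.dd (ee i)).continuous (hg.dd (ee i)).compact (ee i) F]
  simp only [gradient_eq_sum, inner_sum]

lemma isTest_smul_const {g : R3 → ℝ} (hg : IsTest g) (a : R3) :
    ContDiff ℝ ∞ (fun y => g y • a) ∧ HasCompactSupport fun y => g y • a :=
  ⟨hg.smooth.smul contDiff_const, hg.compact.smul_right (f' := fun _ => a)⟩

section Solution

variable {mb : ℝ} {ρ : R3 → ℝ} {Y : ℝ → State}

lemma IsSolution.norm_v_lt (hY : IsSolution mb ρ Y) (t : ℝ) : ‖(Y t).v‖ < 1 :=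
  (hY.mem_phaseSpace t).1

lemma IsSolution.hasDerivAt_pair_E (hρ : IsTest ρ) (hY : IsSolution mb ρ Y) {g : R3 → ℝ}
    (hg : IsTest g) (a : R3) (t : ℝ) :
    HasDerivAt (fun s => pair (Y s).E a g)
      (∑ i, pair (Y t).B (cross (ee i) a) (dd (ee i) g) -
        ⟪(Y t).v, a⟫ * ∫ x, ρ (x - (Y t).q) * g x) t := by
  have hη := isTest_smul_const hg a
  have h := hY.maxwell_E _ hη.1 hη.2
  have e : ∀ s, (∫ x, ⟪(Y s).B x, curl (fun y => g y • a) x⟫) -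
      ∫ x, ρ (x - (Y s).q) * ⟪(Y s).v, g x • a⟫ =
      ∑ i, pair (Y s).B (cross (ee i) a) (dd (ee i) g) -
        ⟪(Y s).v, a⟫ * ∫ x, ρ (x - (Y s).q) * g x := by
    intro s
    rw [integral_inner_curl hg, ← integral_const_mul]
    congr 2; funext x
    rw [inner_smul_right]; ring
  simp only [e] at h
  have hc : Continuous fun s => ∑ i, pair (Y s).B (cross (ee i) a) (dd (ee i) g) -
        ⟪(Y s).v, a⟫ * ∫ x, ρ (x - (Y s).q) * g x := by
    refine (continuous_finsetSum _ fun i _ => continuous_pair hY.continuous_B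
      (hg.dd (ee i)).continuous (hg.dd (ee i)).compact _).sub ?_
    exact (hY.continuous_v.inner continuous_const).mul
      (continuous_integral_shift_mul hρ hg hY.continuous_q)
  have := (hc.integral_hasStrictDerivAt 0 t).hasDerivAt.const_add (∫ x, ⟪(Y 0).E x, g x • a⟫)
  exact this.congr_of_eventuallyEq (Eventually.of_forall fun s => h s)

lemma IsSolution.hasDerivAt_pair_B (hY : IsSolution mb ρ Y) {g : R3 → ℝ}
    (hg : IsTest g) (a : R3) (t : ℝ) :
    HasDerivAt (fun s => pair (Y s).B a g)
      (- ∑ i, pair (Y t).E (cross (ee i) a) (dd (ee i) g)) t := by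
  have hη := isTest_smul_const hg a
  have h := hY.maxwell_B _ hη.1 hη.2
  simp only [integral_inner_curl hg] at h
  have hc : Continuous fun s => ∑ i, pair (Y s).E (cross (ee i) a) (dd (ee i) g) :=
    continuous_finsetSum _ fun i _ => continuous_pair hY.continuous_E
      (hg.dd (ee i)).continuous (hg.dd (ee i)).compact _
  have := (hc.integral_hasStrictDerivAt 0 t).hasDerivAt.const_sub (∫ x, ⟪(Y 0).B x, g x • a⟫)
  exact this.congr_of_eventuallyEq (Eventually.of_forall fun s => h s)

lemma IsSolution.hasDerivAt_q (hY : IsSolution mb ρ Y) (t : ℝ) :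
    HasDerivAt (fun s => (Y s).q) (Y t).v t := by
  have := (hY.continuous_v.integral_hasStrictDerivAt 0 t).hasDerivAt.const_add (Y 0).q
  exact this.congr_of_eventuallyEq (Eventually.of_forall fun s => hY.position s)

/-- The vector product with `v` from the left, as a continuous linear map. -/
def crossL (v : R3) : R3 →L[ℝ] R3 :=
  LinearMap.toContinuousLinearMap
    { toFun := cross v
      map_add' := fun x y => by
        ext i; fin_cases i <;> simp [cross_apply] <;> ring
      map_smul' := fun c x => by
        ext i; fin_cases i <;> simp [cross_apply] <;> ring }

lemma crossL_apply (v x : R3) : crossL v x = cross v x := rfl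

lemma inner_lorentzForce (hρ : IsTest ρ) (S : State) (a : R3) :
    ⟪lorentzForce ρ S, a⟫ = pair S.E a (fun x => ρ (x - S.q)) +
      pair S.B (cross a S.v) fun x => ρ (x - S.q) := by
  have hg := hρ.comp_sub S.q
  have hloc : ∀ F : L2Field, LocallyIntegrable (F : R3 → R3) := fun F =>
    (Lp.memLp F).locallyIntegrable (by norm_num)
  have hE : Integrable fun x => ρ (x - S.q) • S.E x :=
    (hloc S.E).integrable_smul_left_of_hasCompactSupport hg.continuous hg.compact
  have hB : Integrable fun x => ρ (x - S.q) • cross S.v (S.B x) := by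
    have := (crossL S.v).integrable_comp
      ((hloc S.B).integrable_smul_left_of_hasCompactSupport hg.continuous hg.compact)
    simpa only [map_smul, crossL_apply] using this
  unfold lorentzForce pair
  simp only [smul_add]
  rw [integral_add hE hB, inner_add_left, real_inner_comm, real_inner_comm _ (∫ x, _ • cross _ _),
    ← integral_inner hE, ← integral_inner hB]
  congr 1
  · congr 1; funext x
    rw [real_inner_comm, inner_smul_left, inner_smul_right]; rfl
  · congr 1; funext x
    rw [real_inner_comm, inner_smul_left, inner_cross_rotate, inner_smul_right]; rfl

lemma continuous_cross {a b : ℝ → R3} (ha : Continuous a) (hb : Continuous b) :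
    Continuous fun s => cross (a s) (b s) := by
  simp only [cross_apply]
  refine (PiLp.continuous_toLp 2 _).comp (continuous_pi fun i => ?_)
  have ha' : ∀ i, Continuous fun s => a s i := fun i => by fun_prop
  have hb' : ∀ i, Continuous fun s => b s i := fun i => by fun_prop
  fin_cases i <;> simp <;> fun_prop

lemma IsSolution.continuous_lorentzForce (hρ : IsTest ρ) (hY : IsSolution mb ρ Y) :
    Continuous fun t => lorentzForce ρ (Y t) := by
  have h : ∀ a, Continuous fun t => ⟪lorentzForce ρ (Y t), a⟫ := by
    intro a
    simp only [inner_lorentzForce hρ]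
    refine (continuous_pair_shift hρ hY.continuous_E hY.continuous_q a).add ?_
    have hcr := continuous_cross (continuous_const (y := a)) hY.continuous_v
    have hsum : Continuous fun t => ∑ i, cross a (Y t).v i *
        pair (Y t).B (ee i) fun x => ρ (x - (Y t).q) :=
      continuous_finsetSum _ fun i _ => ((EuclideanSpace.proj i).continuous.comp hcr).mul
        (continuous_pair_shift hρ hY.continuous_B hY.continuous_q _)
    refine hsum.congr fun t => ?_
    exact (pair_eq_sum (hρ.comp_sub (Y t).q).continuous (hρ.comp_sub (Y t).q).compact _ _).symm
  have e : (fun t => lorentzForce ρ (Y t)) =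
      fun t => ∑ i, ⟪lorentzForce ρ (Y t), ee i⟫ • ee i := by
    funext t
    simp only [inner_ee]
    exact vec_eq_sum _
  rw [e]
  exact continuous_finsetSum _ fun i _ => (h _).smul continuous_const

/-- The acceleration of the charge, from Newton's law with the relativistic momentum. -/
def acceleration (mb : ℝ) (ρ : R3 → ℝ) (S : State) : R3 :=
  (Real.sqrt (1 - ‖S.v‖ ^ 2) / mb) • (lorentzForce ρ S - ⟪S.v, lorentzForce ρ S⟫ • S.v)

lemma lorentzFactor_pos {s : ℝ} (h0 : 0 ≤ s) (hs : s < 1) : 0 < lorentzFactor s :=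
  one_div_pos.2 (Real.sqrt_pos.2 (by nlinarith))

/-- The Lorentz factor as a function of the momentum `p = γ v`: `γ = √(1 + |p|²)`. The weak form of
Newton's law only says that the momentum is differentiable; through this formula the Lorentz
factor, and then the velocity `p / γ`, inherit differentiability. -/
lemma sqrt_one_add_momentum {v : R3} (hv : ‖v‖ < 1) :
    Real.sqrt (1 + ‖lorentzFactor ‖v‖ • v‖ ^ 2) = lorentzFactor ‖v‖ := by
  have hg := lorentzFactor_pos (norm_nonneg v) hv
  have h1 : 0 < 1 - ‖v‖ ^ 2 := by nlinarith [norm_nonneg v]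
  rw [← Real.sqrt_sq hg.le]
  congr 1
  rw [norm_smul, Real.norm_eq_abs, Real.sqrt_sq hg.le, mul_pow, sq_abs]
  unfold lorentzFactor
  rw [div_pow, Real.sq_sqrt h1.le]
  field_simp; ring

lemma hasDerivAt_sqrt_one_add {z : ℝ → R3} {z' : R3} {t : ℝ} (hz : HasDerivAt z z' t) :
    HasDerivAt (fun s => Real.sqrt (1 + ‖z s‖ ^ 2))
      (⟪z t, z'⟫ / Real.sqrt (1 + ‖z t‖ ^ 2)) t := by
  have h := (hz.norm_sq.const_add 1).sqrt (by positivity)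
  refine h.congr_deriv ?_
  field_simp

lemma IsSolution.hasDerivAt_momentum (hmb : 0 < mb) (hρ : IsTest ρ) (hY : IsSolution mb ρ Y)
    (t : ℝ) :
    HasDerivAt (fun s => lorentzFactor ‖(Y s).v‖ • (Y s).v) (mb⁻¹ • lorentzForce ρ (Y t)) t := by
  have h1 := ((hY.continuous_lorentzForce hρ).integral_hasStrictDerivAt 0 t).hasDerivAt.const_add
    ((mb * lorentzFactor ‖(Y 0).v‖) • (Y 0).v)
  have h2 : HasDerivAt (fun s => (mb * lorentzFactor ‖(Y s).v‖) • (Y s).v)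
      (lorentzForce ρ (Y t)) t :=
    h1.congr_of_eventuallyEq (Eventually.of_forall fun s => hY.momentum s)
  have h3 := h2.const_smul mb⁻¹
  refine h3.congr_of_eventuallyEq (Eventually.of_forall fun s => ?_)
  simp only [Pi.smul_apply, smul_smul]
  rw [← mul_assoc, inv_mul_cancel₀ hmb.ne', one_mul]

lemma IsSolution.hasDerivAt_lorentzFactor (hmb : 0 < mb) (hρ : IsTest ρ) (hY : IsSolution mb ρ Y)
    (t : ℝ) :
    HasDerivAt (fun s => lorentzFactor ‖(Y s).v‖) (mb⁻¹ * ⟪(Y t).v, lorentzForce ρ (Y t)⟫) t := by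
  have h := hasDerivAt_sqrt_one_add (hY.hasDerivAt_momentum hmb hρ t)
  simp only [sqrt_one_add_momentum (hY.norm_v_lt _)] at h
  refine h.congr_deriv ?_
  have hg := lorentzFactor_pos (norm_nonneg _) (hY.norm_v_lt t)
  rw [inner_smul_left, inner_smul_right]
  simp only [conj_trivial]
  field_simp

lemma IsSolution.hasDerivAt_v (hmb : 0 < mb) (hρ : IsTest ρ) (hY : IsSolution mb ρ Y) (t : ℝ) :
    HasDerivAt (fun s => (Y s).v) (acceleration mb ρ (Y t)) t := by
  have h1 := hY.hasDerivAt_momentum hmb hρ t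
  have h2 := (hY.hasDerivAt_lorentzFactor hmb hρ t).inv
    (lorentzFactor_pos (norm_nonneg _) (hY.norm_v_lt t)).ne'
  have h3 := h2.smul h1
  have hg := lorentzFactor_pos (norm_nonneg _) (hY.norm_v_lt t)
  refine (h3.congr_of_eventuallyEq (Eventually.of_forall fun s => ?_)).congr_deriv ?_
  · have := lorentzFactor_pos (norm_nonneg _) (hY.norm_v_lt s)
    simp only [Pi.smul_apply', Pi.inv_apply, smul_smul]
    rw [inv_mul_cancel₀ this.ne', one_smul]
  · have e : Real.sqrt (1 - ‖(Y t).v‖ ^ 2) = (lorentzFactor ‖(Y t).v‖)⁻¹ := by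
      simp [lorentzFactor]
    unfold acceleration
    rw [e, smul_sub, smul_smul, smul_smul, smul_smul, sub_eq_add_neg, ← neg_smul]
    simp only [Pi.inv_apply]
    congr 2
    · field_simp

lemma norm_acceleration_le (hmb : 0 < mb) {S : State} (hv : ‖S.v‖ < 1) :
    ‖acceleration mb ρ S‖ ≤ 2 / mb * ‖lorentzForce ρ S‖ := by
  unfold acceleration
  have h1 : Real.sqrt (1 - ‖S.v‖ ^ 2) ≤ 1 := by
    rw [Real.sqrt_le_one]
    nlinarith [sq_nonneg ‖S.v‖]
  have h2 : ‖lorentzForce ρ S - ⟪S.v, lorentzForce ρ S⟫ • S.v‖ ≤ 2 * ‖lorentzForce ρ S‖ := by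
    refine (norm_sub_le _ _).trans ?_
    rw [norm_smul]
    have h3 := norm_inner_le_norm (𝕜 := ℝ) S.v (lorentzForce ρ S)
    have h4 : ‖⟪S.v, lorentzForce ρ S⟫‖ * ‖S.v‖ ≤ ‖lorentzForce ρ S‖ := by
      calc ‖⟪S.v, lorentzForce ρ S⟫‖ * ‖S.v‖ ≤ (‖S.v‖ * ‖lorentzForce ρ S‖) * ‖S.v‖ := by gcongr
        _ ≤ (1 * ‖lorentzForce ρ S‖) * 1 := by gcongr
        _ = _ := by ring
    linarith
  rw [norm_smul, Real.norm_eq_abs, abs_of_nonneg (by positivity)]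
  calc Real.sqrt (1 - ‖S.v‖ ^ 2) / mb * ‖lorentzForce ρ S - ⟪S.v, lorentzForce ρ S⟫ • S.v‖
      ≤ 1 / mb * (2 * ‖lorentzForce ρ S‖) := by gcongr
    _ = _ := by ring

lemma IsSolution.continuous_acceleration (hρ : IsTest ρ) (hY : IsSolution mb ρ Y) :
    Continuous fun t => acceleration mb ρ (Y t) := by
  have h1 := hY.continuous_lorentzForce hρ
  have h2 := hY.continuous_v
  unfold acceleration
  fun_prop

end Solution

/-! ### Mollified fields -/

/-- The `a`-component of the field `F`, mollified with the kernel `κ`. -/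
def mollify (κ : R3 → ℝ) (F : L2Field) (a x : R3) : ℝ := pair F a fun y => κ (x - y)

lemma mollify_eq_convolution (κ : R3 → ℝ) (F : L2Field) (a : R3) :
    mollify κ F a =
      convolution (fun y => ⟪F y, a⟫) κ (ContinuousLinearMap.mul ℝ ℝ) volume := by
  funext x
  simp only [mollify, pair, convolution_def, ContinuousLinearMap.mul_apply', inner_smul_right]
  congr 1; funext y; ring

lemma contDiff_mollify {κ : R3 → ℝ} (hκ : IsTest κ) (F : L2Field) (a : R3) :
    ContDiff ℝ ∞ (mollify κ F a) := by
  rw [mollify_eq_convolution]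
  exact hκ.compact.contDiff_convolution_right (n := (⊤ : ℕ∞)) _ (locallyIntegrable_of_L2 F a)
    hκ.smooth

lemma dd_mollify {κ : R3 → ℝ} (hκ : IsTest κ) (F : L2Field) (a b x : R3) :
    dd b (mollify κ F a) x = mollify (dd b κ) F a x := by
  rw [mollify_eq_convolution, mollify_eq_convolution,
    dd_convolution (locallyIntegrable_of_L2 F a) hκ]

lemma continuous_mollify {κ : R3 → ℝ} (hκ : IsTest κ) {F : ℝ → L2Field} (hF : Continuous F)
    (a : R3) : Continuous fun p : ℝ × R3 => mollify κ (F p.1) a p.2 := by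
  have h := continuous_pair_shift (X := ℝ × R3) (hκ.comp_const_sub 0)
    (F := fun p => F p.1) (by fun_prop) (q := fun p => p.2) (by fun_prop) a
  simpa [mollify] using h

lemma mollify_eq_sum {κ : R3 → ℝ} (hκ : IsTest κ) (F : L2Field) (a x : R3) :
    mollify κ F a x = ∑ i, a i * mollify κ F (ee i) x :=
  pair_eq_sum (hκ.comp_const_sub x).continuous (hκ.comp_const_sub x).compact F a

lemma integrable_sq_component (F : L2Field) (a : R3) : Integrable fun y => ⟪F y, a⟫ ^ 2 := by
  have h : MemLp (fun y => ⟪F y, a⟫) 2 (volume : Measure R3) := by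
    have := (innerSL ℝ a).comp_memLp' (Lp.memLp F)
    refine this.ae_eq (Eventually.of_forall fun y => ?_)
    simp [real_inner_comm]
  exact h.integrable_sq

/-- Mollification with a probability density does not increase the `L²` norm. -/
lemma integral_sq_mollify_le {κ : R3 → ℝ} (hκ : IsTest κ) (h0 : ∀ x, 0 ≤ κ x)
    (h1 : ∫ x, κ x = 1) (F : L2Field) (a : R3) :
    Integrable (fun x => mollify κ F a x ^ 2) ∧
      ∫ x, mollify κ F a x ^ 2 ≤ ∫ y, ⟪F y, a⟫ ^ 2 := by
  have hsq := integrable_sq_component F a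
  have hloc := locallyIntegrable_of_L2 F a
  have hκi : Integrable κ := hκ.continuous.integrable_of_hasCompactSupport hκ.compact
  set A : R3 → ℝ := convolution (fun y => ⟪F y, a⟫ ^ 2) κ (ContinuousLinearMap.mul ℝ ℝ) volume
  have hA : Integrable A := hsq.integrable_convolution (ContinuousLinearMap.mul ℝ ℝ) hκi
  have hAint : ∫ x, A x = ∫ y, ⟪F y, a⟫ ^ 2 := by
    have := integral_convolution (ContinuousLinearMap.mul ℝ ℝ) hsq hκi
    simpa [h1] using this
  -- Jensen's inequality: the variance with respect to the density `κ (x - ·)` is nonnegative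
  have hle : ∀ x, mollify κ F a x ^ 2 ≤ A x := by
    intro x
    have hx := hκ.comp_const_sub x
    have i1 : Integrable fun y => ⟪F y, a⟫ * κ (x - y) :=
      integrable_mul_of_locallyIntegrable hloc hx.continuous hx.compact
    have i2 : Integrable fun y => ⟪F y, a⟫ ^ 2 * κ (x - y) :=
      integrable_mul_of_locallyIntegrable hsq.locallyIntegrable hx.continuous hx.compact
    have i3 : Integrable fun y => κ (x - y) :=
      hx.continuous.integrable_of_hasCompactSupport hx.compact
    have hM : mollify κ F a x = ∫ y, ⟪F y, a⟫ * κ (x - y) := by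
      rw [mollify_eq_convolution]; rfl
    have hAx : A x = ∫ y, ⟪F y, a⟫ ^ 2 * κ (x - y) := rfl
    set m := mollify κ F a x
    have hpos : 0 ≤ ∫ y, (⟪F y, a⟫ - m) ^ 2 * κ (x - y) :=
      integral_nonneg fun y => mul_nonneg (sq_nonneg _) (h0 _)
    have hexp : ∀ y, (⟪F y, a⟫ - m) ^ 2 * κ (x - y) =
        ⟪F y, a⟫ ^ 2 * κ (x - y) + ((-2 * m) * (⟪F y, a⟫ * κ (x - y)) + m ^ 2 * κ (x - y)) :=
      fun y => by ring
    simp only [hexp] at hpos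
    have hadd : Integrable fun y => (-2 * m) * (⟪F y, a⟫ * κ (x - y)) + m ^ 2 * κ (x - y) :=
      (i1.const_mul _).add (i3.const_mul _)
    rw [integral_add i2 hadd, integral_add (i1.const_mul _) (i3.const_mul _),
      integral_const_mul, integral_const_mul, ← hM, ← hAx, integral_sub_left_eq_self κ volume x, h1] at hpos
    nlinarith
  have hcont : Continuous (mollify κ F a) := (contDiff_mollify hκ F a).continuous
  have hint : Integrable fun x => mollify κ F a x ^ 2 :=
    hA.mono' (hcont.pow 2).aestronglyMeasurable (Eventually.of_forall fun x => by
      rw [Real.norm_eq_abs, abs_of_nonneg (sq_nonneg _)]; exact hle x)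
  exact ⟨hint, (integral_mono hint hA hle).trans hAint.le⟩

lemma integral_sq_component_le (F : L2Field) (i : Fin 3) :
    ∫ y, ⟪F y, ee i⟫ ^ 2 ≤ ‖F‖ ^ 2 := by
  have h : ‖F‖ ^ 2 = ∫ y, ‖F y‖ ^ 2 := by
    rw [← real_inner_self_eq_norm_sq, L2.inner_def]
    simp only [real_inner_self_eq_norm_sq]
  have hi : Integrable fun y => ‖F y‖ ^ 2 := (Lp.memLp F).integrable_norm_pow (by norm_num)
  rw [h]
  refine integral_mono (integrable_sq_component F _) hi fun y => ?_
  simp only [← sq_abs ⟪F y, ee i⟫]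
  have := abs_real_inner_le_norm (F y) (ee i)
  rw [norm_ee, mul_one] at this
  gcongr

lemma integral_norm_sq_eq_sum (F : L2Field) :
    ∫ y, ‖F y‖ ^ 2 = ∑ i, ∫ y, ⟪F y, ee i⟫ ^ 2 := by
  rw [← integral_finsetSum _ fun i _ => integrable_sq_component F _]
  congr 1; funext y
  rw [EuclideanSpace.norm_sq_eq]
  simp only [inner_ee, Real.norm_eq_abs, sq_abs]

/-- The mollifier moves to the test function. -/
lemma integral_mollify_mul {κ h : R3 → ℝ} (hκ : IsTest κ) (hh : IsTest h) (F : L2Field) (a : R3) :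
    ∫ x, mollify κ F a x * h x = ∫ y, ⟪F y, a⟫ * ∫ x, κ (x - y) * h x := by
  obtain ⟨r₁, _, hr₁⟩ := hκ.exists_radius
  obtain ⟨r₂, _, hr₂⟩ := hh.exists_radius
  obtain ⟨C, hC0, hC⟩ := hκ.exists_bound
  have hM : ∀ x, mollify κ F a x = ∫ y, ⟪F y, a⟫ * κ (x - y) := by
    intro x; rw [mollify_eq_convolution]; rfl
  have hloc := locallyIntegrable_of_L2 F a
  have e1 : ∀ x, mollify κ F a x * h x = ∫ y, ⟪F y, a⟫ * (κ (x - y) * h x) := fun x => by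
    rw [hM, ← integral_mul_const]; congr 1; funext y; ring
  have e2 : ∀ y, ⟪F y, a⟫ * ∫ x, κ (x - y) * h x = ∫ x, ⟪F y, a⟫ * (κ (x - y) * h x) := fun y => by
    rw [← integral_const_mul]
  simp only [e1, e2]
  refine integral_integral_swap ?_
  set K := Metric.closedBall (0 : R3) (r₁ + r₂)
  have hK : Integrable (K.indicator fun y => C * |⟪F y, a⟫|) :=
    (integrable_indicator_iff measurableSet_closedBall).2
      ((hloc.integrableOn_isCompact (isCompact_closedBall _ _)).abs.const_mul C)
  have hhi : Integrable h := hh.continuous.integrable_of_hasCompactSupport hh.compact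
  have hb : Integrable (fun p : R3 × R3 => |h p.1| * K.indicator (fun y => C * |⟪F y, a⟫|) p.2)
      (volume.prod volume) := hhi.abs.mul_prod hK
  refine hb.mono' ?_ (Eventually.of_forall fun p => ?_)
  · have := hκ.continuous
    have := hh.continuous
    exact (hloc.aestronglyMeasurable.comp_snd).mul
      (by fun_prop : Continuous fun p : R3 × R3 => κ (p.1 - p.2) * h p.1).aestronglyMeasurable
  · simp only [Function.uncurry_def]
    by_cases hy : p.2 ∈ K
    · rw [Set.indicator_of_mem hy, Real.norm_eq_abs, abs_mul, abs_mul]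
      have := hC (p.1 - p.2)
      calc |⟪F p.2, a⟫| * (|κ (p.1 - p.2)| * |h p.1|) ≤ |⟪F p.2, a⟫| * (C * |h p.1|) := by gcongr
        _ = _ := by ring
    · have : κ (p.1 - p.2) * h p.1 = 0 := by
        by_contra hne
        have h1 := hr₁ _ (left_ne_zero_of_mul hne)
        have h2 := hr₂ _ (right_ne_zero_of_mul hne)
        have h3 := norm_sub_norm_le p.2 p.1
        rw [norm_sub_rev] at h3
        exact hy (by simp only [K, mem_closedBall_zero_iff]; linarith)
      rw [this, mul_zero, norm_zero]
      exact mul_nonneg (abs_nonneg _) (Set.indicator_nonneg (fun _ _ => by positivity) _)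

/-- Averages with a probability density supported in a small ball. -/
lemma abs_average_sub_le {κ g : R3 → ℝ} (hκ : IsTest κ) (h0 : ∀ x, 0 ≤ κ x)
    (h1 : ∫ x, κ x = 1) (hg : Continuous g) {c δ : ℝ} {x : R3}
    (hd : ∀ y, κ y ≠ 0 → |g (x + y) - c| ≤ δ) : |(∫ y, κ y * g (x + y)) - c| ≤ δ := by
  have hκi : Integrable κ := hκ.continuous.integrable_of_hasCompactSupport hκ.compact
  have hi : Integrable fun y => κ y * g (x + y) :=
    (hκ.continuous.mul (by fun_prop)).integrable_of_hasCompactSupport hκ.compact.mul_right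
  have e : (∫ y, κ y * g (x + y)) - c = ∫ y, κ y * (g (x + y) - c) := by
    simp only [mul_sub]
    rw [integral_sub hi (hκi.mul_const c), integral_mul_const, h1, one_mul]
  rw [e, ← Real.norm_eq_abs]
  have := norm_integral_le_of_norm_le (hκi.mul_const δ)
    (f := fun y => κ y * (g (x + y) - c)) (Eventually.of_forall fun y => ?_)
  · rwa [integral_mul_const, h1, one_mul] at this
  · rw [norm_mul, Real.norm_eq_abs, Real.norm_eq_abs, abs_of_nonneg (h0 y)]
    by_cases hy : κ y = 0
    · simp [hy]
    · exact mul_le_mul_of_nonneg_left (hd y hy) (h0 y)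

/-- The mollified charge distribution. -/
def mollifiedCharge (κ ρ : R3 → ℝ) (z : R3) : ℝ := ∫ y, ρ y * κ (z - y)

lemma isTest_mollifiedCharge {κ ρ : R3 → ℝ} (hκ : IsTest κ) (hρ : IsTest ρ) :
    IsTest (mollifiedCharge κ ρ) := by
  have e : mollifiedCharge κ ρ = convolution ρ κ (ContinuousLinearMap.mul ℝ ℝ) volume := rfl
  rw [e]
  exact ⟨hκ.compact.contDiff_convolution_right (n := (⊤ : ℕ∞)) _
    hρ.continuous.locallyIntegrable hκ.smooth,
    hρ.compact.convolution (ContinuousLinearMap.mul ℝ ℝ) hκ.compact⟩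

lemma integral_shift_mul_eq (κ ρ : R3 → ℝ) (x q : R3) :
    ∫ y, ρ (y - q) * κ (x - y) = mollifiedCharge κ ρ (x - q) := by
  unfold mollifiedCharge
  rw [← integral_sub_right_eq_self (fun y => ρ y * κ (x - q - y)) q]
  simp

/-! ### The energy inequality -/

section Energy

variable {mb : ℝ} {ρ : R3 → ℝ} {Y : ℝ → State}

/-- A derivative on the kernel of the mollification becomes a derivative of the mollified field,
with a minus sign from the reflected argument. -/
lemma dd_kernel {κ : R3 → ℝ} (hκ : IsTest κ) (F : L2Field) (a b x : R3) :
    pair F a (dd b fun y => κ (x - y)) = - dd b (mollify κ F a) x := by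
  rw [dd_mollify hκ]
  have : ∀ y, dd b (fun y => κ (x - y)) y = -1 * dd b κ (x - y) := fun y => by
    rw [dd_comp_const_sub hκ.differentiable]; ring
  rw [pair_congr _ _ this, pair_mul, mollify]
  ring

/-- The mollified fields solve the Maxwell equations pointwise. -/
lemma IsSolution.hasDerivAt_mollify_E (hρ : IsTest ρ) (hY : IsSolution mb ρ Y) {κ : R3 → ℝ}
    (hκ : IsTest κ) (i : Fin 3) (x : R3) (t : ℝ) :
    HasDerivAt (fun s => mollify κ (Y s).E (ee i) x)
      (- (∑ j, dd (ee j) (mollify κ (Y t).B (cross (ee j) (ee i))) x) -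
        (Y t).v i * mollifiedCharge κ ρ (x - (Y t).q)) t := by
  have h := hY.hasDerivAt_pair_E hρ (hκ.comp_const_sub x) (ee i) t
  simp only [dd_kernel hκ, integral_shift_mul_eq, inner_ee, Finset.sum_neg_distrib] at h
  exact h

lemma IsSolution.hasDerivAt_mollify_B (hY : IsSolution mb ρ Y) {κ : R3 → ℝ}
    (hκ : IsTest κ) (i : Fin 3) (x : R3) (t : ℝ) :
    HasDerivAt (fun s => mollify κ (Y s).B (ee i) x)
      (∑ j, dd (ee j) (mollify κ (Y t).E (cross (ee j) (ee i))) x) t := by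
  have h := hY.hasDerivAt_pair_B (hκ.comp_const_sub x) (ee i) t
  simp only [dd_kernel hκ, Finset.sum_neg_distrib, neg_neg] at h
  exact h

/-- Components of the vector product of basis vectors (the Levi-Civita symbol). -/
def levi (j i k : Fin 3) : ℝ := cross (ee j) (ee i) k

lemma levi_swap (j i k : Fin 3) : levi j k i = - levi j i k := by
  unfold levi
  fin_cases j <;> fin_cases i <;> fin_cases k <;> simp [cross_apply]

lemma abs_levi_le (j i k : Fin 3) : |levi j i k| ≤ 1 := by
  unfold levi
  fin_cases j <;> fin_cases i <;> fin_cases k <;> simp [cross_apply]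

lemma dd_mollify_cross {κ : R3 → ℝ} (hκ : IsTest κ) (F : L2Field) (i j : Fin 3) (x : R3) :
    dd (ee j) (mollify κ F (cross (ee j) (ee i))) x =
      ∑ k, levi j i k * dd (ee j) (mollify κ F (ee k)) x := by
  rw [dd_mollify hκ, mollify_eq_sum (hκ.dd _)]
  simp only [dd_mollify hκ, levi]

/-- The Poynting identity for mollified fields, with a cut-off: only the derivative of the cut-off
survives. -/
lemma integral_poynting {κ ψ : R3 → ℝ} (hκ : IsTest κ) (hψ : IsTest ψ) (E B : L2Field) :
    ∫ x, ψ x * (∑ i, (mollify κ E (ee i) x *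
        (- ∑ j, dd (ee j) (mollify κ B (cross (ee j) (ee i))) x) +
      mollify κ B (ee i) x * ∑ j, dd (ee j) (mollify κ E (cross (ee j) (ee i))) x)) =
    ∑ j, ∑ i, ∑ k, levi j i k *
      ∫ x, dd (ee j) ψ x * (mollify κ E (ee i) x * mollify κ B (ee k) x) := by
  have hs : ∀ F : L2Field, ∀ i, ContDiff ℝ ∞ (mollify κ F (ee i)) := fun F i =>
    contDiff_mollify hκ F _
  have hprod : ∀ i k, ContDiff ℝ ∞ fun x => mollify κ E (ee i) x * mollify κ B (ee k) x :=
    fun i k => (hs E i).mul (hs B k)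
  have hdprod : ∀ i k j x, fderiv ℝ (fun x => mollify κ E (ee i) x * mollify κ B (ee k) x) x
      (ee j) = mollify κ E (ee i) x * dd (ee j) (mollify κ B (ee k)) x +
        mollify κ B (ee k) x * dd (ee j) (mollify κ E (ee i)) x := by
    intro i k j x
    have := (((hs E i).differentiable (by simp) x).hasFDerivAt.mul
      ((hs B k).differentiable (by simp) x).hasFDerivAt).fderiv
    have e : (fun x => mollify κ E (ee i) x * mollify κ B (ee k) x) =
      mollify κ E (ee i) * mollify κ B (ee k) := rfl
    rw [e, this]
    simp [dd]
  have hparts : ∀ i k j, ∫ x, dd (ee j) ψ x * (mollify κ E (ee i) x * mollify κ B (ee k) x) =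
      - ∫ x, ψ x * (mollify κ E (ee i) x * dd (ee j) (mollify κ B (ee k)) x +
        mollify κ B (ee k) x * dd (ee j) (mollify κ E (ee i)) x) := by
    intro i k j
    have h2 := integral_mul_fderiv_eq_neg_fderiv_mul_of_integrable (μ := volume) (f := ψ)
      (g := fun x => mollify κ E (ee i) x * mollify κ B (ee k) x) (v := ee j)
      (((hψ.dd (ee j)).continuous.mul (hprod i k).continuous).integrable_of_hasCompactSupport
        (hψ.dd (ee j)).compact.mul_right)
      ((hψ.continuous.mul (((hprod i k).continuous_fderiv (by simp)).clm_apply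
        continuous_const)).integrable_of_hasCompactSupport hψ.compact.mul_right)
      ((hψ.continuous.mul (hprod i k).continuous).integrable_of_hasCompactSupport
        hψ.compact.mul_right)
      (fun x _ => hψ.differentiable x) (fun x _ => (hprod i k).differentiable (by simp) x)
    simp only [hdprod] at h2
    rw [h2, neg_neg]
    rfl
  have hi : ∀ j i k, Integrable fun x => -levi j i k * (ψ x * (mollify κ E (ee i) x *
      dd (ee j) (mollify κ B (ee k)) x + mollify κ B (ee k) x *
        dd (ee j) (mollify κ E (ee i)) x)) := by
    intro j i k
    have c1 := (hs E i).continuous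
    have c2 := (hs B k).continuous
    have c3 := (contDiff_dd (hs E i) (ee j)).continuous
    have c4 := (contDiff_dd (hs B k) (ee j)).continuous
    exact (Continuous.integrable_of_hasCompactSupport
      (hψ.continuous.mul (by fun_prop)) hψ.compact.mul_right).const_mul _
  have hR : ∀ j i k, levi j i k *
      ∫ x, dd (ee j) ψ x * (mollify κ E (ee i) x * mollify κ B (ee k) x) =
      ∫ x, -levi j i k * (ψ x * (mollify κ E (ee i) x *
      dd (ee j) (mollify κ B (ee k)) x + mollify κ B (ee k) x *
        dd (ee j) (mollify κ E (ee i)) x)) := by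
    intro j i k
    rw [hparts, integral_const_mul]; ring
  simp only [hR]
  rw [← Finset.sum_congr rfl fun j _ => (integral_finsetSum _ fun i _ =>
    integrable_finsetSum _ fun k _ => hi j i k).trans (Finset.sum_congr rfl fun i _ =>
      integral_finsetSum _ fun k _ => hi j i k), ← integral_finsetSum _ fun j _ =>
      integrable_finsetSum _ fun i _ => integrable_finsetSum _ fun k _ => hi j i k]
  congr 1; funext x
  simp only [dd_mollify_cross hκ]
  -- antisymmetry of the Levi-Civita symbol
  have hanti : ∀ j, ∑ i, ∑ k, levi j i k *
      (mollify κ B (ee i) x * dd (ee j) (mollify κ E (ee k)) x) =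
      - ∑ i, ∑ k, levi j i k * (mollify κ B (ee k) x * dd (ee j) (mollify κ E (ee i)) x) := by
    intro j
    rw [Finset.sum_comm, ← Finset.sum_neg_distrib]
    refine Finset.sum_congr rfl fun i _ => ?_
    rw [← Finset.sum_neg_distrib]
    refine Finset.sum_congr rfl fun k _ => ?_
    rw [levi_swap]; ring
  have e1 : ∑ i, (mollify κ E (ee i) x *
        (- ∑ j, ∑ k, levi j i k * dd (ee j) (mollify κ B (ee k)) x) +
      mollify κ B (ee i) x * ∑ j, ∑ k, levi j i k * dd (ee j) (mollify κ E (ee k)) x) =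
      ∑ j, (- (∑ i, ∑ k, levi j i k * (mollify κ E (ee i) x *
        dd (ee j) (mollify κ B (ee k)) x)) + ∑ i, ∑ k, levi j i k *
      (mollify κ B (ee i) x * dd (ee j) (mollify κ E (ee k)) x)) := by
    rw [Finset.sum_add_distrib, Finset.sum_add_distrib, Finset.sum_neg_distrib]
    simp only [mul_neg, Finset.sum_neg_distrib, Finset.mul_sum]
    congr 1
    · congr 1
      rw [Finset.sum_comm]
      refine Finset.sum_congr rfl fun _ _ => Finset.sum_congr rfl fun _ _ =>
        Finset.sum_congr rfl fun _ _ => by ring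
    · rw [Finset.sum_comm]
      refine Finset.sum_congr rfl fun _ _ => Finset.sum_congr rfl fun _ _ =>
        Finset.sum_congr rfl fun _ _ => by ring
  rw [e1]
  simp only [hanti]
  rw [Finset.mul_sum]
  refine Finset.sum_congr rfl fun j _ => ?_
  simp only [← Finset.sum_neg_distrib, ← Finset.sum_add_distrib, Finset.mul_sum]
  refine Finset.sum_congr rfl fun i _ => Finset.sum_congr rfl fun k _ => ?_
  ring

end Energy

/-! ### Mollifiers and cut-offs -/

/-- A smooth even probability density supported in the ball of radius `ε`. -/
structure IsMollifier (ε : ℝ) (κ : R3 → ℝ) : Prop where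
  isTest : IsTest κ
  nonneg : ∀ x, 0 ≤ κ x
  integral_eq_one : ∫ x, κ x = 1
  even : ∀ x, κ (-x) = κ x
  supp : ∀ x, κ x ≠ 0 → ‖x‖ ≤ ε

lemma exists_isMollifier {ε : ℝ} (hε : 0 < ε) : ∃ κ, IsMollifier ε κ := by
  let b : ContDiffBump (0 : R3) := ⟨ε / 2, ε, by positivity, by linarith⟩
  refine ⟨b.normed volume, ⟨b.contDiff_normed, b.hasCompactSupport_normed⟩, b.nonneg_normed,
    b.integral_normed, b.normed_neg, fun x hx => ?_⟩
  have : x ∈ Function.support (b.normed volume) := hx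
  rw [b.support_normed_eq, mem_ball_zero_iff] at this
  exact this.le

/-- Cut-off functions with arbitrarily small gradient, obtained by dilating one bump function. -/
lemma exists_cutoff {r η : ℝ} (hr : 0 < r) (hη : 0 < η) : ∃ ψ : R3 → ℝ, IsTest ψ ∧
    (∀ x, 0 ≤ ψ x) ∧ (∀ x, ψ x ≤ 1) ∧ (∀ x, ‖x‖ ≤ r → ψ x = 1) ∧
      ∀ i x, |dd (ee i) ψ x| ≤ η := by
  let b : ContDiffBump (0 : R3) := ⟨1, 2, by norm_num, by norm_num⟩
  have hb : IsTest b := ⟨b.contDiff, b.hasCompactSupport⟩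
  choose C hC0 hC using fun i => (hb.dd (ee i)).exists_bound
  set c : ℝ := min r⁻¹ (η / ∑ i, C i)
  have hS : 0 < ∑ i, C i := Finset.sum_pos (fun i _ => hC0 i) Finset.univ_nonempty
  have hc : 0 < c := by positivity
  have hcr : c * r ≤ 1 := by
    calc c * r ≤ r⁻¹ * r := by gcongr; exact min_le_left _ _
      _ = 1 := inv_mul_cancel₀ hr.ne'
  refine ⟨fun x => b (c • x), ⟨hb.smooth.comp (by fun_prop), ?_⟩, fun x => b.nonneg,
    fun x => b.le_one, fun x hx => ?_, fun i x => ?_⟩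
  · exact hb.compact.comp_homeomorph (Homeomorph.smulOfNeZero c hc.ne')
  · refine b.one_of_mem_closedBall ?_
    rw [mem_closedBall_zero_iff, norm_smul, Real.norm_eq_abs, abs_of_pos hc]
    exact (mul_le_mul_of_nonneg_left hx hc.le).trans hcr
  · have h : HasFDerivAt (fun x => b (c • x)) ((fderiv ℝ b (c • x)).comp
        (c • ContinuousLinearMap.id ℝ R3)) x :=
      (hb.differentiable (c • x)).hasFDerivAt.comp x
        ((hasFDerivAt_id x).const_smul c)
    have e : dd (ee i) (fun x => b (c • x)) x = c * dd (ee i) b (c • x) := by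
      unfold dd
      rw [h.fderiv]; simp
    rw [e, abs_mul, abs_of_pos hc]
    calc c * |dd (ee i) b (c • x)| ≤ (η / ∑ i, C i) * C i := by
          gcongr
          · exact min_le_right _ _
          · exact hC i _
      _ ≤ (η / ∑ i, C i) * ∑ i, C i := by
          gcongr
          exact Finset.single_le_sum (fun i _ => (hC0 i).le) (Finset.mem_univ i)
      _ = η := by field_simp

lemma abs_mollifiedCharge_sub_le {ε : ℝ} {κ h : R3 → ℝ} (hκ : IsMollifier ε κ) (hh : Continuous h)
    {c δ : ℝ} {x : R3} (hd : ∀ y, ‖y‖ ≤ ε → |h (x - y) - c| ≤ δ) :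
    |mollifiedCharge κ h x - c| ≤ δ := by
  have e : mollifiedCharge κ h x = ∫ y, κ y * (fun u => h (2 • x - u)) (x + y) := by
    unfold mollifiedCharge
    rw [← integral_sub_left_eq_self _ volume x]
    congr 1; funext y
    simp only [show x - (x - y) = y by abel, show 2 • x - (x + y) = x - y by rw [two_smul]; abel]
    ring
  -- the charge is reflected, `u ↦ h (2x - u)`, so as to average over `x + y` and not `x - y`
  rw [e]
  refine abs_average_sub_le hκ.isTest hκ.nonneg hκ.integral_eq_one
    (g := fun u => h (2 • x - u)) (by fun_prop) fun y hy => ?_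
  simp only [show 2 • x - (x + y) = x - y by rw [two_smul]; abel]
  exact hd y (hκ.supp y hy)

lemma mollifiedCharge_ne_zero {ε r : ℝ} {κ h : R3 → ℝ} (hκ : IsMollifier ε κ)
    (hh : ∀ x, h x ≠ 0 → ‖x‖ ≤ r) {x : R3} (hx : mollifiedCharge κ h x ≠ 0) : ‖x‖ ≤ r + ε := by
  by_contra hlt
  push Not at hlt
  refine hx ?_
  unfold mollifiedCharge
  refine integral_eq_zero_of_ae (Eventually.of_forall fun y => ?_)
  by_contra hne
  have h1 := hh _ (left_ne_zero_of_mul hne)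
  have h2 := hκ.supp _ (right_ne_zero_of_mul hne)
  have h3 := norm_sub_norm_le x y
  linarith

/-! ### Speeds are bounded by the initial energy -/

section Energy

variable {mb : ℝ} {ρ : R3 → ℝ} {Y : ℝ → State}

/-- The field energy density of the mollified fields. -/
def mollifiedEnergy (κ : R3 → ℝ) (S : State) (x : R3) : ℝ :=
  1 / 2 * ∑ i, (mollify κ S.E (ee i) x ^ 2 + mollify κ S.B (ee i) x ^ 2)

/-- The flux through the cut-off. -/
def flux (κ ψ : R3 → ℝ) (S : State) : ℝ := ∑ j, ∑ i, ∑ k, levi j i k *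
  ∫ x, dd (ee j) ψ x * (mollify κ S.E (ee i) x * mollify κ S.B (ee k) x)

/-- Balance of the mollified field energy inside a cut-off: flux through the cut-off and work done
on the mollified charge. -/
lemma IsSolution.hasDerivAt_mollifiedEnergy (hρ : IsTest ρ) (hY : IsSolution mb ρ Y)
    {κ ψ : R3 → ℝ} (hκ : IsTest κ) (hψ : IsTest ψ) (t : ℝ) :
    HasDerivAt (fun s => ∫ x, ψ x * mollifiedEnergy κ (Y s) x)
      (flux κ ψ (Y t) - ∑ i, (Y t).v i *
        ∫ x, ψ x * (mollify κ (Y t).E (ee i) x * mollifiedCharge κ ρ (x - (Y t).q))) t := by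
  have hq := isTest_mollifiedCharge hκ hρ
  have hqc := hq.continuous
  have cE : ∀ (κ : R3 → ℝ) (hκ : IsTest κ) a,
      Continuous fun p : ℝ × R3 => mollify κ (Y p.1).E a p.2 := fun κ hκ a =>
    continuous_mollify hκ hY.continuous_E a
  have cB : ∀ (κ : R3 → ℝ) (hκ : IsTest κ) a,
      Continuous fun p : ℝ × R3 => mollify κ (Y p.1).B a p.2 := fun κ hκ a =>
    continuous_mollify hκ hY.continuous_B a
  have hψc := hψ.continuous
  have h := hasDerivAt_integral_of_compact_support (μ := (volume : Measure R3))
    (H := fun s x => ψ x * mollifiedEnergy κ (Y s) x)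
    (H' := fun s x => ψ x * ∑ i, (mollify κ (Y s).E (ee i) x *
      (- (∑ j, dd (ee j) (mollify κ (Y s).B (cross (ee j) (ee i))) x) -
        (Y s).v i * mollifiedCharge κ ρ (x - (Y s).q)) +
      mollify κ (Y s).B (ee i) x * ∑ j, dd (ee j) (mollify κ (Y s).E (cross (ee j) (ee i))) x))
    ?_ ?_ ?_ (s₀ := t) zero_lt_one hψ.compact (fun s _ x hx => ?_)
  · refine h.congr_deriv ?_
    have hsm : ∀ F : L2Field, ∀ a, ContDiff ℝ ∞ (mollify κ F a) := fun F a =>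
      contDiff_mollify hκ F a
    have hsc : ∀ F : L2Field, ∀ a, Continuous (mollify κ F a) := fun F a =>
      (hsm F a).continuous
    have hdc : ∀ F : L2Field, ∀ a b, Continuous (dd b (mollify κ F a)) := fun F a b =>
      (contDiff_dd (hsm F a) b).continuous
    rw [flux, ← integral_poynting hκ hψ]
    simp only [← integral_const_mul]
    rw [← integral_finsetSum, ← integral_sub]
    · congr 1; funext x
      rw [Finset.mul_sum, Finset.mul_sum, ← Finset.sum_sub_distrib]
      refine Finset.sum_congr rfl fun i _ => ?_
      ring
    · refine Continuous.integrable_of_hasCompactSupport ?_ hψ.compact.mul_right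
      have := fun i => hsc (Y t).E (ee i)
      have := fun i => hsc (Y t).B (ee i)
      have := fun i j => hdc (Y t).B (cross (ee j) (ee i)) (ee j)
      have := fun i j => hdc (Y t).E (cross (ee j) (ee i)) (ee j)
      fun_prop
    · refine integrable_finsetSum _ fun i _ => ?_
      refine (Continuous.integrable_of_hasCompactSupport ?_ hψ.compact.mul_right).const_mul _
      have := hsc (Y t).E (ee i)
      fun_prop
    · intro i _
      refine (Continuous.integrable_of_hasCompactSupport ?_ hψ.compact.mul_right).const_mul _
      have := hsc (Y t).E (ee i)
      fun_prop
  · have := fun i => cE κ hκ (ee i)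
    have := fun i => cB κ hκ (ee i)
    simp only [Function.uncurry_def, mollifiedEnergy]
    fun_prop
  · have hv : ∀ i, Continuous fun p : ℝ × R3 => (Y p.1).v i := fun i =>
      (EuclideanSpace.proj i).continuous.comp (hY.continuous_v.comp continuous_fst)
    have hqq : Continuous fun p : ℝ × R3 => mollifiedCharge κ ρ (p.2 - (Y p.1).q) :=
      hqc.comp (continuous_snd.sub (hY.continuous_q.comp continuous_fst))
    simp only [Function.uncurry_def, dd_mollify hκ]
    exact (hψc.comp continuous_snd).mul (continuous_finsetSum _ fun i _ =>
      ((cE κ hκ (ee i)).mul ((continuous_finsetSum _ fun j _ =>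
        cB _ (hκ.dd (ee j)) (cross (ee j) (ee i))).neg.sub ((hv i).mul hqq))).add
      ((cB κ hκ (ee i)).mul (continuous_finsetSum _ fun j _ =>
        cE _ (hκ.dd (ee j)) (cross (ee j) (ee i)))))
  · intro s x
    have hd : ∀ i, HasDerivAt
        (fun s => mollify κ (Y s).E (ee i) x ^ 2 + mollify κ (Y s).B (ee i) x ^ 2)
        (2 * (mollify κ (Y s).E (ee i) x *
      (- (∑ j, dd (ee j) (mollify κ (Y s).B (cross (ee j) (ee i))) x) -
        (Y s).v i * mollifiedCharge κ ρ (x - (Y s).q)) +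
      mollify κ (Y s).B (ee i) x * ∑ j, dd (ee j) (mollify κ (Y s).E (cross (ee j) (ee i))) x))
        s := fun i => by
      refine (((hY.hasDerivAt_mollify_E hρ hκ i x s).fun_pow 2).fun_add
        ((hY.hasDerivAt_mollify_B hκ i x s).fun_pow 2)).congr_deriv ?_
      push_cast
      ring
    refine (((HasDerivAt.fun_sum (u := Finset.univ) fun i _ => hd i).const_mul
      (1 / 2 : ℝ)).const_mul (ψ x)).congr_deriv ?_
    rw [← Finset.mul_sum]
    ring
  · simp [image_eq_zero_of_notMem_tsupport hx]

lemma abs_flux_le {ε η : ℝ} {κ ψ : R3 → ℝ} (hκ : IsMollifier ε κ)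
    (hη : ∀ i x, |dd (ee i) ψ x| ≤ η) (S : State) :
    |flux κ ψ S| ≤ 27 * (η * (‖S.E‖ ^ 2 + ‖S.B‖ ^ 2)) := by
  have h : ∀ j i k, |levi j i k *
      ∫ x, dd (ee j) ψ x * (mollify κ S.E (ee i) x * mollify κ S.B (ee k) x)| ≤
      η * (‖S.E‖ ^ 2 + ‖S.B‖ ^ 2) := by
    intro j i k
    obtain ⟨iE, hE⟩ := integral_sq_mollify_le hκ.isTest hκ.nonneg hκ.integral_eq_one S.E (ee i)
    obtain ⟨iB, hB⟩ := integral_sq_mollify_le hκ.isTest hκ.nonneg hκ.integral_eq_one S.B (ee k)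
    have hη0 : 0 ≤ η := (abs_nonneg _).trans (hη 0 0)
    have hle : |∫ x, dd (ee j) ψ x * (mollify κ S.E (ee i) x * mollify κ S.B (ee k) x)| ≤
        ∫ x, η * (mollify κ S.E (ee i) x ^ 2 + mollify κ S.B (ee k) x ^ 2) := by
      rw [← Real.norm_eq_abs]
      refine norm_integral_le_of_norm_le ((iE.add iB).const_mul η) (Eventually.of_forall fun x => ?_)
      rw [Real.norm_eq_abs, abs_mul]
      refine mul_le_mul (hη j x) ?_ (abs_nonneg _) hη0
      rw [abs_le]
      constructor <;> nlinarith [sq_nonneg (mollify κ S.E (ee i) x + mollify κ S.B (ee k) x),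
        sq_nonneg (mollify κ S.E (ee i) x - mollify κ S.B (ee k) x),
        sq_nonneg (mollify κ S.E (ee i) x), sq_nonneg (mollify κ S.B (ee k) x)]
    rw [integral_const_mul, integral_add iE iB] at hle
    rw [abs_mul]
    refine (mul_le_of_le_one_left (abs_nonneg _) (abs_levi_le _ _ _)).trans (hle.trans ?_)
    gcongr
    · exact hE.trans (integral_sq_component_le _ _)
    · exact hB.trans (integral_sq_component_le _ _)
  unfold flux
  refine (Finset.abs_sum_le_sum_abs _ _).trans ?_
  have : ∀ j ∈ Finset.univ, |∑ i, ∑ k, levi j i k *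
      ∫ x, dd (ee j) ψ x * (mollify κ S.E (ee i) x * mollify κ S.B (ee k) x)| ≤
      9 * (η * (‖S.E‖ ^ 2 + ‖S.B‖ ^ 2)) := by
    intro j _
    refine (Finset.abs_sum_le_sum_abs _ _).trans ?_
    refine (Finset.sum_le_sum fun i _ => (Finset.abs_sum_le_sum_abs _ _).trans
      (Finset.sum_le_sum fun k _ => h j i k)).trans ?_
    simp
    linarith
  refine (Finset.sum_le_sum this).trans ?_
  simp
  linarith

lemma pair_sub {g h : R3 → ℝ} (hg : Continuous g) (hc : HasCompactSupport g) (hh : Continuous h)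
    (hd : HasCompactSupport h) (F : L2Field) (a : R3) :
    pair F a (fun x => g x - h x) = pair F a g - pair F a h := by
  unfold pair
  rw [← integral_sub (integrable_pair hg hc a F) (integrable_pair hh hd a F)]
  congr 1; funext x
  rw [sub_smul, inner_sub_right]

/-- Replacing the twice mollified charge by the charge itself changes the work little. -/
lemma abs_work_sub_le {ε r L : ℝ} {κ ψ : R3 → ℝ} (hκ : IsMollifier ε κ) (hρ : IsTest ρ)
    (hε : 0 ≤ ε) (hε1 : ε ≤ 1) (hr : ∀ x, ρ x ≠ 0 → ‖x‖ ≤ r) (hL0 : 0 ≤ L)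
    (hL : ∀ x y, |ρ x - ρ y| ≤ L * ‖x - y‖) (F : L2Field) (q : R3) (i : Fin 3)
    (hψ : ∀ x, ‖x‖ ≤ ‖q‖ + r + 2 → ψ x = 1) :
    |(∫ x, ψ x * (mollify κ F (ee i) x * mollifiedCharge κ ρ (x - q))) -
      pair F (ee i) (fun x => ρ (x - q))| ≤ ‖F‖ * (2 * (L * ε) * ballRoot (‖q‖ + r + 2)) := by
  have hqt := isTest_mollifiedCharge hκ.isTest hρ
  have e1 : ∫ x, ψ x * (mollify κ F (ee i) x * mollifiedCharge κ ρ (x - q)) =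
      ∫ x, mollify κ F (ee i) x * mollifiedCharge κ ρ (x - q) := by
    congr 1; funext x
    by_cases hx : mollifiedCharge κ ρ (x - q) = 0
    · simp [hx]
    · have h1 := mollifiedCharge_ne_zero hκ hr hx
      have h2 := norm_sub_norm_le x q
      rw [hψ x (by linarith), one_mul]
  set h : R3 → ℝ := fun x => mollifiedCharge κ ρ (x - q)
  have hh : IsTest h := hqt.comp_sub q
  have hhr : ∀ x, h x ≠ 0 → ‖x‖ ≤ ‖q‖ + r + ε := fun x hx => by
    have h1 := mollifiedCharge_ne_zero hκ hr hx
    have h2 := norm_sub_norm_le x q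
    linarith
  -- the kernel is even, so moving it to the charge mollifies the charge once more
  have e2 : ∀ y, ∫ x, κ (x - y) * h x = mollifiedCharge κ h y := fun y => by
    unfold mollifiedCharge
    congr 1; funext x
    rw [← hκ.even, neg_sub, mul_comm]
  have hhh := isTest_mollifiedCharge hκ.isTest hh
  have hρq := hρ.comp_sub q
  rw [e1, integral_mollify_mul hκ.isTest hh]
  simp only [e2]
  rw [← pair_eq_integral_mul (F := F) (Eventually.of_forall fun _ => rfl),
    ← pair_sub hhh.continuous hhh.compact hρq.continuous hρq.compact]
  have hb := abs_pair_le (g := fun x => mollifiedCharge κ h x - ρ (x - q))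
    (hhh.continuous.sub hρq.continuous)
    (c := 2 * (L * ε)) (r := ‖q‖ + r + 2) (by positivity) ?_ ?_ F (ee i)
  · simpa [norm_ee] using hb
  · intro x hx
    by_cases h0 : mollifiedCharge κ h x = 0
    · rw [h0, zero_sub, neg_ne_zero] at hx
      have h1 := hr _ hx
      have h2 := norm_sub_norm_le x q
      linarith
    · have := mollifiedCharge_ne_zero hκ hhr h0
      linarith
  · intro x
    refine abs_mollifiedCharge_sub_le hκ hh.continuous fun y hy => ?_
    have h1 : |h (x - y) - ρ (x - y - q)| ≤ L * ε :=
      abs_mollifiedCharge_sub_le hκ hρ.continuous fun z hz => (hL _ _).trans (by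
        rw [show x - y - q - z - (x - y - q) = -z by abel, norm_neg]
        gcongr)
    have h2 : |ρ (x - y - q) - ρ (x - q)| ≤ L * ε := (hL _ _).trans (by
        rw [show x - y - q - (x - q) = -y by abel, norm_neg]
        gcongr)
    have := abs_sub_le (h (x - y)) (ρ (x - y - q)) (ρ (x - q))
    linarith

lemma mollifiedEnergy_nonneg (κ : R3 → ℝ) (S : State) (x : R3) : 0 ≤ mollifiedEnergy κ S x :=
  mul_nonneg (by norm_num) (Finset.sum_nonneg fun _ _ => by positivity)

lemma integral_mollifiedEnergy_le {ε : ℝ} {κ ψ : R3 → ℝ} (hκ : IsMollifier ε κ) (hψ : IsTest ψ)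
    (h1 : ∀ x, ψ x ≤ 1) (S : State) :
    ∫ x, ψ x * mollifiedEnergy κ S x ≤ (1 / 2) * ∫ x, (‖S.E x‖ ^ 2 + ‖S.B x‖ ^ 2) := by
  have hm := fun (F : L2Field) i => integral_sq_mollify_le hκ.isTest hκ.nonneg hκ.integral_eq_one
    F (ee i)
  have hn : ∀ F : L2Field, Integrable fun x => ‖F x‖ ^ 2 := fun F =>
    (Lp.memLp F).integrable_norm_pow (by norm_num)
  have hi : Integrable (mollifiedEnergy κ S) :=
    (integrable_finsetSum _ fun i _ => ((hm S.E i).1.add (hm S.B i).1)).const_mul _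
  have hic : Continuous (mollifiedEnergy κ S) := by
    have := fun (F : L2Field) i => (contDiff_mollify hκ.isTest F (ee i)).continuous
    unfold mollifiedEnergy
    fun_prop
  calc ∫ x, ψ x * mollifiedEnergy κ S x ≤ ∫ x, mollifiedEnergy κ S x := by
        refine integral_mono ((hψ.continuous.mul hic).integrable_of_hasCompactSupport
          hψ.compact.mul_right) hi fun x => ?_
        exact mul_le_of_le_one_left (mollifiedEnergy_nonneg _ _ _) (h1 x)
    _ = 1 / 2 * ∑ i, ((∫ x, mollify κ S.E (ee i) x ^ 2) + ∫ x, mollify κ S.B (ee i) x ^ 2) := by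
        simp only [mollifiedEnergy]
        have hadd : ∀ i, Integrable fun x =>
            mollify κ S.E (ee i) x ^ 2 + mollify κ S.B (ee i) x ^ 2 := fun i =>
          (hm S.E i).1.add (hm S.B i).1
        rw [integral_const_mul, integral_finsetSum _ fun i _ => hadd i]
        congr 1
        exact Finset.sum_congr rfl fun i _ => integral_add (hm S.E i).1 (hm S.B i).1
    _ ≤ 1 / 2 * ∑ i, ((∫ x, ⟪S.E x, ee i⟫ ^ 2) + ∫ x, ⟪S.B x, ee i⟫ ^ 2) := by
        exact mul_le_mul_of_nonneg_left (Finset.sum_le_sum fun i _ =>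
          add_le_add (hm S.E i).2 (hm S.B i).2) (by norm_num)
    _ = _ := by
        rw [integral_add (hn _) (hn _), integral_norm_sq_eq_sum, integral_norm_sq_eq_sum,
          Finset.sum_add_distrib]

/-- The energy of the charge never exceeds the initial total energy. -/
lemma IsSolution.kinetic_energy_le (hmb : 0 < mb) (hρ : IsTest ρ) (hY : IsSolution mb ρ Y)
    {t : ℝ} (ht : 0 ≤ t) : mb * lorentzFactor ‖(Y t).v‖ ≤ energy mb (Y 0) := by
  obtain ⟨r, hr0, hr⟩ := hρ.exists_radius
  obtain ⟨L, hL0, hL⟩ := exists_lipschitz_bound hρ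
  obtain ⟨M, hM⟩ := (isCompact_Icc (a := (0 : ℝ)) (b := t)).exists_bound_of_continuousOn
    (f := fun s => ((Y s).E, (Y s).B, (Y s).q))
    (hY.continuous_E.prodMk (hY.continuous_B.prodMk hY.continuous_q)).continuousOn
  have hMs : ∀ s ∈ Set.Icc 0 t, ‖(Y s).E‖ ≤ M ∧ ‖(Y s).B‖ ≤ M ∧ ‖(Y s).q‖ ≤ M := fun s hs => by
    have := hM s hs
    simp only [Prod.norm_mk, sup_le_iff] at this
    exact this
  have hM0 : 0 ≤ M := (norm_nonneg _).trans (hM 0 ⟨le_rfl, ht⟩)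
  have hroot : ∀ s ∈ Set.Icc 0 t, ballRoot (‖(Y s).q‖ + r + 2) ≤ ballRoot (M + r + 2) := by
    intro s hs
    unfold ballRoot
    have := (hMs s hs).2.2
    gcongr
    exact ENNReal.rpow_ne_top_of_nonneg (by norm_num) measure_closedBall_lt_top.ne
  -- `η` bounds the gradient of the cut-off; the width `η / (η + 1)` of the mollifier tends to zero
  -- with `η` and stays below one, so that the support of the mollified charge stays bounded
  have key : ∀ η : ℝ, 0 < η → mb * lorentzFactor ‖(Y t).v‖ ≤ energy mb (Y 0) +
      (27 * (η * (M ^ 2 + M ^ 2)) +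
        3 * (M * (2 * (L * (η / (η + 1))) * ballRoot (M + r + 2)))) * t := by
    intro η hη
    obtain ⟨κ, hκ⟩ := exists_isMollifier (ε := η / (η + 1)) (by positivity)
    obtain ⟨ψ, hψ, hψ0, hψ1, hψe, hψd⟩ := exists_cutoff (r := M + r + 2) (by positivity) hη
    set δ := 27 * (η * (M ^ 2 + M ^ 2)) +
      3 * (M * (2 * (L * (η / (η + 1))) * ballRoot (M + r + 2)))
    set Z : ℝ → ℝ := fun s => (∫ x, ψ x * mollifiedEnergy κ (Y s) x) +
      mb * lorentzFactor ‖(Y s).v‖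
    have hZ : ∀ s, HasDerivAt Z _ s := fun s =>
      (hY.hasDerivAt_mollifiedEnergy hρ hκ.isTest hψ s).add
        ((hY.hasDerivAt_lorentzFactor hmb hρ s).const_mul mb)
    have hbd : ∀ s ∈ Set.Ico 0 t, deriv Z s ≤ δ := by
      intro s hs
      have hs' := Set.Ico_subset_Icc_self hs
      obtain ⟨h1, h2, h3⟩ := hMs s hs'
      have hE0 : 0 ≤ ‖(Y s).E‖ := norm_nonneg _
      have hB0 : 0 ≤ ‖(Y s).B‖ := norm_nonneg _
      -- the magnetic force does no work
      have hwork : ⟪(Y s).v, lorentzForce ρ (Y s)⟫ =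
          ∑ i, (Y s).v i * pair (Y s).E (ee i) fun x => ρ (x - (Y s).q) := by
        have hc : cross (Y s).v (Y s).v = 0 := by
          rw [cross_apply]; ext i; fin_cases i <;> simp <;> ring
        rw [real_inner_comm, inner_lorentzForce hρ, hc, ← pair_eq_sum (hρ.comp_sub _).continuous
          (hρ.comp_sub _).compact]
        simp [pair]
      rw [(hZ s).deriv, hwork, ← mul_assoc, mul_inv_cancel₀ hmb.ne', one_mul, sub_add,
        ← Finset.sum_sub_distrib]
      have hf := abs_flux_le hκ hψd (Y s)
      have hsum : |∑ i, ((Y s).v i * (∫ x, ψ x * (mollify κ (Y s).E (ee i) x *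
          mollifiedCharge κ ρ (x - (Y s).q))) - (Y s).v i * pair (Y s).E (ee i) fun x =>
            ρ (x - (Y s).q))| ≤
          ∑ i : Fin 3, M * (2 * (L * (η / (η + 1))) * ballRoot (M + r + 2)) := by
        refine (Finset.abs_sum_le_sum_abs _ _).trans (Finset.sum_le_sum fun i _ => ?_)
        rw [← mul_sub, abs_mul]
        have hvi : |(Y s).v i| ≤ 1 := by
          have := PiLp.norm_apply_le (Y s).v i
          exact this.trans (hY.norm_v_lt s).le
        refine (mul_le_of_le_one_left (abs_nonneg _) hvi).trans ?_
        refine (abs_work_sub_le hκ hρ (by positivity) (div_le_one_of_le₀ (by linarith) (by linarith))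
          hr hL0 hL _ _ i fun x hx => hψe x (by linarith)).trans ?_
        have := hroot s hs'
        have := ballRoot_nonneg (‖(Y s).q‖ + r + 2)
        gcongr
      simp only [Finset.sum_const, Finset.card_univ, Fintype.card_fin, nsmul_eq_mul] at hsum
      have hη' : η * (‖(Y s).E‖ ^ 2 + ‖(Y s).B‖ ^ 2) ≤ η * (M ^ 2 + M ^ 2) := by gcongr
      have a1 := le_abs_self (flux κ ψ (Y s))
      have a2 := (abs_le.1 hsum).1
      push_cast at a2
      simp only [δ]
      linarith
    have hmv := (convex_Icc 0 t).image_sub_le_mul_sub_of_deriv_le (f := Z) (C := δ)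
      (fun s _ => (hZ s).continuousAt.continuousWithinAt)
      (fun s _ => (hZ s).differentiableAt.differentiableWithinAt)
      (fun s hs => hbd s (by rw [interior_Icc] at hs; exact Set.Ioo_subset_Ico_self hs))
      0 ⟨le_rfl, ht⟩ t ⟨ht, le_rfl⟩ ht
    have h0 := integral_mollifiedEnergy_le hκ hψ hψ1 (Y 0)
    have h1 : 0 ≤ ∫ x, ψ x * mollifiedEnergy κ (Y t) x :=
      integral_nonneg fun x => mul_nonneg (hψ0 x) (mollifiedEnergy_nonneg _ _ _)
    simp only [Z, sub_zero] at hmv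
    unfold energy
    linarith
  have hlim : Tendsto (fun η : ℝ => energy mb (Y 0) + (27 * (η * (M ^ 2 + M ^ 2)) +
      3 * (M * (2 * (L * (η / (η + 1))) * ballRoot (M + r + 2)))) * t) (𝓝[>] 0)
      (𝓝 (energy mb (Y 0))) := by
    have hc : ContinuousAt (fun η : ℝ => energy mb (Y 0) + (27 * (η * (M ^ 2 + M ^ 2)) +
      3 * (M * (2 * (L * (η / (η + 1))) * ballRoot (M + r + 2)))) * t) 0 := by
      fun_prop (disch := norm_num)
    have := hc.tendsto.mono_left (nhdsWithin_le_nhds (s := Set.Ioi 0))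
    simpa using this
  exact ge_of_tendsto hlim (eventually_mem_nhdsWithin.mono fun η hη => key η hη)

end Energy

/-! ### Retarded representation of the fields -/

lemma continuous_integral_mul_wave {S : ℝ → R3 → ℝ} (hS : Continuous (Function.uncurry S))
    {χ : R3 → ℝ} (hχ : IsTest χ) (θ : ℝ → ℝ) (hθ : Continuous θ) :
    Continuous fun s => ∫ x, S s x * wave χ (θ s, x) := by
  have hU := isTestCurve_wave hχ
  have hUc := hU.continuous
  rw [continuous_iff_continuousAt]
  intro s₀
  obtain ⟨r, hr⟩ := hU.supp (|θ s₀| + 1)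
  obtain ⟨δ, hδ, hδ'⟩ := Metric.continuousAt_iff.1 hθ.continuousAt 1 one_pos
  refine continuousAt_integral_of_compact_support (H := fun s x => S s x * wave χ (θ s, x))
    (hS.mul (hUc.comp (by fun_prop : Continuous fun p : ℝ × R3 => (θ p.1, p.2)))) hδ
    (isCompact_closedBall (0 : R3) r) fun s hs x hx => ?_
  by_contra hne
  refine hx (mem_closedBall_zero_iff.2 (hr (θ s) x ?_ (right_ne_zero_of_mul hne)))
  have h1 := hδ' (x := s) (by rwa [Real.dist_eq])
  rw [Real.dist_eq] at h1
  have := abs_sub_abs_le_abs_sub (θ s) (θ s₀)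
  linarith

/-- Comparison of a retarded integral with the retarded integral of another source, when the first
source leaves the backward light cone after the time `T`. -/
lemma abs_sub_retarded_le {G : ℝ → ℝ} {S S₀ : ℝ → R3 → ℝ} {χ : R3 → ℝ} (hχ : IsTest χ)
    (hS : Continuous (Function.uncurry S)) (hS₀ : Continuous (Function.uncurry S₀)) {T t δ : ℝ}
    (hT : 0 ≤ T) (hTt : T ≤ t) (hδ : 0 ≤ δ) (hG : Continuous G)
    (hd : ∀ s, s < t → HasDerivAt G (∫ x, S s x * wave χ (t - s, x)) s)
    (hvan : ∀ τ, T < τ → τ ≤ t → ∀ x, wave χ (τ, x) ≠ 0 → S (t - τ) x = 0)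
    (hbd : ∀ τ, 0 ≤ τ → τ ≤ T → ∀ x, |S (t - τ) x - S₀ τ x| ≤ δ) :
    |G t - G 0 - ∫ τ in (0 : ℝ)..T, ∫ x, S₀ τ x * wave χ (τ, x)| ≤
      T * (δ * (T * ∫ x, |χ x|)) := by
  have hc : Continuous fun s => ∫ x, S s x * wave χ (t - s, x) :=
    continuous_integral_mul_wave hS hχ _ (by fun_prop)
  have hS' : Continuous (Function.uncurry fun τ x => S (t - τ) x) :=
    hS.comp (by fun_prop : Continuous fun p : ℝ × R3 => (t - p.1, p.2))
  have hc' : Continuous fun τ => ∫ x, S (t - τ) x * wave χ (τ, x) :=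
    continuous_integral_mul_wave hS' hχ _ continuous_id
  have hc₀ : Continuous fun τ => ∫ x, S₀ τ x * wave χ (τ, x) :=
    continuous_integral_mul_wave hS₀ hχ _ continuous_id
  have hftc := intervalIntegral.integral_eq_sub_of_hasDerivAt_of_le (hT.trans hTt) hG.continuousOn
    (fun s hs => hd s hs.2) (hc.intervalIntegrable 0 t)
  have hsub := intervalIntegral.integral_comp_sub_left (a := 0) (b := t)
    (fun s => ∫ x, S s x * wave χ (t - s, x)) t
  simp only [sub_sub_cancel, sub_self, sub_zero] at hsub
  have hzero : ∫ τ in T..t, ∫ x, S (t - τ) x * wave χ (τ, x) = 0 := by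
    refine intervalIntegral.integral_zero_ae (Eventually.of_forall fun τ hτ => ?_)
    rw [Set.uIoc_of_le hTt] at hτ
    refine integral_eq_zero_of_ae (Eventually.of_forall fun x => ?_)
    by_cases hw : wave χ (τ, x) = 0
    · simp [hw]
    · simp [hvan τ hτ.1 hτ.2 x hw]
  rw [← hftc, ← hsub, ← intervalIntegral.integral_add_adjacent_intervals
    (hc'.intervalIntegrable 0 T) (hc'.intervalIntegrable T t), hzero, add_zero,
    ← intervalIntegral.integral_sub (hc'.intervalIntegrable 0 T) (hc₀.intervalIntegrable 0 T)]
  have hI : 0 ≤ ∫ x, |χ x| := integral_nonneg fun _ => abs_nonneg _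
  have hle : ∀ τ ∈ Set.uIoc 0 T, ‖(∫ x, S (t - τ) x * wave χ (τ, x)) -
      ∫ x, S₀ τ x * wave χ (τ, x)‖ ≤ δ * (T * ∫ x, |χ x|) := by
    intro τ hτ
    rw [Set.uIoc_of_le hT] at hτ
    have hw := (isTestCurve_wave hχ).slice τ
    have hi : ∀ S : ℝ → R3 → ℝ, Continuous (Function.uncurry S) →
        Integrable fun x => S τ x * wave χ (τ, x) := fun S hS =>
      ((hS.comp (by fun_prop : Continuous fun x : R3 => (τ, x))).mul
        hw.continuous).integrable_of_hasCompactSupport hw.compact.mul_left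
    rw [← integral_sub (hi _ hS') (hi _ hS₀)]
    simp only [← sub_mul]
    refine (abs_integral_mul_wave_le hχ.continuous hχ.compact hτ.1.le hδ
      fun x _ => hbd τ hτ.1.le hτ.2 x).trans ?_
    gcongr
    exact hτ.2
  have := intervalIntegral.norm_integral_le_of_norm_le_const hle
  rw [Real.norm_eq_abs, sub_zero, abs_of_nonneg hT] at this
  linarith

/-- `K` bounds a charge distribution, its first derivatives, and their Lipschitz constants. -/
structure IsSourceBound (K : ℝ) (ρ : R3 → ℝ) : Prop where
  nonneg : 0 ≤ K
  bound : ∀ x, |ρ x| ≤ K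
  dd_bound : ∀ b x, |dd b ρ x| ≤ K * ‖b‖
  dd_lipschitz : ∀ b x y, |dd b ρ x - dd b ρ y| ≤ K * ‖b‖ * ‖x - y‖

lemma exists_isSourceBound {ρ : R3 → ℝ} (hρ : IsTest ρ) : ∃ K, IsSourceBound K ρ := by
  obtain ⟨C, hC0, hC⟩ := hρ.exists_bound
  choose D hD0 hD using fun i => (hρ.dd (ee i)).exists_bound
  choose L hL0 hL using fun i => exists_lipschitz_bound (hρ.dd (ee i))
  have hb : ∀ (b : R3) i, |b i| ≤ ‖b‖ := fun b i => PiLp.norm_apply_le b i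
  have hDs : 0 ≤ ∑ i, D i := Finset.sum_nonneg fun i _ => (hD0 i).le
  have hLs : 0 ≤ ∑ i, L i := Finset.sum_nonneg fun i _ => hL0 i
  refine ⟨C + ∑ i, D i + ∑ i, L i, by positivity, fun x => (hC x).trans (by linarith),
    fun b x => ?_, fun b x y => ?_⟩
  · rw [dd_eq_sum]
    calc |∑ i, b i * dd (ee i) ρ x| ≤ ∑ i, |b i * dd (ee i) ρ x| := Finset.abs_sum_le_sum_abs _ _
      _ ≤ ∑ i, ‖b‖ * D i := by
          gcongr with i
          rw [abs_mul]
          exact mul_le_mul (hb b i) (hD i x) (abs_nonneg _) (norm_nonneg _)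
      _ = (∑ i, D i) * ‖b‖ := by rw [← Finset.mul_sum, mul_comm]
      _ ≤ _ := by gcongr; linarith
  · rw [dd_eq_sum, dd_eq_sum b, ← Finset.sum_sub_distrib]
    calc |∑ i, (b i * dd (ee i) ρ x - b i * dd (ee i) ρ y)|
        ≤ ∑ i, |b i * dd (ee i) ρ x - b i * dd (ee i) ρ y| := Finset.abs_sum_le_sum_abs _ _
      _ ≤ ∑ i, ‖b‖ * (L i * ‖x - y‖) := by
          gcongr with i
          rw [← mul_sub, abs_mul]
          exact mul_le_mul (hb b i) (hL i x y) (abs_nonneg _) (norm_nonneg _)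
      _ = (∑ i, L i) * ‖b‖ * ‖x - y‖ := by
          rw [Finset.sum_mul, Finset.sum_mul]
          exact Finset.sum_congr rfl fun i _ => by ring
      _ ≤ _ := by gcongr; linarith

lemma dd_const_mul {f : R3 → ℝ} (hf : IsTest f) (e : ℝ) (b x : R3) :
    dd b (fun x => e * f x) x = e * dd b f x := by
  unfold dd
  rw [fderiv_const_mul (hf.differentiable x)]; simp

lemma IsSourceBound.const_mul {K : ℝ} {f : R3 → ℝ} (h : IsSourceBound K f) (hf : IsTest f) (e : ℝ) :
    IsSourceBound (|e| * K) fun x => e * f x := by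
  refine ⟨mul_nonneg (abs_nonneg _) h.nonneg, fun x => ?_, fun b x => ?_, fun b x y => ?_⟩
  · rw [abs_mul]
    exact mul_le_mul_of_nonneg_left (h.bound x) (abs_nonneg _)
  · rw [dd_const_mul hf, abs_mul, mul_assoc]
    exact mul_le_mul_of_nonneg_left (h.dd_bound b x) (abs_nonneg _)
  · rw [dd_const_mul hf, dd_const_mul hf, ← mul_sub, abs_mul, mul_assoc, mul_assoc, ← mul_assoc K]
    exact mul_le_mul_of_nonneg_left (h.dd_lipschitz b x y) (abs_nonneg _)

/-- The source `-∇ρ - ∂_t(ρ v)` of the `a`-component of the retarded electric field, for a charge at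
`q` with velocity `v` and acceleration `w`. -/
def sourceE (ρ : R3 → ℝ) (a q v w x : R3) : ℝ :=
  - dd a ρ (x - q) + ⟪v, a⟫ * dd v ρ (x - q) - ⟪w, a⟫ * ρ (x - q)

/-- The source `∇ × (ρ v)` of the `a`-component of the retarded magnetic field. -/
def sourceB (ρ : R3 → ℝ) (a q v x : R3) : ℝ := - dd (cross a v) ρ (x - q)

lemma dd_sub_dir (a b : R3) (g : R3 → ℝ) (x : R3) : dd (a - b) g x = dd a g x - dd b g x := by
  simp [dd]

lemma cross_sub_right (a b c : R3) : cross a (b - c) = cross a b - cross a c := by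
  have := (crossL a).map_sub b c
  simpa only [crossL_apply] using this

lemma abs_dd_sub_dd_le {K : ℝ} {ρ : R3 → ℝ} (hK : IsSourceBound K ρ) (b b' y y' : R3) :
    |dd b ρ y - dd b' ρ y'| ≤ K * ‖b - b'‖ + K * ‖b'‖ * ‖y - y'‖ := by
  have e : dd b ρ y - dd b' ρ y' = dd (b - b') ρ y + (dd b' ρ y - dd b' ρ y') := by
    rw [dd_sub_dir]; ring
  rw [e]
  exact (abs_add_le _ _).trans (add_le_add (hK.dd_bound _ _) (hK.dd_lipschitz _ _ _))

lemma abs_sourceB_sub_le {K : ℝ} {ρ : R3 → ℝ} (hK : IsSourceBound K ρ) {a q q' v v' x : R3}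
    (hv' : ‖v'‖ ≤ 1) :
    |sourceB ρ a q v x - sourceB ρ a q' v' x| ≤ ‖a‖ * K * (‖v - v'‖ + ‖q - q'‖) := by
  unfold sourceB
  have h := abs_dd_sub_dd_le hK (cross a v) (cross a v') (x - q) (x - q')
  rw [← cross_sub_right, show x - q - (x - q') = -(q - q') by abel, norm_neg] at h
  rw [neg_sub_neg, abs_sub_comm]
  refine h.trans ?_
  have h1 := norm_cross_le a (v - v')
  have h2 : ‖cross a v'‖ ≤ ‖a‖ := (norm_cross_le a v').trans (mul_le_of_le_one_right
    (norm_nonneg _) hv')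
  have := hK.nonneg
  calc K * ‖cross a (v - v')‖ + K * ‖cross a v'‖ * ‖q - q'‖ ≤
      K * (‖a‖ * ‖v - v'‖) + K * ‖a‖ * ‖q - q'‖ := by gcongr
    _ = _ := by ring

lemma abs_sourceE_sub_le {K : ℝ} {ρ : R3 → ℝ} (hK : IsSourceBound K ρ) {a q q' v v' w x : R3}
    (hv : ‖v‖ ≤ 1) (hv' : ‖v'‖ ≤ 1) :
    |sourceE ρ a q v w x - sourceE ρ a q' v' 0 x| ≤
      ‖a‖ * K * (2 * ‖v - v'‖ + 2 * ‖q - q'‖ + ‖w‖) := by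
  have hK0 := hK.nonneg
  have h1 := hK.dd_lipschitz a (x - q) (x - q')
  have h2 := abs_dd_sub_dd_le hK v v' (x - q) (x - q')
  rw [show x - q - (x - q') = -(q - q') by abel, norm_neg] at h1 h2
  have h3 := hK.dd_bound v' (x - q')
  have e : sourceE ρ a q v w x - sourceE ρ a q' v' 0 x = - (dd a ρ (x - q) - dd a ρ (x - q')) +
      (⟪v, a⟫ * (dd v ρ (x - q) - dd v' ρ (x - q')) + ⟪v - v', a⟫ * dd v' ρ (x - q')) -
      ⟪w, a⟫ * ρ (x - q) := by
    simp only [sourceE, inner_sub_left, inner_zero_left]; ring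
  have b1 : |⟪v, a⟫| ≤ ‖a‖ := (abs_real_inner_le_norm v a).trans
    (mul_le_of_le_one_left (norm_nonneg _) hv)
  have b2 := abs_real_inner_le_norm (v - v') a
  have b3 := abs_real_inner_le_norm w a
  have b4 := hK.bound (x - q)
  rw [e]
  have c1 : |⟪v, a⟫ * (dd v ρ (x - q) - dd v' ρ (x - q'))| ≤
      ‖a‖ * (K * ‖v - v'‖ + K * 1 * ‖q - q'‖) := by
    rw [abs_mul]
    refine mul_le_mul b1 (h2.trans ?_) (abs_nonneg _) (norm_nonneg _)
    gcongr
  have c2 : |⟪v - v', a⟫ * dd v' ρ (x - q')| ≤ (‖v - v'‖ * ‖a‖) * (K * 1) := by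
    rw [abs_mul]
    refine mul_le_mul b2 (h3.trans ?_) (abs_nonneg _) (by positivity)
    gcongr
  have c3 : |⟪w, a⟫ * ρ (x - q)| ≤ (‖w‖ * ‖a‖) * K := by
    rw [abs_mul]
    exact mul_le_mul b3 b4 (abs_nonneg _) (by positivity)
  have c0 : |-(dd a ρ (x - q) - dd a ρ (x - q'))| ≤ K * ‖a‖ * ‖q - q'‖ := by rwa [abs_neg]
  have := abs_sub (-(dd a ρ (x - q) - dd a ρ (x - q')) +
      (⟪v, a⟫ * (dd v ρ (x - q) - dd v' ρ (x - q')) + ⟪v - v', a⟫ * dd v' ρ (x - q')))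
      (⟪w, a⟫ * ρ (x - q))
  have := abs_add_le (-(dd a ρ (x - q) - dd a ρ (x - q')))
      (⟪v, a⟫ * (dd v ρ (x - q) - dd v' ρ (x - q')) + ⟪v - v', a⟫ * dd v' ρ (x - q'))
  have := abs_add_le (⟪v, a⟫ * (dd v ρ (x - q) - dd v' ρ (x - q'))) (⟪v - v', a⟫ * dd v' ρ (x - q'))
  nlinarith

lemma dd_ne_zero_norm_le {ρ : R3 → ℝ} {r : ℝ} (hr : ∀ x, ρ x ≠ 0 → ‖x‖ ≤ r) {b x : R3}
    (hx : dd b ρ x ≠ 0) : ‖x‖ ≤ r := by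
  by_contra h
  refine hx (dd_eq_zero_of_notMem_tsupport (fun hmem => h ?_) b)
  have : tsupport ρ ⊆ Metric.closedBall 0 r :=
    closure_minimal (fun y hy => by simpa using hr y hy) Metric.isClosed_closedBall
  simpa using this hmem

/-- Soliton fields as retarded integrals over the sources of a uniformly moving charge. -/
lemma integral_solitonE_mul {ρ χ : R3 → ℝ} (hρ : IsTest ρ) (hχ : IsTest χ) {v : R3} (hv : ‖v‖ < 1)
    (a q : R3) {R r T : ℝ} (hχs : ∀ x, χ x ≠ 0 → ‖x - q‖ ≤ R) (hr : ∀ x, ρ x ≠ 0 → ‖x‖ ≤ r)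
    (hT0 : 0 ≤ T) (hT : R + r ≤ T * (1 - ‖v‖)) :
    ∫ x, ⟪solitonE ρ v (x - q), a⟫ * χ x =
      ∫ τ in (0 : ℝ)..T, ∫ x, sourceE ρ a (q - τ • v) v 0 x * wave χ (τ, x) := by
  have hp := fun b => integral_mul_solitonPotential hv (hρ.dd b).continuous hχ.continuous q hχs
    (fun x => dd_ne_zero_norm_le hr (b := b)) hT0 hT
  have hi : ∀ b, Integrable fun x => solitonPotential (dd b ρ) v (x - q) * χ x := fun b =>
    (((continuous_solitonPotential (hρ.dd b) hv).comp (by fun_prop : Continuous fun x : R3 =>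
      x - q)).mul hχ.continuous).integrable_of_hasCompactSupport hχ.compact.mul_left
  have hw : ∀ b, Continuous (Function.uncurry fun (τ : ℝ) x => dd b ρ (x - q + τ • v)) := fun b => by
    have := (hρ.dd b).continuous
    simp only [Function.uncurry_def]
    fun_prop
  have hwc : ∀ b, Continuous fun τ => ∫ x, dd b ρ (x - q + τ • v) * wave χ (τ, x) := fun b =>
    continuous_integral_mul_wave (hw b) hχ _ continuous_id
  have hwi : ∀ b τ, Integrable fun x => dd b ρ (x - q + τ • v) * wave χ (τ, x) := fun b τ => by
    have h := (isTestCurve_wave hχ).slice τ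
    exact (((hw b).comp (by fun_prop : Continuous fun x : R3 => (τ, x))).mul
      h.continuous).integrable_of_hasCompactSupport h.compact.mul_left
  have e1 : ∀ x, ⟪solitonE ρ v (x - q), a⟫ * χ x = ⟪v, a⟫ * (solitonPotential (dd v ρ) v (x - q) *
      χ x) - solitonPotential (dd a ρ) v (x - q) * χ x := fun x => by
    rw [inner_solitonE hρ hv]; ring
  have e2 : ∀ τ x, sourceE ρ a (q - τ • v) v 0 x * wave χ (τ, x) = ⟪v, a⟫ *
      (dd v ρ (x - q + τ • v) * wave χ (τ, x)) - dd a ρ (x - q + τ • v) * wave χ (τ, x) := by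
    intro τ x
    rw [sourceE, inner_zero_left, show x - (q - τ • v) = x - q + τ • v by abel]
    ring
  simp only [e1, e2]
  rw [integral_sub ((hi v).const_mul _) (hi a), integral_const_mul, hp, hp,
    ← intervalIntegral.integral_const_mul, ← intervalIntegral.integral_sub
      (((hwc v).const_mul _).intervalIntegrable _ _) ((hwc a).intervalIntegrable _ _)]
  congr 1; funext τ
  rw [integral_sub ((hwi v τ).const_mul _) (hwi a τ), integral_const_mul]

lemma integral_solitonB_mul {ρ χ : R3 → ℝ} (hρ : IsTest ρ) (hχ : IsTest χ) {v : R3} (hv : ‖v‖ < 1)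
    (a q : R3) {R r T : ℝ} (hχs : ∀ x, χ x ≠ 0 → ‖x - q‖ ≤ R) (hr : ∀ x, ρ x ≠ 0 → ‖x‖ ≤ r)
    (hT0 : 0 ≤ T) (hT : R + r ≤ T * (1 - ‖v‖)) :
    ∫ x, ⟪solitonB ρ v (x - q), a⟫ * χ x =
      ∫ τ in (0 : ℝ)..T, ∫ x, sourceB ρ a (q - τ • v) v x * wave χ (τ, x) := by
  have hp := integral_mul_solitonPotential hv (hρ.dd (cross a v)).continuous hχ.continuous q hχs
    (fun x => dd_ne_zero_norm_le hr) hT0 hT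
  simp only [inner_solitonB hρ hv, neg_mul, integral_neg, hp, sourceB,
    intervalIntegral.integral_neg]
  congr 2; funext τ
  congr 1; funext x
  rw [show x - (q - τ • v) = x - q + τ • v by abel]

/-! ### Fields tested with the adjoint wave -/

lemma integral_mul_dd {g h : R3 → ℝ} (hg : IsTest g) (hh : IsTest h) (b : R3) :
    ∫ x, g x * dd b h x = - ∫ x, dd b g x * h x :=
  integral_mul_fderiv_eq_neg_fderiv_mul_of_integrable
    (((hg.dd b).continuous.mul hh.continuous).integrable_of_hasCompactSupport hh.compact.mul_left)
    ((hg.continuous.mul (hh.dd b).continuous).integrable_of_hasCompactSupport hg.compact.mul_right)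
    ((hg.continuous.mul hh.continuous).integrable_of_hasCompactSupport hg.compact.mul_right)
    (fun x _ => hg.differentiable x) (fun x _ => hh.differentiable x)

/-- The electric field of a state, paired with the adjoint wave `∂_τ u a, ∇u × a`, together with
the boundary term of the current. At `τ = 0` it is the pairing with `χ a`. -/
def retE (ρ : R3 → ℝ) (a : R3) (χ : R3 → ℝ) (τ : ℝ) (S : State) : ℝ :=
  pair S.E a (fun x => dd (1, 0) (wave χ) (τ, x)) +
    ∑ i, pair S.B (cross (ee i) a) (fun x => dd (0, ee i) (wave χ) (τ, x)) -
    ⟪S.v, a⟫ * ∫ x, ρ (x - S.q) * wave χ (τ, x)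

/-- The magnetic field of a state, paired with the adjoint wave. -/
def retB (a : R3) (χ : R3 → ℝ) (τ : ℝ) (S : State) : ℝ :=
  pair S.B a (fun x => dd (1, 0) (wave χ) (τ, x)) -
    ∑ i, pair S.E (cross (ee i) a) (fun x => dd (0, ee i) (wave χ) (τ, x))

lemma pair_eq_zero (F : L2Field) (a : R3) : pair F a (fun _ => 0) = 0 := by simp [pair]

lemma dd_space_wave_zero {χ : R3 → ℝ} (hχ : IsTest χ) (b x : R3) :
    dd (0, b) (wave χ) (0, x) = 0 := by
  rw [dd_space_wave hχ.smooth, wave_zero]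

lemma retE_zero {χ : R3 → ℝ} (hχ : IsTest χ) (ρ : R3 → ℝ) (a : R3) (S : State) :
    retE ρ a χ 0 S = pair S.E a χ := by
  simp [retE, dd_time_wave_zero hχ.smooth, dd_space_wave_zero hχ, wave_zero, pair_eq_zero]

lemma retB_zero {χ : R3 → ℝ} (hχ : IsTest χ) (a : R3) (S : State) :
    retB a χ 0 S = pair S.B a χ := by
  simp [retB, dd_time_wave_zero hχ.smooth, dd_space_wave_zero hχ, pair_eq_zero]

section Solution

variable {mb : ℝ} {ρ : R3 → ℝ} {Y : ℝ → State}

lemma IsSolution.hasDerivAt_integral_charge_wave (hρ : IsTest ρ) (hY : IsSolution mb ρ Y)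
    {χ : R3 → ℝ} (hχ : IsTest χ) (t s : ℝ) :
    HasDerivAt (fun s => ∫ x, ρ (x - (Y s).q) * wave χ (t - s, x))
      (- (∫ x, dd (Y s).v ρ (x - (Y s).q) * wave χ (t - s, x)) -
        ∫ x, ρ (x - (Y s).q) * dd (1, 0) (wave χ) (t - s, x)) s := by
  have hU := isTestCurve_wave hχ
  have hUc := hU.continuous
  have hU' := hU.dd (1, 0)
  have hU'c := hU'.continuous
  have hρc := hρ.continuous
  have hρd : Continuous fun p : ℝ × R3 => dd (Y p.1).v ρ (p.2 - (Y p.1).q) := by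
    have h1 := hρ.smooth.continuous_fderiv (by simp)
    have h2 : Continuous fun p : ℝ × R3 => (Y p.1).v := hY.continuous_v.comp continuous_fst
    exact (h1.comp (continuous_snd.sub (hY.continuous_q.comp continuous_fst))).clm_apply h2
  have hq : Continuous fun p : ℝ × R3 => (Y p.1).q := hY.continuous_q.comp continuous_fst
  obtain ⟨r, hr⟩ := (hU.reflect t).supp (|s| + 1)
  have h := hasDerivAt_integral_of_compact_support (μ := (volume : Measure R3))
    (H := fun s x => ρ (x - (Y s).q) * wave χ (t - s, x))
    (H' := fun s x => - (dd (Y s).v ρ (x - (Y s).q) * wave χ (t - s, x)) -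
      ρ (x - (Y s).q) * dd (1, 0) (wave χ) (t - s, x))
    (by simp only [Function.uncurry_def]; fun_prop)
    (by simp only [Function.uncurry_def]; fun_prop) ?_ (s₀ := s) zero_lt_one
    (isCompact_closedBall (0 : R3) r) (fun s' hs' x hx => ?_)
  · refine h.congr_deriv ?_
    have hw := hU.slice (t - s)
    have hw' := hU'.slice (t - s)
    have i1 : Integrable fun x => dd (Y s).v ρ (x - (Y s).q) * wave χ (t - s, x) :=
      ((hρd.comp (by fun_prop : Continuous fun x : R3 => (s, x))).mul
        hw.continuous).integrable_of_hasCompactSupport hw.compact.mul_left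
    have i2 : Integrable fun x => ρ (x - (Y s).q) * dd (1, 0) (wave χ) (t - s, x) :=
      ((by fun_prop : Continuous fun x => ρ (x - (Y s).q)).mul
        hw'.continuous).integrable_of_hasCompactSupport hw'.compact.mul_left
    have i1' : Integrable fun x => -(dd (Y s).v ρ (x - (Y s).q) * wave χ (t - s, x)) := i1.neg
    rw [integral_sub i1' i2, integral_neg]
  · intro s x
    have h1 : HasDerivAt (fun r => x - (Y r).q) (-(Y s).v) s := (hY.hasDerivAt_q s).const_sub x
    have h2 := (hρ.differentiable (x - (Y s).q)).hasFDerivAt.comp_hasDerivAt s h1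
    have h3 := (hU.reflect t).hasDerivAt_time s x
    rw [hU.dd_reflect] at h3
    refine (h2.mul h3).congr_deriv ?_
    simp [dd]
    ring
  · by_contra hne
    refine hx (mem_closedBall_zero_iff.2 (hr s' x ?_ (right_ne_zero_of_mul hne)))
    have := abs_sub_abs_le_abs_sub s' s
    linarith

lemma IsSolution.continuous_pair_E (hρ : IsTest ρ) (hY : IsSolution mb ρ Y) {W : ℝ × R3 → ℝ}
    (hW : IsTestCurve W) (a : R3) (t : ℝ) :
    Continuous fun s => pair (Y s).E a fun x => W (t - s, x) :=
  continuous_iff_continuousAt.2 fun s => (hasDerivAt_pair hY.continuous_E (hW.reflect t) a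
    (hY.hasDerivAt_pair_E hρ ((hW.reflect t).slice s) a s)).continuousAt

lemma IsSolution.continuous_pair_B (hY : IsSolution mb ρ Y) {W : ℝ × R3 → ℝ}
    (hW : IsTestCurve W) (a : R3) (t : ℝ) :
    Continuous fun s => pair (Y s).B a fun x => W (t - s, x) :=
  continuous_iff_continuousAt.2 fun s => (hasDerivAt_pair hY.continuous_B (hW.reflect t) a
    (hY.hasDerivAt_pair_B ((hW.reflect t).slice s) a s)).continuousAt

lemma IsSolution.continuous_retE (hρ : IsTest ρ) (hY : IsSolution mb ρ Y) {χ : R3 → ℝ}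
    (hχ : IsTest χ) (a : R3) (t : ℝ) : Continuous fun s => retE ρ a χ (t - s) (Y s) := by
  have hU := isTestCurve_wave hχ
  refine ((hY.continuous_pair_E hρ (hU.dd (1, 0)) a t).add (continuous_finsetSum _ fun i _ =>
    hY.continuous_pair_B (hU.dd (0, ee i)) _ t)).sub
      ((hY.continuous_v.inner continuous_const).mul ?_)
  exact continuous_iff_continuousAt.2 fun s =>
    (hY.hasDerivAt_integral_charge_wave hρ hχ t s).continuousAt

lemma IsSolution.continuous_retB (hρ : IsTest ρ) (hY : IsSolution mb ρ Y) {χ : R3 → ℝ}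
    (hχ : IsTest χ) (a : R3) (t : ℝ) : Continuous fun s => retB a χ (t - s) (Y s) := by
  have hU := isTestCurve_wave hχ
  exact (hY.continuous_pair_B (hU.dd (1, 0)) a t).sub (continuous_finsetSum _ fun i _ =>
    hY.continuous_pair_E hρ (hU.dd (0, ee i)) _ t)

/-- The boundary term in `retE` absorbs the time derivative of the wave in the current, so that only
the wave itself is integrated against the source. -/
lemma IsSolution.hasDerivAt_retE (hmb : 0 < mb) (hρ : IsTest ρ) (hY : IsSolution mb ρ Y)
    {χ : R3 → ℝ} (hχ : IsTest χ) (a : R3) {t s : ℝ} (hst : s < t) :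
    HasDerivAt (fun s => retE ρ a χ (t - s) (Y s))
      (∫ x, sourceE ρ a (Y s).q (Y s).v (acceleration mb ρ (Y s)) x * wave χ (t - s, x)) s := by
  have hU := isTestCurve_wave hχ
  have hw := hU.slice (t - s)
  have h1 := hasDerivAt_pair_wave hY.continuous_E hY.continuous_B (κ := 1) (by norm_num)
    (JF := fun s a g => ⟪(Y s).v, a⟫ * ∫ x, ρ (x - (Y s).q) * g x) (JG := fun _ _ _ => 0)
    (Q := fun s g => ∫ x, ρ (x - (Y s).q) * g x)
    (fun g hg a s => (hY.hasDerivAt_pair_E hρ hg a s).congr_deriv (by ring))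
    (fun g hg a s => (hY.hasDerivAt_pair_B hg a s).congr_deriv (by ring))
    (fun g hg s => ((hY.mem_phaseSpace s).2.1).sum_pair hg) hχ a hst
  have h2 := ((hY.hasDerivAt_v hmb hρ s).inner ℝ (hasDerivAt_const s a)).fun_mul
    (hY.hasDerivAt_integral_charge_wave hρ hχ t s)
  have h3 := h1.fun_sub h2
  simp only [one_mul] at h3
  refine h3.congr_deriv ?_
  have hparts : ∫ x, ρ (x - (Y s).q) * dd (0, a) (wave χ) (t - s, x) =
      - ∫ x, dd a ρ (x - (Y s).q) * wave χ (t - s, x) := by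
    have := integral_mul_dd (hρ.comp_sub (Y s).q) hw a
    simpa only [dd_comp_sub, hU.dd_slice] using this
  have hi : ∀ g : R3 → ℝ, IsTest g → Integrable fun x => g (x - (Y s).q) * wave χ (t - s, x) :=
    fun g hg => ((hg.comp_sub _).continuous.mul hw.continuous).integrable_of_hasCompactSupport
      hw.compact.mul_left
  have e : ∀ x, sourceE ρ a (Y s).q (Y s).v (acceleration mb ρ (Y s)) x * wave χ (t - s, x) =
      (⟪(Y s).v, a⟫ * (dd (Y s).v ρ (x - (Y s).q) * wave χ (t - s, x)) -
        dd a ρ (x - (Y s).q) * wave χ (t - s, x)) - ⟪acceleration mb ρ (Y s), a⟫ *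
        (ρ (x - (Y s).q) * wave χ (t - s, x)) := fun x => by
    rw [sourceE]; ring
  simp only [e]
  have i1 : Integrable fun x => ⟪(Y s).v, a⟫ * (dd (Y s).v ρ (x - (Y s).q) * wave χ (t - s, x)) -
      dd a ρ (x - (Y s).q) * wave χ (t - s, x) :=
    ((hi _ (hρ.dd _)).const_mul _).sub (hi _ (hρ.dd _))
  rw [integral_sub i1 ((hi _ hρ).const_mul _),
    integral_sub ((hi _ (hρ.dd _)).const_mul _) (hi _ (hρ.dd _)), integral_const_mul,
    integral_const_mul, hparts]
  simp only [inner_zero_right, zero_add, Finset.sum_const_zero]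
  ring

lemma IsSolution.hasDerivAt_retB (hρ : IsTest ρ) (hY : IsSolution mb ρ Y)
    {χ : R3 → ℝ} (hχ : IsTest χ) (a : R3) {t s : ℝ} (hst : s < t) :
    HasDerivAt (fun s => retB a χ (t - s) (Y s))
      (∫ x, sourceB ρ a (Y s).q (Y s).v x * wave χ (t - s, x)) s := by
  have hU := isTestCurve_wave hχ
  have hw := hU.slice (t - s)
  have h1 := hasDerivAt_pair_wave hY.continuous_B hY.continuous_E (κ := -1) (by norm_num)
    (JG := fun s a g => ⟪(Y s).v, a⟫ * ∫ x, ρ (x - (Y s).q) * g x) (JF := fun _ _ _ => 0)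
    (Q := fun s g => 0)
    (fun g hg a s => (hY.hasDerivAt_pair_B hg a s).congr_deriv (by ring))
    (fun g hg a s => (hY.hasDerivAt_pair_E hρ hg a s).congr_deriv (by ring))
    (fun g hg s => by
      have := ((hY.mem_phaseSpace s).2.2).sum_pair hg
      simpa using this) hχ a hst
  simp only [neg_one_mul, ← sub_eq_add_neg] at h1
  refine h1.congr_deriv ?_
  have hparts : ∀ b, ∫ x, ρ (x - (Y s).q) * dd (0, b) (wave χ) (t - s, x) =
      - ∫ x, dd b ρ (x - (Y s).q) * wave χ (t - s, x) := by
    intro b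
    have := integral_mul_dd (hρ.comp_sub (Y s).q) hw b
    simpa only [dd_comp_sub, hU.dd_slice] using this
  have hi : ∀ g : R3 → ℝ, IsTest g → Integrable fun x => g (x - (Y s).q) * wave χ (t - s, x) :=
    fun g hg => ((hg.comp_sub _).continuous.mul hw.continuous).integrable_of_hasCompactSupport
      hw.compact.mul_left
  have hc : ∀ i, ⟪(Y s).v, cross (ee i) a⟫ = cross a (Y s).v i := fun i => by
    rw [← inner_ee, inner_cross_rotate]
  have e : ∀ x, sourceB ρ a (Y s).q (Y s).v x * wave χ (t - s, x) =
      - ∑ i, cross a (Y s).v i * (dd (ee i) ρ (x - (Y s).q) * wave χ (t - s, x)) := fun x => by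
    rw [sourceB, dd_eq_sum, neg_mul, Finset.sum_mul]
    congr 1
    exact Finset.sum_congr rfl fun i _ => by ring
  simp only [e, hparts, hc]
  rw [integral_neg, integral_finsetSum _ fun i _ => (hi _ (hρ.dd _)).const_mul _]
  simp only [integral_const_mul]
  simp

end Solution

/-! ### Deviation of the fields near the charge -/

lemma lorentzFactor_le_iff {s s' : ℝ} (h0 : 0 ≤ s) (h1 : s < 1) (h0' : 0 ≤ s') (h1' : s' < 1) :
    lorentzFactor s ≤ lorentzFactor s' ↔ s ≤ s' := by
  unfold lorentzFactor
  have hp : 0 < 1 - s ^ 2 := by nlinarith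
  have hp' : 0 < 1 - s' ^ 2 := by nlinarith
  rw [one_div_le_one_div (Real.sqrt_pos.2 hp) (Real.sqrt_pos.2 hp'), Real.sqrt_le_sqrt_iff hp.le,
    sub_le_sub_iff_left, sq_le_sq₀ h0 h0']

lemma norm_sub_le_of_sourceE_ne_zero {ρ : R3 → ℝ} {r : ℝ} (hr : ∀ x, ρ x ≠ 0 → ‖x‖ ≤ r)
    {a q v w x : R3} (h : sourceE ρ a q v w x ≠ 0) : ‖x - q‖ ≤ r := by
  by_contra hlt
  have h1 : ∀ b, dd b ρ (x - q) = 0 := fun b => by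
    by_contra hne; exact hlt (dd_ne_zero_norm_le hr hne)
  have h2 : ρ (x - q) = 0 := by by_contra hne; exact hlt (hr _ hne)
  exact h (by simp [sourceE, h1, h2])

lemma norm_sub_le_of_sourceB_ne_zero {ρ : R3 → ℝ} {r : ℝ} (hr : ∀ x, ρ x ≠ 0 → ‖x‖ ≤ r)
    {a q v x : R3} (h : sourceB ρ a q v x ≠ 0) : ‖x - q‖ ≤ r :=
  dd_ne_zero_norm_le hr (neg_ne_zero.1 h)

section Solution

variable {mb : ℝ} {ρ : R3 → ℝ} {Y : ℝ → State}

/-- The speed stays below the speed that corresponds to the initial total energy. -/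
lemma IsSolution.norm_v_le (hmb : 0 < mb) (hρ : IsTest ρ) (hY : IsSolution mb ρ Y) {vbar : ℝ}
    (h0 : 0 ≤ vbar) (h1 : vbar < 1) (hE : energy mb (Y 0) ≤ mb * lorentzFactor vbar) {t : ℝ}
    (ht : 0 ≤ t) : ‖(Y t).v‖ ≤ vbar :=
  (lorentzFactor_le_iff (norm_nonneg _) (hY.norm_v_lt t) h0 h1).1
    (le_of_mul_le_mul_left ((hY.kinetic_energy_le hmb hρ ht).trans hE) hmb)

lemma IsSolution.norm_q_sub_le (hY : IsSolution mb ρ Y) {vbar : ℝ}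
    (hvb : ∀ t, 0 ≤ t → ‖(Y t).v‖ ≤ vbar) {s t : ℝ} (hs : 0 ≤ s) (hst : s ≤ t) :
    ‖(Y t).q - (Y s).q‖ ≤ vbar * (t - s) := by
  have := (convex_Icc s t).norm_image_sub_le_of_norm_hasDerivWithin_le (C := vbar)
    (fun x _ => (hY.hasDerivAt_q x).hasDerivWithinAt) (fun x hx => hvb x (hs.trans hx.1))
    (Set.left_mem_Icc.2 hst) (Set.right_mem_Icc.2 hst)
  rwa [Real.norm_eq_abs, abs_of_nonneg (sub_nonneg.2 hst)] at this

lemma IsSolution.norm_v_sub_le (hmb : 0 < mb) (hρ : IsTest ρ) (hY : IsSolution mb ρ Y) {A s t : ℝ}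
    (hA : ∀ r ∈ Set.Icc s t, ‖acceleration mb ρ (Y r)‖ ≤ A) (hst : s ≤ t) :
    ‖(Y t).v - (Y s).v‖ ≤ A * (t - s) := by
  have := (convex_Icc s t).norm_image_sub_le_of_norm_hasDerivWithin_le (C := A)
    (fun x _ => (hY.hasDerivAt_v hmb hρ x).hasDerivWithinAt) hA
    (Set.left_mem_Icc.2 hst) (Set.right_mem_Icc.2 hst)
  rwa [Real.norm_eq_abs, abs_of_nonneg (sub_nonneg.2 hst)] at this

/-- Deviation of the trajectory from its tangent line. -/
lemma IsSolution.norm_q_sub_line_le (hmb : 0 < mb) (hρ : IsTest ρ) (hY : IsSolution mb ρ Y)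
    {A s t : ℝ} (hA : ∀ r ∈ Set.Icc s t, ‖acceleration mb ρ (Y r)‖ ≤ A) (hst : s ≤ t) :
    ‖(Y s).q - ((Y t).q - (t - s) • (Y t).v)‖ ≤ A * (t - s) ^ 2 := by
  have hA0 : 0 ≤ A := (norm_nonneg _).trans (hA s (Set.left_mem_Icc.2 hst))
  have hd : ∀ x, HasDerivAt (fun r => (Y r).q - r • (Y t).v) ((Y x).v - (Y t).v) x := fun x => by
    simpa using (hY.hasDerivAt_q x).fun_sub ((hasDerivAt_id x).smul_const (Y t).v)
  have := (convex_Icc s t).norm_image_sub_le_of_norm_hasDerivWithin_le (C := A * (t - s))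
    (fun x _ => (hd x).hasDerivWithinAt) (fun x hx => ?_)
    (Set.right_mem_Icc.2 hst) (Set.left_mem_Icc.2 hst)
  · rw [Real.norm_eq_abs, abs_sub_comm, abs_of_nonneg (sub_nonneg.2 hst)] at this
    refine (le_of_eq ?_).trans (this.trans (le_of_eq (by ring)))
    congr 1
    module
  · rw [norm_sub_rev]
    refine (hY.norm_v_sub_le hmb hρ (fun r hr => hA r ⟨hx.1.trans hr.1, hr.2⟩) hx.2).trans ?_
    gcongr
    exact hx.1

/-- After the time `T` the charge has left the backward light cone of the support of `χ`. -/
lemma IsSolution.norm_le_of_wave_ne_zero (hY : IsSolution mb ρ Y) {vbar : ℝ} (hvb1 : vbar < 1)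
    (hvb : ∀ t, 0 ≤ t → ‖(Y t).v‖ ≤ vbar) {χ : R3 → ℝ} {R r T t τ : ℝ}
    (hχs : ∀ x, χ x ≠ 0 → ‖x - (Y t).q‖ ≤ R) (hT : R + r ≤ T * (1 - vbar)) (hτ : T < τ)
    (hτ0 : 0 ≤ τ) (hτt : τ ≤ t) {x : R3} (hx : wave χ (τ, x) ≠ 0) : r < ‖x - (Y (t - τ)).q‖ := by
  have h1 := shell_of_sphMean_ne_zero hχs hτ0 (right_ne_zero_of_mul hx)
  have h2 := hY.norm_q_sub_le hvb (sub_nonneg.2 hτt) (sub_le_self t hτ0)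
  have h3 := (abs_le.1 h1).1
  have h4 := norm_sub_le_norm_sub_add_norm_sub x (Y (t - τ)).q (Y t).q
  rw [norm_sub_rev (Y (t - τ)).q] at h4
  nlinarith

/-- The electric field near the charge is, up to the contribution of the initial data, the soliton
field, with an error that is controlled by the acceleration during a bounded time span. -/
lemma IsSolution.abs_pair_E_sub_le (hmb : 0 < mb) (hρ : IsTest ρ) (hY : IsSolution mb ρ Y)
    {vbar : ℝ} (hvb1 : vbar < 1) (hvb : ∀ t, 0 ≤ t → ‖(Y t).v‖ ≤ vbar) {χ : R3 → ℝ}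
    (hχ : IsTest χ) (a : R3) {R r T t A K : ℝ} (hK : IsSourceBound K ρ)
    (hr : ∀ x, ρ x ≠ 0 → ‖x‖ ≤ r) (hχs : ∀ x, χ x ≠ 0 → ‖x - (Y t).q‖ ≤ R)
    (hT0 : 0 ≤ T) (hT : R + r ≤ T * (1 - vbar)) (hTt : T ≤ t)
    (hA : ∀ s ∈ Set.Icc (t - T) t, ‖acceleration mb ρ (Y s)‖ ≤ A) :
    |pair (Y t).E a χ - retE ρ a χ t (Y 0) -
        ∫ x, ⟪solitonE ρ (Y t).v (x - (Y t).q), a⟫ * χ x| ≤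
      T * (‖a‖ * K * (A * (2 * T + 2 * T ^ 2 + 1)) * (T * ∫ x, |χ x|)) := by
  have hA0 : 0 ≤ A := (norm_nonneg _).trans (hA t ⟨by linarith, le_rfl⟩)
  have hK0 := hK.nonneg
  have ht0 := hT0.trans hTt
  have hTv : R + r ≤ T * (1 - ‖(Y t).v‖) := hT.trans
    (mul_le_mul_of_nonneg_left (by linarith [hvb t ht0]) hT0)
  rw [integral_solitonE_mul hρ hχ (hY.norm_v_lt t) a (Y t).q hχs hr hT0 hTv]
  have hacc := hY.continuous_acceleration hρ (mb := mb)
  have hρc := hρ.continuous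
  have hρ' := hρ.smooth.continuous_fderiv (by simp)
  have hcont : ∀ q v w : ℝ → R3, Continuous q → Continuous v → Continuous w →
      Continuous (Function.uncurry fun s x => sourceE ρ a (q s) (v s) (w s) x) := by
    intro q v w hq hv hw
    have h1 : Continuous fun p : ℝ × R3 => fderiv ℝ ρ (p.2 - q p.1) := hρ'.comp (by fun_prop)
    have h2 : Continuous fun p : ℝ × R3 => fderiv ℝ ρ (p.2 - q p.1) (v p.1) :=
      h1.clm_apply (by fun_prop)
    have h3 : Continuous fun p : ℝ × R3 => fderiv ℝ ρ (p.2 - q p.1) a :=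
      h1.clm_apply (by fun_prop)
    simp only [Function.uncurry_def, sourceE, dd]
    fun_prop
  have h := abs_sub_retarded_le (G := fun s => retE ρ a χ (t - s) (Y s))
    (S := fun s x => sourceE ρ a (Y s).q (Y s).v (acceleration mb ρ (Y s)) x)
    (S₀ := fun τ x => sourceE ρ a ((Y t).q - τ • (Y t).v) (Y t).v 0 x) hχ
    (hcont _ _ _ hY.continuous_q hY.continuous_v hacc)
    (hcont (fun τ => (Y t).q - τ • (Y t).v) _ _ (by fun_prop) continuous_const continuous_const)
    (δ := ‖a‖ * K * (A * (2 * T + 2 * T ^ 2 + 1))) hT0 hTt (by positivity)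
    (hY.continuous_retE hρ hχ a t) (fun s hs => hY.hasDerivAt_retE hmb hρ hχ a hs) ?_ ?_
  · simpa only [sub_self, sub_zero, retE_zero hχ] using h
  · intro τ hτ hτt x hx
    by_contra hne
    exact absurd (norm_sub_le_of_sourceE_ne_zero hr hne)
      (not_le.2 (hY.norm_le_of_wave_ne_zero hvb1 hvb hχs hT hτ (hT0.trans hτ.le) hτt hx))
  · intro τ hτ0 hτT x
    have hA' : ∀ s ∈ Set.Icc (t - τ) t, ‖acceleration mb ρ (Y s)‖ ≤ A := fun s hs =>
      hA s ⟨by linarith [hs.1], hs.2⟩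
    have h1 := hY.norm_v_sub_le hmb hρ hA' (by linarith)
    have h2 := hY.norm_q_sub_line_le hmb hρ hA' (by linarith)
    have h3 := hA' (t - τ) ⟨le_rfl, by linarith⟩
    rw [sub_sub_cancel] at h1 h2
    rw [norm_sub_rev] at h1
    refine (abs_sourceE_sub_le hK (hY.norm_v_lt _).le (hY.norm_v_lt _).le).trans ?_
    gcongr
    calc 2 * ‖(Y (t - τ)).v - (Y t).v‖ + 2 * ‖(Y (t - τ)).q - ((Y t).q - τ • (Y t).v)‖ +
        ‖acceleration mb ρ (Y (t - τ))‖ ≤ 2 * (A * τ) + 2 * (A * τ ^ 2) + A := by gcongr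
      _ ≤ 2 * (A * T) + 2 * (A * T ^ 2) + A := by gcongr
      _ = _ := by ring

/-- The magnetic counterpart of `IsSolution.abs_pair_E_sub_le`. -/
lemma IsSolution.abs_pair_B_sub_le (hmb : 0 < mb) (hρ : IsTest ρ) (hY : IsSolution mb ρ Y)
    {vbar : ℝ} (hvb1 : vbar < 1) (hvb : ∀ t, 0 ≤ t → ‖(Y t).v‖ ≤ vbar) {χ : R3 → ℝ}
    (hχ : IsTest χ) (a : R3) {R r T t A K : ℝ} (hK : IsSourceBound K ρ)
    (hr : ∀ x, ρ x ≠ 0 → ‖x‖ ≤ r) (hχs : ∀ x, χ x ≠ 0 → ‖x - (Y t).q‖ ≤ R)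
    (hT0 : 0 ≤ T) (hT : R + r ≤ T * (1 - vbar)) (hTt : T ≤ t)
    (hA : ∀ s ∈ Set.Icc (t - T) t, ‖acceleration mb ρ (Y s)‖ ≤ A) :
    |pair (Y t).B a χ - retB a χ t (Y 0) -
        ∫ x, ⟪solitonB ρ (Y t).v (x - (Y t).q), a⟫ * χ x| ≤
      T * (‖a‖ * K * (A * (2 * T + 2 * T ^ 2 + 1)) * (T * ∫ x, |χ x|)) := by
  have hA0 : 0 ≤ A := (norm_nonneg _).trans (hA t ⟨by linarith, le_rfl⟩)
  have hK0 := hK.nonneg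
  have ht0 := hT0.trans hTt
  have hTv : R + r ≤ T * (1 - ‖(Y t).v‖) := hT.trans
    (mul_le_mul_of_nonneg_left (by linarith [hvb t ht0]) hT0)
  rw [integral_solitonB_mul hρ hχ (hY.norm_v_lt t) a (Y t).q hχs hr hT0 hTv]
  have hρ' := hρ.smooth.continuous_fderiv (by simp)
  have hcont : ∀ q v : ℝ → R3, Continuous q → Continuous v →
      Continuous (Function.uncurry fun s x => sourceB ρ a (q s) (v s) x) := by
    intro q v hq hv
    have h1 : Continuous fun p : ℝ × R3 => fderiv ℝ ρ (p.2 - q p.1) := hρ'.comp (by fun_prop)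
    have h2 : Continuous fun p : ℝ × R3 => cross a (v p.1) :=
      (continuous_cross continuous_const hv).comp continuous_fst
    exact (h1.clm_apply h2).neg
  have h := abs_sub_retarded_le (G := fun s => retB a χ (t - s) (Y s))
    (S := fun s x => sourceB ρ a (Y s).q (Y s).v x)
    (S₀ := fun τ x => sourceB ρ a ((Y t).q - τ • (Y t).v) (Y t).v x) hχ
    (hcont _ _ hY.continuous_q hY.continuous_v)
    (hcont (fun τ => (Y t).q - τ • (Y t).v) _ (by fun_prop) continuous_const)
    (δ := ‖a‖ * K * (A * (2 * T + 2 * T ^ 2 + 1))) hT0 hTt (by positivity)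
    (hY.continuous_retB hρ hχ a t) (fun s hs => hY.hasDerivAt_retB hρ hχ a hs) ?_ ?_
  · simpa only [sub_self, sub_zero, retB_zero hχ] using h
  · intro τ hτ hτt x hx
    by_contra hne
    exact absurd (norm_sub_le_of_sourceB_ne_zero hr hne)
      (not_le.2 (hY.norm_le_of_wave_ne_zero hvb1 hvb hχs hT hτ (hT0.trans hτ.le) hτt hx))
  · intro τ hτ0 hτT x
    have hA' : ∀ s ∈ Set.Icc (t - τ) t, ‖acceleration mb ρ (Y s)‖ ≤ A := fun s hs =>
      hA s ⟨by linarith [hs.1], hs.2⟩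
    have h1 := hY.norm_v_sub_le hmb hρ hA' (by linarith)
    have h2 := hY.norm_q_sub_line_le hmb hρ hA' (by linarith)
    rw [sub_sub_cancel] at h1 h2
    rw [norm_sub_rev] at h1
    refine (abs_sourceB_sub_le hK (hY.norm_v_lt _).le).trans ?_
    gcongr
    calc ‖(Y (t - τ)).v - (Y t).v‖ + ‖(Y (t - τ)).q - ((Y t).q - τ • (Y t).v)‖
        ≤ A * τ + A * τ ^ 2 := by gcongr
      _ ≤ A * T + A * T ^ 2 := by gcongr
      _ ≤ A * (2 * T + 2 * T ^ 2 + 1) := by nlinarith [mul_nonneg hA0 hT0, mul_nonneg hA0 (sq_nonneg T)]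

/-- The contribution of the initial data at a time `t` when the light cone has passed the charge. -/
lemma abs_ret_le {S : State} {E B : R3 → R3} (hE : S.E =ᵐ[volume] E) (hB : S.B =ᵐ[volume] B)
    {χ : R3 → ℝ} (hχ : IsTest χ) {p : R3} {R t A A' : ℝ} (hs : ∀ x, χ x ≠ 0 → ‖x - p‖ ≤ R)
    (ht : 0 ≤ t) (hA' : 0 ≤ A')
    (hdE : ∀ x, |‖x - p‖ - t| ≤ R → DifferentiableAt ℝ E x ∧ ‖E x‖ ≤ A ∧ ‖fderiv ℝ E x‖ ≤ A')
    (hdB : ∀ x, |‖x - p‖ - t| ≤ R → DifferentiableAt ℝ B x ∧ ‖B x‖ ≤ A ∧ ‖fderiv ℝ B x‖ ≤ A')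
    (hvan : ∀ x, wave χ (t, x) ≠ 0 → ρ (x - S.q) = 0) (a : R3) :
    |retE ρ a χ t S| ≤ ‖a‖ * (A + 4 * (t * A')) * (∫ x, |χ x|) ∧
      |retB a χ t S| ≤ ‖a‖ * (A + 4 * (t * A')) * ∫ x, |χ x| := by
  have hI : 0 ≤ ∫ x, |χ x| := integral_nonneg fun _ => abs_nonneg _
  have h0 : ∫ x, ρ (x - S.q) * wave χ (t, x) = 0 :=
    integral_eq_zero_of_ae (Eventually.of_forall fun x => by
      by_cases hx : wave χ (t, x) = 0
      · simp [hx]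
      · simp [hvan x hx])
  have key : ∀ (F : L2Field) (F' : R3 → R3), F =ᵐ[volume] F' →
      (∀ x, |‖x - p‖ - t| ≤ R → DifferentiableAt ℝ F' x ∧ ‖F' x‖ ≤ A ∧ ‖fderiv ℝ F' x‖ ≤ A') →
      |∑ i, pair F (cross (ee i) a) fun x => dd (0, ee i) (wave χ) (t, x)| ≤
        3 * (‖a‖ * (t * A') * ∫ x, |χ x|) := by
    intro F F' hF hd
    refine (Finset.abs_sum_le_sum_abs _ _).trans ?_
    have : ∀ i ∈ Finset.univ, |pair F (cross (ee i) a) fun x => dd (0, ee i) (wave χ) (t, x)| ≤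
        ‖a‖ * (t * A') * ∫ x, |χ x| := by
      intro i _
      refine ((abs_pair_wave_le hF hχ hs ht hA' hd (cross (ee i) a)).2 (ee i)).trans ?_
      have := norm_cross_le (ee i) a
      rw [norm_ee, one_mul] at this
      rw [norm_ee, mul_one]
      gcongr
    refine (Finset.sum_le_sum this).trans ?_
    simp
  have hE1 := (abs_pair_wave_le hE hχ hs ht hA' hdE a).1
  have hB1 := (abs_pair_wave_le hB hχ hs ht hA' hdB a).1
  have hE2 := key S.E E hE hdE
  have hB2 := key S.B B hB hdB
  constructor
  · rw [retE, h0, mul_zero, sub_zero]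
    refine (abs_add_le _ _).trans ((add_le_add hE1 hB2).trans (le_of_eq ?_))
    ring
  · rw [retB]
    refine (abs_sub _ _).trans ((add_le_add hB1 hE2).trans (le_of_eq ?_))
    ring

/-- The initial fields on the shell where the backward light cone of the charge meets time `0`. As
the charge moves slower than `vbar`, the shell recedes from the origin at a positive speed. -/
lemma IsSolution.exists_data_bound (hY : IsSolution mb ρ Y) {vbar : ℝ} (hvb1 : vbar < 1)
    (hvb : ∀ t, 0 ≤ t → ‖(Y t).v‖ ≤ vbar) {σ : ℝ} (hσ : 0 < σ) {F : R3 → R3} {R₀ C : ℝ}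
    (hF : ∀ x : R3, R₀ ≤ ‖x‖ → DifferentiableAt ℝ F x ∧
      ‖F x‖ + ‖x‖ * ‖fderiv ℝ F x‖ ≤ C * ‖x‖ ^ (-1 - σ)) (R : ℝ) :
    ∃ D t₁ : ℝ, 0 ≤ D ∧ ∀ t, t₁ ≤ t → ∀ x, |‖x - (Y t).q‖ - t| ≤ R →
      DifferentiableAt ℝ F x ∧ ‖F x‖ ≤ D * (1 + t) ^ (-1 - σ) ∧
        ‖fderiv ℝ F x‖ ≤ D * (1 + t) ^ (-1 - σ) / t := by
  -- `|x| ≥ (1 - vbar) t - const` on the shell; half of the coefficient absorbs the constant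
  set m := (1 - vbar) / 2
  have hm : 0 < m := by simp only [m]; linarith
  set Q := ‖(Y 0).q‖
  refine ⟨|C| * (1 + 1 / m) * (m / 2) ^ (-1 - σ), max 1 (max ((R + Q) / m) (R₀ / m)),
    by positivity, fun t ht x hx => ?_⟩
  have ht1 : 1 ≤ t := (le_max_left _ _).trans ht
  have ht2 : R + Q ≤ m * t := by
    have := ((le_max_left _ _).trans (le_max_right _ _)).trans ht
    rwa [div_le_iff₀' hm] at this
  have ht3 : R₀ ≤ m * t := by
    have := ((le_max_right _ _).trans (le_max_right _ _)).trans ht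
    rwa [div_le_iff₀' hm] at this
  have ht0 : 0 < t := by linarith
  have hxm : m * t ≤ ‖x‖ := by
    have h1 := hY.norm_q_sub_le hvb le_rfl ht0.le
    have h2 := (abs_le.1 hx).1
    have h3 := norm_sub_le x (Y t).q
    have h4 := norm_le_norm_add_norm_sub (Y 0).q (Y t).q
    have : vbar = 1 - 2 * m := by simp only [m]; ring
    rw [this] at h1
    rw [norm_sub_rev (Y 0).q] at h4
    nlinarith
  have hx0 : 0 < ‖x‖ := lt_of_lt_of_le (by positivity) hxm
  obtain ⟨hd, hle⟩ := hF x (ht3.trans hxm)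
  have hpow : ‖x‖ ^ (-1 - σ) ≤ (m / 2) ^ (-1 - σ) * (1 + t) ^ (-1 - σ) := by
    rw [← Real.mul_rpow (by positivity) (by positivity)]
    refine Real.rpow_le_rpow_of_nonpos (by positivity) ?_ (by linarith)
    nlinarith
  have hC : C * ‖x‖ ^ (-1 - σ) ≤ |C| * ((m / 2) ^ (-1 - σ) * (1 + t) ^ (-1 - σ)) := by
    have := le_abs_self C
    gcongr
  have hP : 0 ≤ |C| * ((m / 2) ^ (-1 - σ) * (1 + t) ^ (-1 - σ)) := by positivity
  have hfd := norm_nonneg (fderiv ℝ F x)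
  have hFx := norm_nonneg (F x)
  refine ⟨hd, ?_, ?_⟩
  · have : 0 ≤ ‖x‖ * ‖fderiv ℝ F x‖ := by positivity
    have h1 : 0 ≤ 1 / m * (|C| * ((m / 2) ^ (-1 - σ) * (1 + t) ^ (-1 - σ))) := by positivity
    linarith
  · rw [le_div_iff₀ ht0]
    have h1 : ‖fderiv ℝ F x‖ * (m * t) ≤ |C| * ((m / 2) ^ (-1 - σ) * (1 + t) ^ (-1 - σ)) := by
      nlinarith
    have h2 : ‖fderiv ℝ F x‖ * t ≤
        1 / m * (|C| * ((m / 2) ^ (-1 - σ) * (1 + t) ^ (-1 - σ))) := by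
      rw [one_div, ← div_eq_inv_mul, le_div_iff₀ hm]
      linarith
    linarith

end Solution

/-! ### Decay of the acceleration -/

/-- Algebraic decay is insensitive to a bounded time shift. -/
lemma one_add_rpow_shift_le {p T t : ℝ} (hp0 : 0 ≤ p) (hp : p ≤ 2) (hT : 0 ≤ T) (hTt : T ≤ t) :
    (1 + (t - T)) ^ (-p) ≤ (1 + T) ^ 2 * (1 + t) ^ (-p) := by
  have h1 : 0 < 1 + (t - T) := by linarith
  have h2 : 0 < 1 + t := by linarith
  have h3 : 0 < 1 + T := by linarith
  have h4 : (1 + t) ^ p ≤ (1 + T) ^ p * (1 + (t - T)) ^ p := by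
    rw [← Real.mul_rpow h3.le h1.le]
    exact Real.rpow_le_rpow h2.le (by nlinarith) hp0
  have h5 : (1 + T) ^ p ≤ (1 + T) ^ 2 := by
    have := Real.rpow_le_rpow_of_exponent_le (by linarith : 1 ≤ 1 + T) hp
    rwa [Real.rpow_two] at this
  rw [Real.rpow_neg h1.le, Real.rpow_neg h2.le, inv_le_iff_one_le_mul₀ (by positivity)]
  have h6 : 0 < (1 + t) ^ p := by positivity
  have h7 : 0 < (1 + (t - T)) ^ p := by positivity
  calc 1 = ((1 + t) ^ p)⁻¹ * (1 + t) ^ p := (inv_mul_cancel₀ h6.ne').symm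
    _ ≤ ((1 + t) ^ p)⁻¹ * ((1 + T) ^ 2 * (1 + (t - T)) ^ p) := by
        gcongr
        exact h4.trans (by gcongr)
    _ = _ := by ring

/-- A retarded inequality with a small feedback constant forces algebraic decay: at a maximum point
of `(1 + s)^p g(s)` the feedback is absorbed by the left side. -/
lemma exists_decay_of_retarded {g : ℝ → ℝ} (hg : Continuous g) (hg0 : ∀ t, 0 ≤ g t)
    {p T t₁ D θ : ℝ} (hp0 : 0 ≤ p) (hp : p ≤ 2) (hT : 0 ≤ T) (hTt : T ≤ t₁)
    (hθ0 : 0 ≤ θ) (hθ : θ * (1 + T) ^ 2 ≤ 1 / 2)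
    (h : ∀ t, t₁ ≤ t → ∀ A, (∀ s ∈ Set.Icc (t - T) t, g s ≤ A) →
      g t ≤ D * (1 + t) ^ (-p) + θ * A) :
    ∃ C, 0 ≤ C ∧ ∀ t, 0 ≤ t → g t ≤ C * (1 + t) ^ (-p) := by
  have ht₁ : 0 ≤ t₁ := hT.trans hTt
  set k : ℝ → ℝ := fun s => (1 + s) ^ p * g s
  have hk : ∀ b, ContinuousOn k (Set.Icc 0 b) := fun b =>
    (ContinuousOn.rpow_const (by fun_prop) fun s hs => Or.inr hp0).mul hg.continuousOn
  have hgk : ∀ s, 0 ≤ s → g s = k s * (1 + s) ^ (-p) := fun s hs => by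
    have : 0 < (1 + s) ^ p := Real.rpow_pos_of_pos (by linarith) _
    simp only [k]
    rw [Real.rpow_neg (by linarith)]
    field_simp
  obtain ⟨s₀, hs₀, hmax₀⟩ := isCompact_Icc.exists_isMaxOn ⟨0, Set.left_mem_Icc.2 ht₁⟩ (hk t₁)
  have hk0 : 0 ≤ k s₀ := mul_nonneg (Real.rpow_nonneg (by linarith [hs₀.1]) _) (hg0 _)
  refine ⟨max (k s₀) (2 * D), hk0.trans (le_max_left _ _), fun t ht => ?_⟩
  rw [hgk t ht]
  have hpow : 0 ≤ (1 + t) ^ (-p) := Real.rpow_nonneg (by linarith) _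
  refine mul_le_mul_of_nonneg_right ?_ hpow
  obtain ⟨u, hu, hmax⟩ := isCompact_Icc.exists_isMaxOn ⟨0, Set.left_mem_Icc.2 ht⟩ (hk t)
  refine (hmax (Set.right_mem_Icc.2 ht)).trans ?_
  change k u ≤ _
  rcases le_total u t₁ with hut | hut
  · exact (hmax₀ ⟨hu.1, hut⟩).trans (le_max_left _ _)
  · refine le_trans ?_ (le_max_right _ _)
    have hu0 : 0 ≤ k u := mul_nonneg (Real.rpow_nonneg (by linarith [hu.1]) _) (hg0 _)
    have hb := h u hut (k u * (1 + (u - T)) ^ (-p)) fun s hs => by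
      have hs0 : 0 ≤ s := by linarith [hs.1]
      rw [hgk s hs0]
      have h1 : k s ≤ k u := hmax ⟨hs0, hs.2.trans hu.2⟩
      have h2 : (1 + s) ^ (-p) ≤ (1 + (u - T)) ^ (-p) :=
        Real.rpow_le_rpow_of_nonpos (by linarith) (by linarith [hs.1]) (by linarith)
      have h3 : 0 ≤ (1 + s) ^ (-p) := Real.rpow_nonneg (by linarith) _
      exact mul_le_mul h1 h2 h3 hu0
    have hsh := one_add_rpow_shift_le hp0 hp hT (hTt.trans hut)
    rw [hgk u hu.1] at hb
    have hup : 0 < (1 + u) ^ (-p) := Real.rpow_pos_of_pos (by linarith [hu.1]) _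
    have h4 : θ * (k u * (1 + (u - T)) ^ (-p)) ≤ (1 / 2 * k u) * (1 + u) ^ (-p) := by
      calc θ * (k u * (1 + (u - T)) ^ (-p)) ≤ θ * (k u * ((1 + T) ^ 2 * (1 + u) ^ (-p))) := by
            gcongr
        _ = (θ * (1 + T) ^ 2) * (k u * (1 + u) ^ (-p)) := by ring
        _ ≤ 1 / 2 * (k u * (1 + u) ^ (-p)) := by gcongr
        _ = _ := by ring
    have h5 : k u * (1 + u) ^ (-p) ≤ (D + 1 / 2 * k u) * (1 + u) ^ (-p) := by linarith
    have := le_of_mul_le_mul_right h5 hup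
    linarith

/-! ### The self-force of a soliton -/

lemma solitonPotential_neg (g : R3 → ℝ) (v x : R3) :
    solitonPotential g v (-x) = solitonPotential (fun y => g (-y)) v x := by
  unfold solitonPotential
  rw [← integral_neg_eq_self]
  congr 1; funext y
  rw [show -x - -y = -(x - y) by abel, norm_neg, inner_neg_right, neg_sq]

lemma dd_neg_of_even {ρ : R3 → ℝ} (hρ : Differentiable ℝ ρ) (he : ∀ x, ρ (-x) = ρ x) (b x : R3) :
    dd b ρ (-x) = - dd b ρ x := by
  have h1 := dd_comp_const_sub hρ b 0 x
  simp only [zero_sub, he] at h1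
  linarith

lemma integral_eq_zero_of_odd {h : R3 → ℝ} (hodd : ∀ x, h (-x) = - h x) : ∫ x, h x = 0 := by
  have := integral_neg_eq_self h (volume : Measure R3)
  simp only [hodd, integral_neg] at this
  linarith

/-- The soliton potential of a derivative of an even charge distribution is odd. -/
lemma integral_solitonPotential_mul_eq_zero {ρ : R3 → ℝ} (hρ : IsTest ρ)
    (he : ∀ x, ρ (-x) = ρ x) (b v q : R3) :
    ∫ x, solitonPotential (dd b ρ) v (x - q) * ρ (x - q) = 0 := by
  rw [integral_sub_right_eq_self (fun x => solitonPotential (dd b ρ) v x * ρ x) q]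
  refine integral_eq_zero_of_odd fun x => ?_
  rw [solitonPotential_neg, he]
  simp only [dd_neg_of_even hρ.differentiable he]
  have : solitonPotential (fun y => -dd b ρ y) v x = - solitonPotential (dd b ρ) v x := by
    simp only [solitonPotential, mul_neg, integral_neg]
  rw [this]; ring

section

variable {mb : ℝ} {ρ : R3 → ℝ}

/-- By symmetry a soliton exerts no force on its own charge. -/
lemma integral_soliton_mul_charge (hρ : IsTest ρ) (he : ∀ x, ρ (-x) = ρ x) {v : R3} (hv : ‖v‖ < 1)
    (a q : R3) : ∫ x, ⟪solitonE ρ v (x - q), a⟫ * ρ (x - q) = 0 ∧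
      ∫ x, ⟪solitonB ρ v (x - q), a⟫ * ρ (x - q) = 0 := by
  have hz := fun b => integral_solitonPotential_mul_eq_zero hρ he b v q
  have hi : ∀ b, Integrable fun x => solitonPotential (dd b ρ) v (x - q) * ρ (x - q) := fun b =>
    (((continuous_solitonPotential (hρ.dd b) hv).comp (by fun_prop : Continuous fun x : R3 =>
      x - q)).mul (hρ.comp_sub q).continuous).integrable_of_hasCompactSupport
        (hρ.comp_sub q).compact.mul_left
  constructor
  · have e : ∀ x, ⟪solitonE ρ v (x - q), a⟫ * ρ (x - q) =
        ⟪v, a⟫ * (solitonPotential (dd v ρ) v (x - q) * ρ (x - q)) -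
          solitonPotential (dd a ρ) v (x - q) * ρ (x - q) := fun x => by
      rw [inner_solitonE hρ hv]; ring
    simp only [e]
    rw [integral_sub ((hi v).const_mul _) (hi a), integral_const_mul, hz, hz]; simp
  · simp only [inner_solitonB hρ hv, neg_mul, integral_neg, hz, neg_zero]

variable {Y : ℝ → State}

/-- The feedback constant: the time `T` enters through the length of the retarded time span and
the deviation of the trajectory from a line. -/
def feedback (T : ℝ) : ℝ := T ^ 2 * (2 * T + 2 * T ^ 2 + 1)

/-- The fields near the charge deviate from the soliton fields by the contribution of the initial
data, which decays, and a term that is controlled by the acceleration. -/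
lemma IsSolution.exists_deviation_bound (hmb : 0 < mb) (hρ : IsTest ρ) (hY : IsSolution mb ρ Y)
    {vbar : ℝ} (hvb1 : vbar < 1) (hvb : ∀ t, 0 ≤ t → ‖(Y t).v‖ ≤ vbar) {σ : ℝ} (hσ : 0 < σ)
    (hgood : Y 0 ∈ goodPhaseSpace ρ σ) {R r T K : ℝ} (hK : IsSourceBound K ρ)
    (hr : ∀ x, ρ x ≠ 0 → ‖x‖ ≤ r) (hT0 : 0 ≤ T) (hT : R + r ≤ T * (1 - vbar)) :
    ∃ D t₁ : ℝ, 0 ≤ D ∧ T ≤ t₁ ∧ ∀ t, t₁ ≤ t → ∀ A,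
      (∀ s ∈ Set.Icc (t - T) t, ‖acceleration mb ρ (Y s)‖ ≤ A) → ∀ χ : R3 → ℝ, IsTest χ →
      (∀ x, χ x ≠ 0 → ‖x - (Y t).q‖ ≤ R) → ∀ a : R3,
      |pair (Y t).E a χ - ∫ x, ⟪solitonE ρ (Y t).v (x - (Y t).q), a⟫ * χ x| ≤
        ‖a‖ * (∫ x, |χ x|) * (D * (1 + t) ^ (-1 - σ) + K * A * feedback T) ∧
      |pair (Y t).B a χ - ∫ x, ⟪solitonB ρ (Y t).v (x - (Y t).q), a⟫ * χ x| ≤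
        ‖a‖ * (∫ x, |χ x|) * (D * (1 + t) ^ (-1 - σ) + K * A * feedback T) := by
  obtain ⟨-, E, B, hE, hB, R₀, C, hR₀, hEB⟩ := hgood
  obtain ⟨D₁, t₁, hD₁, h₁⟩ := hY.exists_data_bound hvb1 hvb hσ (F := E) (R₀ := R₀) (C := C)
    (fun x hx => ⟨(hEB x hx).1, by
      have := (hEB x hx).2.2
      have h1 := norm_nonneg (B x)
      have h2 : 0 ≤ ‖x‖ * ‖fderiv ℝ B x‖ := by positivity
      linarith⟩) R
  obtain ⟨D₂, t₂, hD₂, h₂⟩ := hY.exists_data_bound hvb1 hvb hσ (F := B) (R₀ := R₀) (C := C)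
    (fun x hx => ⟨(hEB x hx).2.1, by
      have := (hEB x hx).2.2
      have h1 := norm_nonneg (E x)
      have h2 : 0 ≤ ‖x‖ * ‖fderiv ℝ E x‖ := by positivity
      linarith⟩) R
  refine ⟨5 * (D₁ + D₂), max (T + 1) (max t₁ t₂), by positivity,
    (by linarith : T ≤ T + 1).trans (le_max_left _ _), fun t ht A hA χ hχ hχs a => ?_⟩
  have ht1 : T + 1 ≤ t := (le_max_left _ _).trans ht
  have hta : t₁ ≤ t := ((le_max_left _ _).trans (le_max_right _ _)).trans ht
  have htb : t₂ ≤ t := ((le_max_right _ _).trans (le_max_right _ _)).trans ht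
  have ht0 : 0 < t := by linarith
  set P := (1 + t) ^ (-1 - σ)
  have hP : 0 ≤ P := Real.rpow_nonneg (by linarith) _
  have hret := abs_ret_le (ρ := ρ) hE hB hχ hχs ht0.le (A := (D₁ + D₂) * P)
    (A' := (D₁ + D₂) * P / t) (by positivity)
    (fun x hx => by
      obtain ⟨u1, u2, u3⟩ := h₁ t hta x hx
      refine ⟨u1, u2.trans ?_, u3.trans ?_⟩ <;> gcongr <;> linarith)
    (fun x hx => by
      obtain ⟨u1, u2, u3⟩ := h₂ t htb x hx
      refine ⟨u1, u2.trans ?_, u3.trans ?_⟩ <;> gcongr <;> linarith)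
    (fun x hx => by
      by_contra hne
      have := hY.norm_le_of_wave_ne_zero hvb1 hvb hχs hT (τ := t) (by linarith) ht0.le le_rfl hx
      rw [sub_self] at this
      exact absurd (hr _ hne) (not_le.2 this)) a
  have e : t * ((D₁ + D₂) * P / t) = (D₁ + D₂) * P := by field_simp
  rw [e] at hret
  have hE' := hY.abs_pair_E_sub_le hmb hρ hvb1 hvb hχ a hK hr hχs hT0 hT (by linarith) hA
  have hB' := hY.abs_pair_B_sub_le hmb hρ hvb1 hvb hχ a hK hr hχs hT0 hT (by linarith) hA
  have efb : T * (‖a‖ * K * (A * (2 * T + 2 * T ^ 2 + 1)) * (T * ∫ x, |χ x|)) =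
      ‖a‖ * (∫ x, |χ x|) * (K * A * feedback T) := by unfold feedback; ring
  rw [efb] at hE' hB'
  constructor
  · have := abs_add_le (pair (Y t).E a χ - retE ρ a χ t (Y 0) -
      ∫ x, ⟪solitonE ρ (Y t).v (x - (Y t).q), a⟫ * χ x) (retE ρ a χ t (Y 0))
    rw [show pair (Y t).E a χ - retE ρ a χ t (Y 0) -
      (∫ x, ⟪solitonE ρ (Y t).v (x - (Y t).q), a⟫ * χ x) + retE ρ a χ t (Y 0) =
      pair (Y t).E a χ - ∫ x, ⟪solitonE ρ (Y t).v (x - (Y t).q), a⟫ * χ x by ring] at this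
    linarith [hret.1]
  · have := abs_add_le (pair (Y t).B a χ - retB a χ t (Y 0) -
      ∫ x, ⟪solitonB ρ (Y t).v (x - (Y t).q), a⟫ * χ x) (retB a χ t (Y 0))
    rw [show pair (Y t).B a χ - retB a χ t (Y 0) -
      (∫ x, ⟪solitonB ρ (Y t).v (x - (Y t).q), a⟫ * χ x) + retB a χ t (Y 0) =
      pair (Y t).B a χ - ∫ x, ⟪solitonB ρ (Y t).v (x - (Y t).q), a⟫ * χ x by ring] at this
    linarith [hret.2]

/-- Decay of the acceleration for weakly coupled charges. -/
lemma IsSolution.exists_acceleration_bound (hmb : 0 < mb) (hρ : IsTest ρ)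
    (he : ∀ x, ρ (-x) = ρ x) (hY : IsSolution mb ρ Y)
    {vbar : ℝ} (hvb1 : vbar < 1) (hvb : ∀ t, 0 ≤ t → ‖(Y t).v‖ ≤ vbar) {σ : ℝ} (hσ : 0 < σ)
    (hσ1 : σ ≤ 1) (hgood : Y 0 ∈ goodPhaseSpace ρ σ) {r T K : ℝ} (hK : IsSourceBound K ρ)
    (hr : ∀ x, ρ x ≠ 0 → ‖x‖ ≤ r) (hT0 : 0 ≤ T) (hT : r + r ≤ T * (1 - vbar))
    (hsmall : 4 / mb * (∫ x, |ρ x|) * (K * feedback T) * (1 + T) ^ 2 ≤ 1 / 2) :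
    ∃ C, 0 ≤ C ∧ ∀ t, 0 ≤ t → ‖acceleration mb ρ (Y t)‖ ≤ C * (1 + t) ^ (-1 - σ) := by
  obtain ⟨D, t₁, hD, ht₁, hdev⟩ := hY.exists_deviation_bound hmb hρ hvb1 hvb hσ hgood hK hr hT0 hT
  have hI : 0 ≤ ∫ x, |ρ x| := integral_nonneg fun _ => abs_nonneg _
  have hK0 := hK.nonneg
  have hfb : 0 ≤ feedback T := by unfold feedback; positivity
  have hexp : -1 - σ = -(1 + σ) := by ring
  simp only [hexp] at hdev ⊢
  refine exists_decay_of_retarded (hY.continuous_acceleration hρ).norm (fun _ => norm_nonneg _)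
    (T := T) (t₁ := t₁) (D := 4 / mb * (∫ x, |ρ x|) * D) (by linarith) (by linarith) hT0 ht₁
    (by positivity) hsmall fun t ht A hA => ?_
  set X := D * (1 + t) ^ (-(1 + σ)) + K * A * feedback T
  have hA0 : 0 ≤ A := (norm_nonneg _).trans (hA t ⟨by linarith, le_rfl⟩)
  have hX : 0 ≤ X := by
    have : 0 ≤ (1 + t) ^ (-(1 + σ)) := Real.rpow_nonneg (by linarith) _
    positivity
  have hχ := hρ.comp_sub (Y t).q
  have hIq : ∫ x, |ρ (x - (Y t).q)| = ∫ x, |ρ x| :=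
    integral_sub_right_eq_self (fun x => |ρ x|) (Y t).q
  have hforce : ∀ a, |⟪lorentzForce ρ (Y t), a⟫| ≤ 2 * (‖a‖ * (∫ x, |ρ x|) * X) := by
    intro a
    have hE := (hdev t ht A hA _ hχ (fun x hx => hr _ hx) a).1
    have hB := (hdev t ht A hA _ hχ (fun x hx => hr _ hx) (cross a (Y t).v)).2
    have hv := hY.norm_v_lt t
    rw [(integral_soliton_mul_charge hρ he hv _ _).1, sub_zero, hIq] at hE
    rw [(integral_soliton_mul_charge hρ he hv _ _).2, sub_zero, hIq] at hB
    have hc : ‖cross a (Y t).v‖ ≤ ‖a‖ := (norm_cross_le _ _).trans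
      (mul_le_of_le_one_right (norm_nonneg _) hv.le)
    rw [inner_lorentzForce hρ]
    refine (abs_add_le _ _).trans ?_
    have : ‖cross a (Y t).v‖ * (∫ x, |ρ x|) * X ≤ ‖a‖ * (∫ x, |ρ x|) * X := by gcongr
    linarith
  have hnorm : ‖lorentzForce ρ (Y t)‖ ≤ 2 * ((∫ x, |ρ x|) * X) := by
    have h := hforce (lorentzForce ρ (Y t))
    rw [real_inner_self_eq_norm_sq, abs_of_nonneg (sq_nonneg _)] at h
    by_cases h0 : ‖lorentzForce ρ (Y t)‖ = 0
    · rw [h0]; positivity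
    · have hpos := lt_of_le_of_ne (norm_nonneg _) (Ne.symm h0)
      refine le_of_mul_le_mul_left ?_ hpos
      nlinarith
  refine (norm_acceleration_le hmb (hY.norm_v_lt t)).trans ?_
  calc 2 / mb * ‖lorentzForce ρ (Y t)‖ ≤ 2 / mb * (2 * ((∫ x, |ρ x|) * X)) := by gcongr
    _ = _ := by simp only [X]; ring

end

/-! ### Local energy of the deviation -/

/-- A locally integrable function whose integrals against test functions near a ball are bounded
by the `L¹` norm of the test function is bounded on that ball. -/
lemma ae_abs_le_of_integral_mul_le {h : R3 → ℝ} (hh : LocallyIntegrable h) {q : R3} {R c : ℝ}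
    (H : ∀ χ : R3 → ℝ, IsTest χ → (∀ x, χ x ≠ 0 → ‖x - q‖ ≤ R + 1) →
      |∫ x, h x * χ x| ≤ c * ∫ x, |χ x|) : ∀ᵐ x, ‖x - q‖ ≤ R → |h x| ≤ c := by
  let φ : ℕ → ContDiffBump (0 : R3) := fun n =>
    ⟨1 / (n + 1 : ℝ) / 2, 1 / (n + 1 : ℝ), by positivity, half_lt_self (by positivity)⟩
  have hφ : Tendsto (fun n => (φ n).rOut) atTop (𝓝 0) := tendsto_one_div_add_atTop_nhds_zero_nat
  -- almost every point is the limit of averages against shrinking bumps, of unit mass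
  have hae := ContDiffBump.ae_convolution_tendsto_right_of_locallyIntegrable (K := 2) hφ
    (Eventually.of_forall fun n => by simp only [φ]; linarith) hh
  filter_upwards [hae] with x hx hxq
  refine le_of_tendsto hx.abs (Eventually.of_forall fun n => ?_)
  set κ := (φ n).normed (volume : Measure R3)
  have hκ : IsTest κ := ⟨(φ n).contDiff_normed, (φ n).hasCompactSupport_normed⟩
  have e : convolution κ h (ContinuousLinearMap.lsmul ℝ ℝ) volume x = ∫ y, h y * κ (x - y) := by
    rw [convolution_eq_swap]
    congr 1; funext y
    simp [mul_comm]
  have e1 : ∫ y, |κ (x - y)| = 1 := by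
    rw [integral_sub_left_eq_self (fun y => |κ y|) volume x]
    simp only [κ, abs_of_nonneg ((φ n).nonneg_normed _)]
    exact (φ n).integral_normed
  rw [e]
  have := H _ (hκ.comp_const_sub x) fun y hy => ?_
  · rwa [e1, mul_one] at this
  · have h1 : x - y ∈ Function.support κ := hy
    rw [(φ n).support_normed_eq, mem_ball_zero_iff] at h1
    have h2 : (φ n).rOut ≤ 1 := by
      simp only [φ]
      rw [div_le_one (by positivity)]
      linarith [Nat.cast_nonneg (α := ℝ) n]
    have h3 := norm_sub_le_norm_sub_add_norm_sub y x q
    rw [norm_sub_rev y x] at h3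
    linarith

lemma norm_le_three_mul {w : R3} {c : ℝ} (h : ∀ i, |w i| ≤ c) : ‖w‖ ≤ 3 * c := by
  rw [vec_eq_sum w]
  refine (norm_sum_le _ _).trans ?_
  calc ∑ i, ‖w i • ee i‖ ≤ ∑ _i : Fin 3, c := by
        gcongr with i
        rw [norm_smul, norm_ee, mul_one]
        exact h i
    _ = 3 * c := by simp

/-- The vector version: the pairings control a field pointwise, up to a constant. -/
lemma ae_norm_sub_le_of_pair {F : L2Field} {S : R3 → R3} (hS : ∀ a, Continuous fun x => ⟪S x, a⟫)
    {q : R3} {R c : ℝ} (H : ∀ χ : R3 → ℝ, IsTest χ → (∀ x, χ x ≠ 0 → ‖x - q‖ ≤ R + 1) →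
      ∀ a, |pair F a χ - ∫ x, ⟪S x, a⟫ * χ x| ≤ ‖a‖ * (∫ x, |χ x|) * c) :
    ∀ᵐ x, ‖x - q‖ ≤ R → ‖F x - S x‖ ≤ 3 * c := by
  have hi : ∀ i : Fin 3, ∀ᵐ x, ‖x - q‖ ≤ R → |⟪F x, ee i⟫ - ⟪S x, ee i⟫| ≤ c := by
    intro i
    have hF := locallyIntegrable_of_L2 F (ee i)
    refine ae_abs_le_of_integral_mul_le (h := fun x => ⟪F x, ee i⟫ - ⟪S x, ee i⟫)
      (hF.sub (hS (ee i)).locallyIntegrable) fun χ hχ hs => ?_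
    have h := H χ hχ hs (ee i)
    have i1 := integrable_mul_of_locallyIntegrable hF hχ.continuous hχ.compact
    have i2 : Integrable fun x => ⟪S x, ee i⟫ * χ x :=
      ((hS (ee i)).mul hχ.continuous).integrable_of_hasCompactSupport hχ.compact.mul_left
    rw [pair_eq_integral_mul (Eventually.of_forall fun _ => rfl), ← integral_sub i1 i2, norm_ee,
      one_mul] at h
    simp only [sub_mul]
    linarith
  filter_upwards [eventually_all.2 hi] with x hx hxq
  refine norm_le_three_mul fun i => ?_
  have := hx i hxq
  rwa [← inner_sub_left, inner_ee] at this

lemma localEnergyNorm_le_of_ae {R c : ℝ} (hc : 0 ≤ c) {E B : R3 → R3} {q : R3}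
    (hE : ∀ᵐ x, ‖x - q‖ ≤ R → ‖E x‖ ≤ c) (hB : ∀ᵐ x, ‖x - q‖ ≤ R → ‖B x‖ ≤ c) :
    localEnergyNorm R (fun x => E (x + q)) (fun x => B (x + q)) ≤
      ENNReal.ofReal (c * ballRoot R) := by
  have hq := (measurePreserving_add_right (volume : Measure R3) q).quasiMeasurePreserving
  have hE' := hq.ae hE
  have hB' := hq.ae hB
  simp only [add_sub_cancel_right] at hE' hB'
  have hfin : volume (Metric.closedBall (0 : R3) R) ≠ ⊤ := measure_closedBall_lt_top.ne
  have hle : ∫⁻ x in Metric.closedBall (0 : R3) R, (‖E (x + q)‖ₑ ^ 2 + ‖B (x + q)‖ₑ ^ 2) ≤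
      ∫⁻ _x in Metric.closedBall (0 : R3) R, 2 * ENNReal.ofReal c ^ 2 := by
    refine lintegral_mono_ae ((ae_restrict_iff' measurableSet_closedBall).2 ?_)
    filter_upwards [hE', hB'] with x h1 h2 hx
    have hx' := mem_closedBall_zero_iff.1 hx
    rw [two_mul, ← ofReal_norm, ← ofReal_norm]
    gcongr
    · exact h1 hx'
    · exact h2 hx'
  unfold localEnergyNorm
  rw [setLIntegral_const] at hle
  calc ((1 / 2 : ℝ≥0∞) * ∫⁻ x in Metric.closedBall (0 : R3) R,
        (‖E (x + q)‖ₑ ^ 2 + ‖B (x + q)‖ₑ ^ 2)) ^ (1 / 2 : ℝ)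
      ≤ ((1 / 2 : ℝ≥0∞) * (2 * ENNReal.ofReal c ^ 2 *
        volume (Metric.closedBall (0 : R3) R))) ^ (1 / 2 : ℝ) := by gcongr
    _ = (ENNReal.ofReal c ^ (2 : ℝ) * volume (Metric.closedBall (0 : R3) R)) ^ (1 / 2 : ℝ) := by
        congr 1
        rw [← mul_assoc, ← mul_assoc, one_div, ENNReal.inv_mul_cancel (by norm_num) (by norm_num),
          one_mul]
        norm_cast
    _ = ENNReal.ofReal c * volume (Metric.closedBall (0 : R3) R) ^ (1 / 2 : ℝ) := by
        rw [ENNReal.mul_rpow_of_nonneg _ _ (by norm_num), ← ENNReal.rpow_mul]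
        norm_num
    _ = ENNReal.ofReal (c * ballRoot R) := by
        rw [ENNReal.ofReal_mul hc, ballRoot, ENNReal.ofReal_toReal
          (ENNReal.rpow_ne_top_of_nonneg (by norm_num) hfin)]

lemma enorm_sub_sq_le (a b : R3) : ‖a - b‖ₑ ^ 2 ≤ 2 * ENNReal.ofReal (‖a‖ ^ 2 + ‖b‖ ^ 2) := by
  have e : 2 * ENNReal.ofReal (‖a‖ ^ 2 + ‖b‖ ^ 2) = ENNReal.ofReal (2 * (‖a‖ ^ 2 + ‖b‖ ^ 2)) := by
    rw [ENNReal.ofReal_mul (by norm_num), ENNReal.ofReal_ofNat]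
  rw [e, ← ofReal_norm, ← ENNReal.ofReal_pow (norm_nonneg _)]
  refine ENNReal.ofReal_le_ofReal ?_
  have h := norm_sub_le a b
  nlinarith [norm_nonneg (a - b), norm_nonneg a, norm_nonneg b, sq_nonneg (‖a‖ - ‖b‖)]

/-- A crude bound of the local energy norm by the global norms of the fields. -/
lemma localEnergyNorm_sub_le {F G : L2Field} {S S' : R3 → R3} {M N R : ℝ} (hF : ‖F‖ ≤ M)
    (hG : ‖G‖ ≤ M) (hS : ∀ x, ‖S x‖ ≤ N) (hS' : ∀ x, ‖S' x‖ ≤ N) (q : R3) :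
    localEnergyNorm R (fun x => F (x + q) - S (x + q)) (fun x => G (x + q) - S' (x + q)) ≤
      ENNReal.ofReal (2 * (M + N * ballRoot R)) := by
  have hM : 0 ≤ M := (norm_nonneg _).trans hF
  have hN : 0 ≤ N := (norm_nonneg _).trans (hS 0)
  set b := ballRoot R
  have hb : 0 ≤ b := ballRoot_nonneg R
  have hfin : volume (Metric.closedBall (0 : R3) R) ≠ ⊤ := measure_closedBall_lt_top.ne
  have hvol : volume (Metric.closedBall (0 : R3) R) = ENNReal.ofReal (b ^ 2) := by
    rw [ENNReal.ofReal_pow hb, show b = ballRoot R from rfl, ballRoot, ENNReal.ofReal_toReal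
      (ENNReal.rpow_ne_top_of_nonneg (by norm_num) hfin), ← ENNReal.rpow_two, ← ENNReal.rpow_mul]
    norm_num
  have hint : ∀ F : L2Field, ‖F‖ ≤ M →
      ∫⁻ x in Metric.closedBall (0 : R3) R, 2 * ENNReal.ofReal (‖F (x + q)‖ ^ 2) ≤
        2 * ENNReal.ofReal (M ^ 2) := by
    intro F hF
    refine (setLIntegral_le_lintegral _ _).trans ?_
    rw [lintegral_const_mul' _ _ (by norm_num),
      lintegral_add_right_eq_self (fun x => ENNReal.ofReal (‖F x‖ ^ 2)) q,
      ← ofReal_integral_eq_lintegral_ofReal ((Lp.memLp F).integrable_norm_pow (by norm_num))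
        (Eventually.of_forall fun _ => by positivity)]
    have h : ‖F‖ ^ 2 = ∫ y, ‖F y‖ ^ 2 := by
      rw [← real_inner_self_eq_norm_sq, L2.inner_def]
      simp only [real_inner_self_eq_norm_sq]
    rw [← h]
    gcongr
  have hmeas : ∀ F : L2Field, Measurable fun x => 2 * ENNReal.ofReal (‖F (x + q)‖ ^ 2) := fun F =>
    ((((Lp.stronglyMeasurable F).measurable.comp (measurable_add_const q)).norm.pow_const
      2).ennreal_ofReal).const_mul 2
  have hsub : ∀ (F : L2Field) (S : R3 → R3), (∀ x, ‖S x‖ ≤ N) → ∀ x,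
      ‖F (x + q) - S (x + q)‖ₑ ^ 2 ≤
        2 * ENNReal.ofReal (‖F (x + q)‖ ^ 2) + 2 * ENNReal.ofReal (N ^ 2) := by
    intro F S hS x
    refine (enorm_sub_sq_le _ _).trans ?_
    rw [ENNReal.ofReal_add (by positivity) (by positivity), mul_add]
    have := hS (x + q)
    gcongr
  have hadd : ∫⁻ x in Metric.closedBall (0 : R3) R, (‖F (x + q) - S (x + q)‖ₑ ^ 2 +
      ‖G (x + q) - S' (x + q)‖ₑ ^ 2) ≤
      4 * (ENNReal.ofReal (M ^ 2) + ENNReal.ofReal (N ^ 2) * ENNReal.ofReal (b ^ 2)) := by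
    calc _ ≤ ∫⁻ x in Metric.closedBall (0 : R3) R, (2 * ENNReal.ofReal (‖F (x + q)‖ ^ 2) +
          (2 * ENNReal.ofReal (‖G (x + q)‖ ^ 2) + 4 * ENNReal.ofReal (N ^ 2))) := by
          refine lintegral_mono fun x => (add_le_add (hsub F S hS x) (hsub G S' hS' x)).trans
            (le_of_eq ?_)
          ring
      _ = (∫⁻ x in Metric.closedBall (0 : R3) R, 2 * ENNReal.ofReal (‖F (x + q)‖ ^ 2)) +
          ((∫⁻ x in Metric.closedBall (0 : R3) R, 2 * ENNReal.ofReal (‖G (x + q)‖ ^ 2)) +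
          4 * ENNReal.ofReal (N ^ 2) * ENNReal.ofReal (b ^ 2)) := by
          rw [lintegral_add_left (hmeas F), lintegral_add_left (hmeas G), setLIntegral_const, hvol]
      _ ≤ 2 * ENNReal.ofReal (M ^ 2) + (2 * ENNReal.ofReal (M ^ 2) +
          4 * ENNReal.ofReal (N ^ 2) * ENNReal.ofReal (b ^ 2)) :=
          add_le_add (hint F hF) (add_le_add (hint G hG) le_rfl)
      _ = _ := by ring
  unfold localEnergyNorm
  have h2 : (2 * (M + N * b)) ^ 2 = 4 * (M ^ 2 + 2 * (M * (N * b)) + (N * b) ^ 2) := by ring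
  calc _ ≤ ((1 / 2 : ℝ≥0∞) * (4 * (ENNReal.ofReal (M ^ 2) +
        ENNReal.ofReal (N ^ 2) * ENNReal.ofReal (b ^ 2)))) ^ (1 / 2 : ℝ) := by gcongr
    _ ≤ (ENNReal.ofReal ((2 * (M + N * b)) ^ 2)) ^ (1 / 2 : ℝ) := by
        gcongr
        rw [← ENNReal.ofReal_mul (by positivity), ← ENNReal.ofReal_add (by positivity)
          (by positivity), show (4 : ℝ≥0∞) = ENNReal.ofReal 4 by simp, ← ENNReal.ofReal_mul
          (by norm_num)]
        calc (1 / 2 : ℝ≥0∞) * ENNReal.ofReal (4 * (M ^ 2 + N ^ 2 * b ^ 2)) ≤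
            1 * ENNReal.ofReal (4 * (M ^ 2 + N ^ 2 * b ^ 2)) := by
              gcongr
              simp
          _ ≤ _ := by
              rw [one_mul]
              refine ENNReal.ofReal_le_ofReal ?_
              rw [h2]
              have : 0 ≤ M * (N * b) := by positivity
              nlinarith
    _ = _ := by
        rw [ENNReal.ofReal_pow (by positivity), ← ENNReal.rpow_two, ← ENNReal.rpow_mul]
        norm_num

/-- Uniform bounds of the soliton fields for velocities bounded away from one. -/
lemma exists_soliton_bound {ρ : R3 → ℝ} (hρ : IsTest ρ) {vbar : ℝ} (hvb1 : vbar < 1) :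
    ∃ N, ∀ v x : R3, ‖v‖ ≤ vbar → ‖solitonE ρ v x‖ ≤ N ∧ ‖solitonB ρ v x‖ ≤ N := by
  obtain ⟨C, hC0, hC⟩ := exists_solitonPotential_bound hvb1
  obtain ⟨K, hK⟩ := exists_isSourceBound hρ
  have hK0 := hK.nonneg
  set I := ∑ i, ∫ y, |dd (ee i) ρ y|
  have hI : 0 ≤ I := Finset.sum_nonneg fun _ _ => integral_nonneg fun _ => abs_nonneg _
  have hint : ∀ a, ∫ y, |dd a ρ y| ≤ ‖a‖ * I := by
    intro a
    have hi : ∀ b, Integrable fun y => |dd b ρ y| := fun b =>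
      ((hρ.dd b).continuous.integrable_of_hasCompactSupport (hρ.dd b).compact).abs
    calc ∫ y, |dd a ρ y| ≤ ∫ y, ∑ i, ‖a‖ * |dd (ee i) ρ y| := by
          refine integral_mono (hi a) (integrable_finsetSum _ fun i _ => (hi _).const_mul _)
            fun y => ?_
          simp only
          rw [dd_eq_sum]
          refine (Finset.abs_sum_le_sum_abs _ _).trans (Finset.sum_le_sum fun i _ => ?_)
          rw [abs_mul]
          gcongr
          exact PiLp.norm_apply_le a i
      _ = ‖a‖ * I := by
          rw [integral_finsetSum _ fun i _ => (hi _).const_mul _]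
          simp only [integral_const_mul, ← Finset.mul_sum, I]
  set P := C * (K + I)
  have hP : 0 ≤ P := by positivity
  have hpot : ∀ a v x : R3, ‖v‖ ≤ vbar → |solitonPotential (dd a ρ) v x| ≤ ‖a‖ * P := by
    intro a v x hv
    have h := hC (dd a ρ) (hρ.dd a).continuous (hρ.dd a).compact (K * ‖a‖) (hK.dd_bound a) v x hv
    have := hint a
    calc _ ≤ _ := h
      _ ≤ C * (K * ‖a‖ + ‖a‖ * I) := by gcongr
      _ = _ := by simp only [P]; ring
  have hnorm : ∀ w : R3, (∀ a, |⟪w, a⟫| ≤ ‖a‖ * (2 * P)) → ‖w‖ ≤ 2 * P := by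
    intro w hw
    have h := hw w
    rw [real_inner_self_eq_norm_sq, abs_of_nonneg (sq_nonneg _), sq] at h
    by_cases h0 : ‖w‖ = 0
    · rw [h0]; positivity
    · exact le_of_mul_le_mul_left h (lt_of_le_of_ne (norm_nonneg _) (Ne.symm h0))
  refine ⟨2 * P, fun v x hv => ?_⟩
  have hv1 : ‖v‖ < 1 := hv.trans_lt hvb1
  refine ⟨hnorm _ fun a => ?_, hnorm _ fun a => ?_⟩
  · rw [inner_solitonE hρ hv1]
    have h1 := hpot a v x hv
    have h2 := hpot v v x hv
    have h3 := abs_real_inner_le_norm v a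
    have h4 : |⟪v, a⟫ * solitonPotential (dd v ρ) v x| ≤ ‖a‖ * P := by
      rw [abs_mul]
      calc _ ≤ (‖v‖ * ‖a‖) * (‖v‖ * P) := by gcongr
        _ ≤ (1 * ‖a‖) * (1 * P) := by gcongr
        _ = _ := by ring
    have h5 := abs_add_le (-solitonPotential (dd a ρ) v x) (⟪v, a⟫ * solitonPotential (dd v ρ) v x)
    rw [abs_neg] at h5
    linarith
  · rw [inner_solitonB hρ hv1, abs_neg]
    have h1 := hpot (cross a v) v x hv
    have h2 : ‖cross a v‖ ≤ ‖a‖ := (norm_cross_le _ _).trans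
      (mul_le_of_le_one_right (norm_nonneg _) hv1.le)
    have h3 : ‖cross a v‖ * P ≤ ‖a‖ * P := by gcongr
    have h4 : 0 ≤ ‖a‖ * P := by positivity
    linarith

lemma continuous_inner_solitonE {ρ : R3 → ℝ} (hρ : IsTest ρ) {v : R3} (hv : ‖v‖ < 1) (q a : R3) :
    Continuous fun x => ⟪solitonE ρ v (x - q), a⟫ := by
  simp only [inner_solitonE hρ hv]
  have h := fun b => continuous_solitonPotential (hρ.dd b) hv
  have h1 := h a
  have h2 := h v
  fun_prop

lemma continuous_inner_solitonB {ρ : R3 → ℝ} (hρ : IsTest ρ) {v : R3} (hv : ‖v‖ < 1) (q a : R3) :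
    Continuous fun x => ⟪solitonB ρ v (x - q), a⟫ := by
  simp only [inner_solitonB hρ hv]
  have h1 := continuous_solitonPotential (hρ.dd (cross a v)) hv
  fun_prop

section Solution

variable {mb : ℝ} {ρ : R3 → ℝ} {Y : ℝ → State}

/-- Decay of the deviation from the comoving soliton, from the decay of the acceleration. -/
lemma IsSolution.exists_localEnergyNorm_bound (hmb : 0 < mb) (hρ : IsTest ρ)
    (hY : IsSolution mb ρ Y) {vbar : ℝ} (hvb1 : vbar < 1) (hvb : ∀ t, 0 ≤ t → ‖(Y t).v‖ ≤ vbar) {σ : ℝ} (hσ : 0 < σ)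
    (hσ1 : σ ≤ 1) (hgood : Y 0 ∈ goodPhaseSpace ρ σ) {Ca : ℝ} (hCa : 0 ≤ Ca)
    (hacc : ∀ t, 0 ≤ t → ‖acceleration mb ρ (Y t)‖ ≤ Ca * (1 + t) ^ (-1 - σ)) {R : ℝ} (hR : 0 < R) :
    ∃ C, 0 ≤ C ∧ ∀ t, 0 ≤ t → localEnergyNorm R
      (fun x => deviationE ρ (Y t) (x + (Y t).q)) (fun x => deviationB ρ (Y t) (x + (Y t).q)) ≤
        ENNReal.ofReal (C * (1 + t) ^ (-1 - σ)) := by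
  obtain ⟨K, hK⟩ := exists_isSourceBound hρ
  obtain ⟨r, hr0, hr⟩ := hρ.exists_radius
  obtain ⟨N, hN⟩ := exists_soliton_bound hρ hvb1
  have hK0 := hK.nonneg
  -- one unit is added to the radius for the test functions that reach beyond the ball
  set T := (R + 1 + r) / (1 - vbar)
  have hvb1' : 0 < 1 - vbar := sub_pos.2 hvb1
  have hT0 : 0 ≤ T := by positivity
  obtain ⟨D, t₁, hD, ht₁, hdev⟩ := hY.exists_deviation_bound hmb hρ hvb1 hvb hσ hgood
    (R := R + 1) (T := T) hK hr hT0 (by simp only [T]; field_simp; exact le_rfl)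
  have hfb : 0 ≤ feedback T := by unfold feedback; positivity
  have ht₁0 : 0 ≤ t₁ := hT0.trans ht₁
  obtain ⟨M, hM⟩ := (isCompact_Icc (a := (0 : ℝ)) (b := t₁)).exists_bound_of_continuousOn
    (f := fun s => ((Y s).E, (Y s).B)) (hY.continuous_E.prodMk hY.continuous_B).continuousOn
  set C₁ := 3 * (D + K * (Ca * (1 + T) ^ 2) * feedback T) * ballRoot R
  have hb := ballRoot_nonneg R
  have hC₁ : 0 ≤ C₁ := by positivity
  set C₂ := |2 * (M + N * ballRoot R)| * (1 + t₁) ^ (1 + σ)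
  have hC₂ : 0 ≤ C₂ := by positivity
  refine ⟨C₁ + C₂, by positivity, fun t ht => ?_⟩
  have hpow : 0 < (1 + t) ^ (-1 - σ) := Real.rpow_pos_of_pos (by linarith) _
  rcases le_total t t₁ with h | h
  · -- bounded times
    have hMt := hM t ⟨ht, h⟩
    simp only [Prod.norm_mk, sup_le_iff] at hMt
    have hvt := hvb t ht
    refine (localEnergyNorm_sub_le (S := fun x => solitonE ρ (Y t).v (x - (Y t).q))
      (S' := fun x => solitonB ρ (Y t).v (x - (Y t).q)) hMt.1 hMt.2
      (fun x => (hN _ _ hvt).1) (fun x => (hN _ _ hvt).2) (Y t).q).trans ?_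
    refine ENNReal.ofReal_le_ofReal ?_
    have h1 : 1 ≤ (1 + t₁) ^ (1 + σ) * (1 + t) ^ (-1 - σ) := by
      rw [show -1 - σ = -(1 + σ) by ring, Real.rpow_neg (by linarith), ← div_eq_mul_inv,
        one_le_div (Real.rpow_pos_of_pos (by linarith) _)]
      exact Real.rpow_le_rpow (by linarith) (by linarith) (by linarith)
    calc 2 * (M + N * ballRoot R) ≤ |2 * (M + N * ballRoot R)| * 1 := by
          rw [mul_one]; exact le_abs_self _
      _ ≤ |2 * (M + N * ballRoot R)| * ((1 + t₁) ^ (1 + σ) * (1 + t) ^ (-1 - σ)) := by gcongr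
      _ = C₂ * (1 + t) ^ (-1 - σ) := by simp only [C₂]; ring
      _ ≤ _ := by gcongr; linarith
  · have hv := hY.norm_v_lt t
    have hA : ∀ s ∈ Set.Icc (t - T) t, ‖acceleration mb ρ (Y s)‖ ≤
        Ca * (1 + T) ^ 2 * (1 + t) ^ (-1 - σ) := by
      intro s hs
      have hs0 : 0 ≤ s := by linarith [hs.1]
      refine (hacc s hs0).trans ?_
      rw [mul_assoc]
      refine mul_le_mul_of_nonneg_left ?_ hCa
      have h1 := one_add_rpow_shift_le (p := 1 + σ) (T := T) (t := t) (by linarith) (by linarith)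
        hT0 (by linarith)
      rw [show -(1 + σ) = -1 - σ by ring] at h1
      exact (Real.rpow_le_rpow_of_nonpos (by linarith) (by linarith [hs.1]) (by linarith)).trans h1
    set c := D * (1 + t) ^ (-1 - σ) + K * (Ca * (1 + T) ^ 2 * (1 + t) ^ (-1 - σ)) * feedback T
    have hc : 0 ≤ c := by positivity
    have hE := ae_norm_sub_le_of_pair (F := (Y t).E) (R := R) (c := c)
      (continuous_inner_solitonE hρ hv (Y t).q) fun χ hχ hs a => (hdev t h _ hA χ hχ hs a).1
    have hB := ae_norm_sub_le_of_pair (F := (Y t).B) (R := R) (c := c)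
      (continuous_inner_solitonB hρ hv (Y t).q) fun χ hχ hs a => (hdev t h _ hA χ hχ hs a).2
    refine (localEnergyNorm_le_of_ae (c := 3 * c) (by positivity) hE hB).trans
      (ENNReal.ofReal_le_ofReal ?_)
    calc 3 * c * ballRoot R = C₁ * (1 + t) ^ (-1 - σ) := by simp only [c, C₁]; ring
      _ ≤ _ := by gcongr; linarith

/-- An integrable acceleration yields an asymptotic velocity. -/
lemma IsSolution.exists_tendsto_v (hmb : 0 < mb) (hρ : IsTest ρ) (hY : IsSolution mb ρ Y)
    {vbar : ℝ} (hvb1 : vbar < 1) (hvb : ∀ t, 0 ≤ t → ‖(Y t).v‖ ≤ vbar) {σ : ℝ} (hσ : 0 < σ)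
    {Ca : ℝ} (hacc : ∀ t, 0 ≤ t → ‖acceleration mb ρ (Y t)‖ ≤ Ca * (1 + t) ^ (-1 - σ)) :
    ∃ vinf : R3, ‖vinf‖ < 1 ∧ Tendsto (fun t => (Y t).v) atTop (𝓝 vinf) := by
  have hint : IntegrableOn (fun t => acceleration mb ρ (Y t)) (Set.Ioi 0) := by
    have h := (integrableOn_add_rpow_Ioi_of_lt (a := -1 - σ) (c := 0) (m := 1) (by linarith)
      (by norm_num)).const_mul Ca
    refine h.mono' (hY.continuous_acceleration hρ).aestronglyMeasurable ?_
    rw [ae_restrict_iff' measurableSet_Ioi]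
    refine Eventually.of_forall fun t ht => ?_
    rw [add_comm t 1]
    exact hacc t (le_of_lt ht)
  have hlim := tendsto_limUnder_of_hasDerivAt_of_integrableOn_Ioi
    (fun t _ => hY.hasDerivAt_v hmb hρ t) hint
  refine ⟨_, lt_of_le_of_lt (le_of_tendsto hlim.norm ?_) hvb1, hlim⟩
  filter_upwards [eventually_ge_atTop 0] with t ht using hvb t ht

end Solution

/-! ### Time reversal -/

/-- The time reversed state: the magnetic field and the velocity change sign. -/
def State.reverse (S : State) : State := ⟨S.E, -S.B, S.q, -S.v⟩

lemma integral_neg_coe (B : L2Field) (η : R3 → R3) :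
    ∫ x, ⟪(-B : L2Field) x, η x⟫ = - ∫ x, ⟪B x, η x⟫ := by
  rw [← integral_neg]
  refine integral_congr_ae ?_
  filter_upwards [Lp.coeFn_neg B] with x hx
  rw [hx, Pi.neg_apply, inner_neg_left]

lemma lorentzForce_reverse (ρ : R3 → ℝ) (S : State) :
    lorentzForce ρ S.reverse = lorentzForce ρ S := by
  unfold lorentzForce State.reverse
  refine integral_congr_ae ?_
  filter_upwards [Lp.coeFn_neg S.B] with x hx
  simp only [hx, Pi.neg_apply, cross_neg_left, cross_neg_right, neg_neg]

lemma acceleration_reverse (mb : ℝ) (ρ : R3 → ℝ) (S : State) :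
    acceleration mb ρ S.reverse = acceleration mb ρ S := by
  unfold acceleration
  rw [lorentzForce_reverse]
  simp [State.reverse]

lemma energy_reverse (mb : ℝ) (S : State) : energy mb S.reverse = energy mb S := by
  unfold energy State.reverse
  rw [norm_neg]
  congr 2
  refine integral_congr_ae ?_
  filter_upwards [Lp.coeFn_neg S.B] with x hx
  simp only [hx, Pi.neg_apply, norm_neg]

lemma reverse_mem_phaseSpace {ρ : R3 → ℝ} {S : State} (h : S ∈ phaseSpace ρ) :
    S.reverse ∈ phaseSpace ρ := by
  refine ⟨by simpa [State.reverse] using h.1, h.2.1, fun φ h1 h2 => ?_⟩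
  have := h.2.2 φ h1 h2
  simp only [State.reverse]
  rw [integral_neg_coe, this]
  simp

lemma reverse_mem_goodPhaseSpace {ρ : R3 → ℝ} {σ : ℝ} {S : State} (h : S ∈ goodPhaseSpace ρ σ) :
    S.reverse ∈ goodPhaseSpace ρ σ := by
  obtain ⟨h0, E, B, hE, hB, R₀, C, hR₀, hb⟩ := h
  refine ⟨reverse_mem_phaseSpace h0, E, fun x => -B x, hE, ?_, R₀, C, hR₀, fun x hx => ?_⟩
  · filter_upwards [Lp.coeFn_neg S.B, hB] with x h1 h2
    simp only [State.reverse]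
    rw [h1, Pi.neg_apply, h2]
  · obtain ⟨h1, h2, h3⟩ := hb x hx
    refine ⟨h1, h2.fun_neg, ?_⟩
    rw [fderiv_fun_neg, norm_neg, norm_neg]
    exact h3

lemma integral_zero_neg {E : Type*} [NormedAddCommGroup E] [NormedSpace ℝ E] (g : ℝ → E) (t : ℝ) :
    ∫ s in (0 : ℝ)..(-t), g s = - ∫ s in (0 : ℝ)..t, g (-s) := by
  rw [intervalIntegral.integral_comp_neg, neg_zero, intervalIntegral.integral_symm]

/-- The equations of motion are invariant under time reversal. -/
lemma IsSolution.reverse {mb : ℝ} {ρ : R3 → ℝ} {Y : ℝ → State} (hY : IsSolution mb ρ Y) :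
    IsSolution mb ρ fun t => (Y (-t)).reverse where
  mem_phaseSpace t := reverse_mem_phaseSpace (hY.mem_phaseSpace _)
  continuous_E := hY.continuous_E.comp continuous_neg
  continuous_B := (hY.continuous_B.comp continuous_neg).neg
  continuous_q := hY.continuous_q.comp continuous_neg
  continuous_v := (hY.continuous_v.comp continuous_neg).neg
  maxwell_E η h1 h2 t := by
    have h := hY.maxwell_E η h1 h2 (-t)
    rw [integral_zero_neg, ← intervalIntegral.integral_neg] at h
    simp only [State.reverse, integral_neg_coe, neg_zero, inner_neg_left, mul_neg, integral_neg]
    rw [h]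
    congr 2; funext s; ring
  maxwell_B η h1 h2 t := by
    have h := hY.maxwell_B η h1 h2 (-t)
    rw [integral_zero_neg] at h
    simp only [State.reverse, integral_neg_coe, neg_zero]
    rw [h]
    ring
  position t := by
    have h := hY.position (-t)
    rw [integral_zero_neg, ← intervalIntegral.integral_neg] at h
    simpa only [State.reverse, neg_zero] using h
  momentum t := by
    have h := hY.momentum (-t)
    rw [integral_zero_neg] at h
    simp only [lorentzForce_reverse]
    simp only [State.reverse, norm_neg, smul_neg, neg_zero]
    rw [h]
    abel

lemma solitonPotential_neg_velocity (ρ : R3 → ℝ) (v : R3) :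
    solitonPotential ρ (-v) = solitonPotential ρ v := by
  funext x
  simp only [solitonPotential, norm_neg, inner_neg_left, neg_sq]

lemma solitonE_neg_velocity (ρ : R3 → ℝ) (v x : R3) : solitonE ρ (-v) x = solitonE ρ v x := by
  simp only [solitonE, solitonPotential_neg_velocity, inner_neg_left, neg_smul_neg]

lemma solitonB_neg_velocity (ρ : R3 → ℝ) (v x : R3) : solitonB ρ (-v) x = - solitonB ρ v x := by
  simp only [solitonB, solitonPotential_neg_velocity, cross_neg_left]

/-- The soliton fields are reversed along with the fields. -/
lemma localEnergyNorm_reverse (ρ : R3 → ℝ) (S : State) (R : ℝ) :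
    localEnergyNorm R (fun x => deviationE ρ S.reverse (x + S.reverse.q))
      (fun x => deviationB ρ S.reverse (x + S.reverse.q)) =
    localEnergyNorm R (fun x => deviationE ρ S (x + S.q)) (fun x => deviationB ρ S (x + S.q)) := by
  unfold localEnergyNorm
  congr 2
  refine lintegral_congr_ae (ae_restrict_of_ae ?_)
  have hq := (measurePreserving_add_right (volume : Measure R3) S.q).quasiMeasurePreserving
  filter_upwards [hq.ae (Lp.coeFn_neg S.B)] with x hx
  have e : deviationB ρ S.reverse (x + S.q) = - deviationB ρ S (x + S.q) := by
    simp only [deviationB, State.reverse, solitonB_neg_velocity]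
    rw [hx, Pi.neg_apply]
    abel
  have e' : deviationE ρ S.reverse (x + S.q) = deviationE ρ S (x + S.q) := by
    simp only [deviationE, State.reverse, solitonE_neg_velocity]
  change ‖deviationE ρ S.reverse (x + S.q)‖ₑ ^ 2 + ‖deviationB ρ S.reverse (x + S.q)‖ₑ ^ 2 = _
  rw [e, e', enorm_neg]

/-! ### Form factors and the asymptotics -/

lemma IsFormFactor.isTest {Rρ : ℝ} {f : R3 → ℝ} (hf : IsFormFactor Rρ f) : IsTest f :=
  ⟨hf.smooth, hasCompactSupport_of_bound fun x hx => by
    by_contra h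
    exact hx (hf.support x (not_le.1 h).le)⟩

lemma IsFormFactor.even {Rρ : ℝ} {f : R3 → ℝ} (hf : IsFormFactor Rρ f) (x : R3) : f (-x) = f x := by
  obtain ⟨fr, hfr⟩ := hf.radial
  rw [hfr, hfr, norm_neg]

/-- The asymptotics for positive times. The smallness condition bounds the response of the
acceleration to itself through the emitted field. -/
lemma IsSolution.forward_asymptotics {mb : ℝ} (hmb : 0 < mb) {ρ : R3 → ℝ} (hρ : IsTest ρ)
    (he : ∀ x, ρ (-x) = ρ x) {vbar : ℝ} (hvbar₀ : 0 ≤ vbar) (hvb1 : vbar < 1) {r T K : ℝ}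
    (hK : IsSourceBound K ρ) (hr : ∀ x, ρ x ≠ 0 → ‖x‖ ≤ r) (hT0 : 0 ≤ T)
    (hT : r + r ≤ T * (1 - vbar))
    (hsmall : 4 / mb * (∫ x, |ρ x|) * (K * feedback T) * (1 + T) ^ 2 ≤ 1 / 2)
    {σ : ℝ} (hσ : 0 < σ) (hσ1 : σ ≤ 1) {Y : ℝ → State} (hY : IsSolution mb ρ Y)
    (hgood : Y 0 ∈ goodPhaseSpace ρ σ) (hE : energy mb (Y 0) ≤ mb * lorentzFactor vbar) :
    (∀ R : ℝ, 0 < R → ∃ C, 0 ≤ C ∧ ∀ t, 0 ≤ t → localEnergyNorm R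
      (fun x => deviationE ρ (Y t) (x + (Y t).q)) (fun x => deviationB ρ (Y t) (x + (Y t).q)) ≤
        ENNReal.ofReal (C * (1 + t) ^ (-1 - σ))) ∧
    (∃ C, 0 ≤ C ∧ ∀ t, 0 ≤ t → ‖acceleration mb ρ (Y t)‖ ≤ C * (1 + t) ^ (-1 - σ)) ∧
    ∃ vinf : R3, ‖vinf‖ < 1 ∧ Tendsto (fun t => (Y t).v) atTop (𝓝 vinf) := by
  have hvb : ∀ t, 0 ≤ t → ‖(Y t).v‖ ≤ vbar := fun t ht => hY.norm_v_le hmb hρ hvbar₀ hvb1 hE ht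
  obtain ⟨Ca, hCa, hacc⟩ :=
    hY.exists_acceleration_bound hmb hρ he hvb1 hvb hσ hσ1 hgood hK hr hT0 hT hsmall
  exact ⟨fun R hR => hY.exists_localEnergyNorm_bound hmb hρ hvb1 hvb hσ hσ1 hgood hCa hacc hR,
    ⟨Ca, hCa, hacc⟩, hY.exists_tendsto_v hmb hρ hvb1 hvb hσ hacc⟩

end AbrahamModel
end

theorem mainTheorem3 (mb : ℝ) (hmb : 0 < mb) (Rρ : ℝ) (f : AbrahamModel.R3 → ℝ)
    (hf : AbrahamModel.IsFormFactor Rρ f) (vbar : ℝ) (hvbar₀ : 0 ≤ vbar) (hvbar₁ : vbar < 1) :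
    ∃ ebar : ℝ, 0 < ebar ∧
      ∀ e : ℝ, |e| ≤ ebar →
      ∀ σ : ℝ, 0 < σ → σ ≤ 1 →
      ∀ Y : ℝ → AbrahamModel.State,
        AbrahamModel.IsSolution mb (AbrahamModel.chargeDistribution e f) Y →
        Y 0 ∈ AbrahamModel.goodPhaseSpace (AbrahamModel.chargeDistribution e f) σ →
        AbrahamModel.energy mb (Y 0) ≤ mb * AbrahamModel.lorentzFactor vbar →
        (∀ R : ℝ, 0 < R → ∃ C : ℝ, ∀ t : ℝ,
          AbrahamModel.localEnergyNorm R
              (fun x => AbrahamModel.deviationE (AbrahamModel.chargeDistribution e f) (Y t)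
                (x + (Y t).q))
              (fun x => AbrahamModel.deviationB (AbrahamModel.chargeDistribution e f) (Y t)
                (x + (Y t).q))
            ≤ ENNReal.ofReal (C * (1 + |t|) ^ (-1 - σ))) ∧
        (∃ C : ℝ, ∀ t : ℝ, ∃ a : AbrahamModel.R3,
          HasDerivAt (fun s => (Y s).v) a t ∧ ‖a‖ ≤ C * (1 + |t|) ^ (-1 - σ)) ∧
        (∃ vinf : AbrahamModel.R3, ‖vinf‖ < 1 ∧
          Tendsto (fun t => (Y t).v) atTop (𝓝 vinf)) := by
  have hft := hf.isTest
  obtain ⟨r, hr0, hr⟩ := hft.exists_radius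
  obtain ⟨K, hK⟩ := AbrahamModel.exists_isSourceBound hft
  have hK0 := hK.nonneg
  have hI : 0 ≤ ∫ x, |f x| := integral_nonneg fun _ => abs_nonneg _
  have hv : 0 < 1 - vbar := sub_pos.2 hvbar₁
  -- the time after which the charge has left the backward light cone of its present support
  set T := (r + r) / (1 - vbar)
  have hT0 : 0 ≤ T := by positivity
  have hT : r + r ≤ T * (1 - vbar) := by rw [div_mul_cancel₀ _ hv.ne']
  have hfb : 0 ≤ AbrahamModel.feedback T := by unfold AbrahamModel.feedback; positivity
  -- the self-interaction is quadratic in the charge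
  set Λ := 4 / mb * (∫ x, |f x|) * (K * AbrahamModel.feedback T) * (1 + T) ^ 2
  have hΛ : 0 ≤ Λ := by positivity
  refine ⟨min 1 (1 / (2 * (Λ + 1))), by positivity, fun e he σ hσ hσ1 Y hY hgood hE => ?_⟩
  set ρ := AbrahamModel.chargeDistribution e f
  have hρ : AbrahamModel.IsTest ρ := hft.const_mul e
  have hρe : ∀ x, ρ (-x) = ρ x := fun x => by
    simp only [ρ, AbrahamModel.chargeDistribution, hf.even x]
  have hρr : ∀ x, ρ x ≠ 0 → ‖x‖ ≤ r := fun x hx => hr x (right_ne_zero_of_mul hx)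
  have hρK : AbrahamModel.IsSourceBound (|e| * K) ρ := hK.const_mul hft e
  have hρI : ∫ x, |ρ x| = |e| * ∫ x, |f x| := by
    simp only [ρ, AbrahamModel.chargeDistribution, abs_mul, integral_const_mul]
  have hsmall : 4 / mb * (∫ x, |ρ x|) * (|e| * K * AbrahamModel.feedback T) * (1 + T) ^ 2 ≤
      1 / 2 := by
    rw [hρI]
    have h1 : |e| ≤ 1 := he.trans (min_le_left _ _)
    have h2 : |e| ≤ 1 / (2 * (Λ + 1)) := he.trans (min_le_right _ _)
    have h0 := abs_nonneg e
    calc _ = |e| * |e| * Λ := by simp only [Λ]; ring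
      _ ≤ 1 * |e| * Λ := by gcongr
      _ ≤ 1 * (1 / (2 * (Λ + 1))) * (Λ + 1) := by gcongr; linarith
      _ = 1 / 2 := by field_simp
  obtain ⟨h1, ⟨C, hC0, hC⟩, h3⟩ := hY.forward_asymptotics hmb hρ hρe hvbar₀ hvbar₁ hρK hρr hT0 hT
    hsmall hσ hσ1 hgood hE
  obtain ⟨h1', ⟨C', hC0', hC'⟩, -⟩ := hY.reverse.forward_asymptotics hmb hρ hρe hvbar₀ hvbar₁ hρK
    hρr hT0 hT hsmall hσ hσ1
    (by simpa using AbrahamModel.reverse_mem_goodPhaseSpace hgood)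
    (by simpa [AbrahamModel.energy_reverse] using hE)
  have hpow : ∀ t : ℝ, 0 ≤ (1 + |t|) ^ (-1 - σ) := fun t => by positivity
  refine ⟨fun R hR => ?_, ⟨C + C', fun t => ⟨_, hY.hasDerivAt_v hmb hρ t, ?_⟩⟩, h3⟩
  · obtain ⟨D, hD0, hD⟩ := h1 R hR
    obtain ⟨D', hD0', hD'⟩ := h1' R hR
    refine ⟨D + D', fun t => ?_⟩
    rcases le_total 0 t with ht | ht
    · refine (hD t ht).trans (ENNReal.ofReal_le_ofReal ?_)
      rw [← abs_of_nonneg ht, abs_abs]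
      exact mul_le_mul_of_nonneg_right (by linarith) (hpow t)
    · have h := hD' (-t) (neg_nonneg.2 ht)
      simp only [AbrahamModel.localEnergyNorm_reverse, neg_neg] at h
      refine h.trans (ENNReal.ofReal_le_ofReal ?_)
      rw [← abs_of_nonpos ht]
      exact mul_le_mul_of_nonneg_right (by linarith) (hpow t)
  · rcases le_total 0 t with ht | ht
    · have h := hC t ht
      rw [← abs_of_nonneg ht] at h
      refine (le_of_eq ?_).trans (h.trans (mul_le_mul_of_nonneg_right (by linarith) (hpow t)))
      rw [abs_of_nonneg ht]
    · have h := hC' (-t) (neg_nonneg.2 ht)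
      rw [AbrahamModel.acceleration_reverse, neg_neg, ← abs_of_nonpos ht] at h
      exact h.trans (mul_le_mul_of_nonneg_right (by linarith) (hpow t))
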